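/- Let $k\ge 1$ be an integer and let $w(u)=u^{-1}e^{-(k^2/4)(\log u)^2}$ for $u\in\mathbb R_+=(0,\infty)$. For a Borel measure $\mu$ on $\mathbb R_+$ of total mass $k+1$ for which $x\mapsto\log(z-x)$ is $\mu$-integrable for every $z\in\mathbb C\setminus[0,\infty)$, put $G(z)=\int\log(z-x)\,d\mu(x)$ (principal branch). Call $\mu$ an *equilibrium measure* for $w$ if the boundary values $G_\pm(x)=\lim_{\varepsilon\downarrow0}G(x\pm i\varepsilon)$ exist for all $x\in\mathbb R_+$ and there is a real constant $\ell$ with $G_+(x)+G_-(x)+\log w(x)-\ell=0$ for $x\in\mathbb R_+\cap\operatorname{supp}\mu$ and $G_+(x)+G_-(x)+\log w(x)-\ell<0$ for $x\in\mathbb R_+\setminus\operatorname{supp}\mu$. Then $w$ has exactly one equilibrium measure $\mu$ of total mass $k+1$. Its support is $[a,b]$, where $0<a<b$ are given by $$\sqrt a=e^{(2k+1)/k^2}-\sqrt{e^{(4k+2)/k^2}-e^{2/k}},\qquad \sqrt b=e^{(2k+1)/k^2}+\sqrt{e^{(4k+2)/k^2}-e^{2/k}},$$ and $d\mu(x)=\psi(x)\,dx$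 on $[a,b]$ with $$\psi(x)=\frac{k^2}{2\pi x}\arctan\left(\frac{\sqrt{(b-x)(x-a)}}{\sqrt{ab}+x}\right),\qquad x\in[a,b].$$ Moreover, for $x\in[a,b]$, $$\psi(x)=\frac1{2\pi}\sqrt{(b-x)(x-a)}\;h(x),\qquad h(x)=\frac1{2\pi i}\oint_C\frac{-(\log w)'(s)}{(s-x)R(s)}\,ds,$$ for every piecewise $C^1$ simple closed contour $C$, oriented counterclockwise, that has $[a,b]$ in its interior and does not meet $(-\infty,0]$. Here $\log w(s)=-\frac{k^2}{4}(\log s)^2-\log s$ with the principal logarithm on $\mathbb C\setminus(-\infty,0]$, and $R(s)=((s-a)(s-b))^{1/2}$ is the branch analytic on $\mathbb C\setminus[a,b]$ with $R(s)\sim s$ as $s\to\infty$. -/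

import Mathlib

open MeasureTheory Set Filter Topology

noncomputable section

namespace StieltjesWigert

/-- The weight `w(u) = u⁻¹ exp(-(k²/4) (log u)²)` on `(0, ∞)`. -/
def weight (k : ℕ) (u : ℝ) : ℝ :=
  1 / u * Real.exp (-((k : ℝ) ^ 2 / 4) * Real.log u ^ 2)

/-- `G(z) = ∫ log (z - x) dμ(x)`, with the principal branch of the logarithm. -/
def gFun (μ : Measure ℝ) (z : ℂ) : ℂ := ∫ x, Complex.log (z - (x : ℂ)) ∂μ

/-- `μ` is an equilibrium measure of total mass `m` on `(0, ∞)` for the weight `w`: its function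
`G` has boundary values `G₊`, `G₋` on `(0, ∞)` from above and below and, for some constant `ℓ`,
`G₊ + G₋ + log w - ℓ` vanishes on the support of `μ` and is (real and) negative at the other points
of `(0, ∞)`. All Borel measures are admitted, not only those with a density. -/
structure IsEquilibriumMeasure (w : ℝ → ℝ) (m : ℝ) (μ : Measure ℝ) : Prop where
  mass : μ univ = ENNReal.ofReal m
  null_Iic : μ (Iic 0) = 0
  integrable_log : ∀ z : ℂ, z ∉ ((↑) : ℝ → ℂ) '' Ici 0 →
    Integrable (fun x : ℝ => Complex.log (z - (x : ℂ))) μ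
  variational : ∃ (Gplus Gminus : ℝ → ℂ) (l : ℝ), ∀ x : ℝ, 0 < x →
    Tendsto (fun ε : ℝ => gFun μ (x + ε * Complex.I)) (𝓝[>] 0) (𝓝 (Gplus x)) ∧
    Tendsto (fun ε : ℝ => gFun μ (x - ε * Complex.I)) (𝓝[>] 0) (𝓝 (Gminus x)) ∧
    (x ∈ μ.support → Gplus x + Gminus x + (Real.log (w x) : ℂ) - (l : ℂ) = 0) ∧
    (x ∉ μ.support →
      ∃ r : ℝ, r < 0 ∧ Gplus x + Gminus x + (Real.log (w x) : ℂ) - (l : ℂ) = (r : ℂ))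

/-- The square root of the left endpoint. -/
def sqrtA (k : ℕ) : ℝ :=
  Real.exp ((2 * k + 1) / (k : ℝ) ^ 2) -
    √(Real.exp ((4 * k + 2) / (k : ℝ) ^ 2) - Real.exp (2 / (k : ℝ)))

/-- The square root of the right endpoint. -/
def sqrtB (k : ℕ) : ℝ :=
  Real.exp ((2 * k + 1) / (k : ℝ) ^ 2) +
    √(Real.exp ((4 * k + 2) / (k : ℝ) ^ 2) - Real.exp (2 / (k : ℝ)))

/-- `ψ(x) = k² / (2 π x) * arctan (√((b - x) (x - a)) / (√(a b) + x))`. -/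
def density (k : ℕ) (a b x : ℝ) : ℝ :=
  (k : ℝ) ^ 2 / (2 * Real.pi * x) * Real.arctan (√((b - x) * (x - a)) / (√(a * b) + x))

/-- A piecewise continuously differentiable simple closed curve, parametrized by `[0, 1]`. -/
structure IsSimpleClosedContour (γ : ℝ → ℂ) : Prop where
  closed : γ 0 = γ 1
  simple : InjOn γ (Ico 0 1)
  piecewise_contDiff : ∃ (n : ℕ) (t : Fin (n + 1) → ℝ), StrictMono t ∧ t 0 = 0 ∧
    t (Fin.last n) = 1 ∧ ∀ i : Fin n, ContDiffOn ℝ 1 γ (Icc (t i.castSucc) (t i.succ))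

/-- The contour integral `∮ f(s) ds` along `γ`. -/
def contourIntegral (f : ℂ → ℂ) (γ : ℝ → ℂ) : ℂ := ∫ t in (0 : ℝ)..1, f (γ t) * deriv γ t

/-- `p` does not lie on `γ` and `γ` has winding number `1` about `p`; for a simple closed contour
this says that `γ` is oriented counterclockwise and that `p` lies inside it. -/
def EnclosesCounterclockwise (γ : ℝ → ℂ) (p : ℂ) : Prop :=
  p ∉ γ '' Icc 0 1 ∧
    1 / (2 * Real.pi * Complex.I) * contourIntegral (fun s => 1 / (s - p)) γ = 1

/-- The analytic continuation of `log w` from `(0, ∞)` to `ℂ \ (-∞, 0]`. -/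
def logWeight (k : ℕ) (s : ℂ) : ℂ := -((k : ℂ) ^ 2 / 4) * Complex.log s ^ 2 - Complex.log s

/-- The branch of `((z - a) (z - b))^(1/2)` that is analytic off `[a, b]` and
asymptotic to `z` at infinity. -/
def sqrtR (a b : ℝ) (z : ℂ) : ℂ := (z - a) ^ (1 / 2 : ℂ) * (z - b) ^ (1 / 2 : ℂ)

/-- `h(z) = (2 π i)⁻¹ ∮ -(log w)'(s) / ((s - z) R(s)) ds` along `γ`. -/
def hFun (k : ℕ) (a b : ℝ) (γ : ℝ → ℂ) (z : ℂ) : ℂ :=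
  1 / (2 * Real.pi * Complex.I) *
    contourIntegral (fun s => -deriv (logWeight k) s / ((s - z) * sqrtR a b s)) γ

end StieltjesWigert

end

namespace StieltjesWigert

/-! ### Integrals over the circle -/

/-! The measure is built explicitly as a superposition of arcsine laws. For `0 < v < c` let `I_v` be
the interval whose endpoints are the roots of `(v y + 1)² = 4 c y`. These intervals shrink to the
point `1/c` as `v` increases to `c`. The arcsine laws of the `I_v` are mixed with weight `K dv / v`
over `v₀ < v < c`. Integrating their densities in `v` gives `K / (π y) · arccos ((v₀ y + 1) / (2 √(c
y)))`, a rewriting of the density `ψ`.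

The potential of an arcsine law is constant on its interval and grows like an inverse hyperbolic
cosine outside. Since `1/c` lies in every `I_v`, the difference of the mixed potential at `x` and at
`1/c` is an integral over `v` of such terms alone. Writing each of them as an integral over `u`
between `1/c` and `x`, and exchanging the integrals, turns the difference into `(K/4) log² (c x)`
minus a remainder. The remainder vanishes on `I_{v₀}` and is positive off it
(`potential_mixture_of_ge`, `potential_mixture_of_le`). Completing the square in `log w` gives `K =
k²/2` and `c = e^{2/k²}`; the mass `K log (c/v₀) = k + 1` then gives `v₀ = e^{-2/k}`.

For uniqueness, the existence of the boundary values of `G` excludes atoms on `(0, ∞)` and makes the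
real potentials finite, so the conditions become real (`IsEquilibriumMeasure.exists_potential`). The
growth of `log² x` confines the positive part of the support to a compact subset of `(0, ∞)`.
Integrating the two sets of conditions against the two measures shows that their difference has
nonnegative energy `∬ log |x - y|`. For equal masses this energy is minus a weighted integral of the
squared modulus of the difference of the characteristic functions, so the measures agree
(`eq_of_energy_nonneg`).

For the formula with `h`, the function `1/R` is the Cauchy transform of the arcsine law of `[a, b]`.
Cauchy's formula therefore makes `h(x)` the mean over `y`, under that law, of the difference
quotients of `V' = -(log w)'`. Because `V'(y) = K log (c y) / y` and the endpoints give `log (c y) /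
y` mean zero, only the quotients of `log` remain, and their mean is an arctangent
(`integral_field_slope_arcsine`). -/

lemma circleMap_zero_one (θ : ℝ) : circleMap 0 1 θ = Complex.exp (θ * Complex.I) := by
  simp [circleMap]

lemma circleMap_add_inv (θ : ℝ) :
    circleMap 0 1 θ + (circleMap 0 1 θ)⁻¹ = 2 * (Real.cos θ : ℂ) := by
  rw [circleMap_zero_one, ← Complex.exp_neg, Complex.ofReal_cos, Complex.cos]
  ring_nf

/-- The Joukowski substitution: on the unit circle `cos θ - z` factors through `ζ` and `ζ⁻¹`, so
means over the arcsine law become circle integrals. -/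
lemma circleMap_sub_mul_sub_inv {ζ z : ℂ} (hζ : ζ ≠ 0) (hz : ζ + ζ⁻¹ = 2 * z) (θ : ℝ) :
    (circleMap 0 1 θ - ζ) * (circleMap 0 1 θ - ζ⁻¹) =
      2 * circleMap 0 1 θ * ((Real.cos θ : ℂ) - z) := by
  have h0 : circleMap 0 1 θ ≠ 0 := circleMap_ne_center one_ne_zero
  have h := circleMap_add_inv θ
  have e : (circleMap 0 1 θ - ζ) * (circleMap 0 1 θ - ζ⁻¹) =
      circleMap 0 1 θ * ((circleMap 0 1 θ + (circleMap 0 1 θ)⁻¹) - (ζ + ζ⁻¹)) := by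
    field_simp
    ring
  rw [e, h, hz]
  ring

lemma integral_comp_cos_zero_two_pi {E : Type*} [NormedAddCommGroup E] [NormedSpace ℝ E]
    (f : ℝ → E)
    (hf : IntervalIntegrable (fun θ => f (Real.cos θ)) volume 0 (2 * Real.pi)) :
    ∫ θ in (0 : ℝ)..(2 * Real.pi), f (Real.cos θ) =
      (2 : ℝ) • ∫ θ in (0 : ℝ)..Real.pi, f (Real.cos θ) := by
  have hpi := Real.pi_pos
  have h1 : IntervalIntegrable (fun θ => f (Real.cos θ)) volume 0 Real.pi :=
    hf.mono_set (by
      rw [uIcc_of_le (by linarith), uIcc_of_le (by linarith)]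
      exact Icc_subset_Icc le_rfl (by linarith))
  have h2 : IntervalIntegrable (fun θ => f (Real.cos θ)) volume Real.pi (2 * Real.pi) :=
    hf.mono_set (by
      rw [uIcc_of_le (by linarith), uIcc_of_le (by linarith)]
      exact Icc_subset_Icc (by linarith) le_rfl)
  rw [← intervalIntegral.integral_add_adjacent_intervals h1 h2, two_smul]
  congr 1
  have := intervalIntegral.integral_comp_sub_left (a := 0) (b := Real.pi)
    (fun θ => f (Real.cos θ)) (2 * Real.pi)
  rw [show 2 * Real.pi - Real.pi = Real.pi by ring, sub_zero] at this
  rw [← this]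
  simp [Real.cos_two_pi_sub]

/-- The inverse hyperbolic cosine, extended by zero to the left of `1`. -/
noncomputable def arch (ξ : ℝ) : ℝ := Real.arcosh (max 1 ξ)

lemma arch_of_le {ξ : ℝ} (h : ξ ≤ 1) : arch ξ = 0 := by simp [arch, max_eq_left h]

lemma arch_of_ge {ξ : ℝ} (h : 1 ≤ ξ) : arch ξ = Real.arcosh ξ := by simp [arch, max_eq_right h]

lemma arch_nonneg (ξ : ℝ) : 0 ≤ arch ξ := Real.arcosh_nonneg (le_max_left _ _)

lemma arch_pos {ξ : ℝ} (h : 1 < ξ) : 0 < arch ξ := by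
  rw [arch_of_ge h.le]; exact Real.arcosh_pos h

lemma continuous_arch : Continuous arch :=
  Real.continuousOn_arcosh.comp_continuous (by fun_prop) fun _ => mem_Ici.2 (le_max_left _ _)

/-- Jensen's formula gives `log⁺ ‖ζ‖ + log⁺ ‖ζ‖⁻¹ = |log ‖ζ‖|` for the circle average of the two
factors. Points `ζ` on the circle are included. -/
lemma log_potential_cos_of_joukowski {ζ : ℂ} {ξ : ℝ} (hζ : ζ ≠ 0) (hz : ζ + ζ⁻¹ = 2 * (ξ : ℂ))
    {r : ℝ} (hr : 0 < r) :
    ∫ θ in (0 : ℝ)..Real.pi, Real.log |r * (ξ - Real.cos θ)| =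
      Real.pi * (|Real.log ‖ζ‖| + Real.log (r / 2)) := by
  have hpi := Real.pi_pos
  have key : ∀ θ : ℝ, Real.log ‖((r / 2 : ℝ) : ℂ) * ((circleMap 0 1 θ - ζ) * (circleMap 0 1 θ - ζ⁻¹))‖ =
      Real.log |r * (ξ - Real.cos θ)| := by
    intro θ
    rw [circleMap_sub_mul_sub_inv hζ hz, norm_mul, norm_mul, norm_mul, norm_circleMap_zero,
      ← Complex.ofReal_sub, Complex.norm_real, Complex.norm_real, Real.norm_eq_abs,
      Real.norm_eq_abs, abs_sub_comm, abs_mul, abs_div]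
    simp
    ring_nf
  have hint : CircleIntegrable (fun w : ℂ => Real.log ‖((r / 2 : ℝ) : ℂ) * ((w - ζ) * (w - ζ⁻¹))‖) 0 1 :=
    MeromorphicOn.circleIntegrable_log_norm (fun z _ => by fun_prop)
  have havg : Real.circleAverage (fun w : ℂ => Real.log ‖((r / 2 : ℝ) : ℂ) * ((w - ζ) * (w - ζ⁻¹))‖) 0 1 =
      |Real.log ‖ζ‖| + Real.log (r / 2) := by
    have e1 : Real.circleAverage (fun w : ℂ => Real.log ‖((r / 2 : ℝ) : ℂ) * ((w - ζ) * (w - ζ⁻¹))‖) 0 1 =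
        Real.circleAverage (fun w : ℂ => (Real.log ‖w - ζ‖ + Real.log ‖w - ζ⁻¹‖) +
          Real.log (r / 2)) 0 1 := by
      apply Real.circleAverage_congr_codiscreteWithin _ one_ne_zero
      -- At these two points the convention `log 0 = 0` would spoil the additivity of the logarithm.
      have : ({ζ, ζ⁻¹}ᶜ : Set ℂ) ∈ codiscreteWithin (Metric.sphere (0 : ℂ) |1|) := by
        exact codiscreteWithin_mono (subset_univ _) (Set.toFinite _).compl_mem_codiscrete
      filter_upwards [this] with w hw
      simp only [mem_compl_iff, mem_insert_iff, mem_singleton_iff, not_or] at hw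
      have h1 := norm_ne_zero_iff.2 (sub_ne_zero.2 hw.1)
      have h2 := norm_ne_zero_iff.2 (sub_ne_zero.2 hw.2)
      rw [norm_mul, norm_mul, Real.log_mul (by simp [hr.ne']) (mul_ne_zero h1 h2), Real.log_mul h1 h2]
      rw [Complex.norm_real, Real.norm_eq_abs, abs_of_pos (by positivity)]
      ring
    have h2 : CircleIntegrable (fun w : ℂ => Real.log ‖w - ζ‖ + Real.log ‖w - ζ⁻¹‖) 0 1 :=
      (circleIntegrable_log_norm_sub_const 1).add (circleIntegrable_log_norm_sub_const 1)
    rw [e1, Real.circleAverage_fun_add h2 (circleIntegrable_const _ _ _),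
      Real.circleAverage_fun_add (circleIntegrable_log_norm_sub_const 1)
      (circleIntegrable_log_norm_sub_const 1), circleAverage_log_norm_sub_const_eq_posLog,
      circleAverage_log_norm_sub_const_eq_posLog, norm_inv, Real.circleAverage_const]
    have := Real.half_mul_log_add_log_abs (x := ‖ζ‖)
    have h2 := Real.half_mul_log_add_log_abs (x := ‖ζ‖⁻¹)
    rw [Real.log_inv, abs_neg] at h2
    linarith
  unfold CircleIntegrable at hint
  rw [Real.circleAverage_def] at havg
  simp only [key] at hint havg
  rw [integral_comp_cos_zero_two_pi (fun y => Real.log |r * (ξ - y)|) hint, smul_eq_mul, smul_eq_mul]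
    at havg
  rw [← havg]
  field_simp

/-- The logarithmic potential of the arcsine law on `[-1, 1]`, scaled by `r`. -/
lemma integral_log_abs_sub_cos (ξ : ℝ) {r : ℝ} (hr : 0 < r) :
    ∫ θ in (0 : ℝ)..Real.pi, Real.log |r * (ξ - Real.cos θ)| =
      Real.pi * (arch |ξ| + Real.log (r / 2)) := by
  rcases le_or_gt |ξ| 1 with h | h
  -- Inside the interval `ζ` is taken on the unit circle; outside, `ζ` is real with `|log |ζ|| =
  -- arcosh |ξ|`.
  · have hne : Complex.exp (Real.arccos ξ * Complex.I) ≠ 0 := Complex.exp_ne_zero _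
    rw [log_potential_cos_of_joukowski (ξ := ξ) hne (hr := hr), arch_of_le h,
      Complex.norm_exp_ofReal_mul_I]
    · simp
    · rw [← circleMap_zero_one, circleMap_add_inv, Real.cos_arccos (abs_le.1 h).1 (abs_le.1 h).2]
  · have hs : 0 ≤ ξ ^ 2 - 1 := by nlinarith [sq_abs ξ]
    have hsq := Real.sq_sqrt hs
    have h1 : (1 : ℝ) ≤ |ξ| + √(|ξ| ^ 2 - 1) := by
      have := Real.sqrt_nonneg (|ξ| ^ 2 - 1)
      linarith
    rcases le_or_gt 0 ξ with h0 | h0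
    · rw [abs_of_nonneg h0] at h h1 ⊢
      have hp : 0 < ξ + √(ξ ^ 2 - 1) := by linarith
      have hne : ((ξ + √(ξ ^ 2 - 1) : ℝ) : ℂ) ≠ 0 := by exact_mod_cast hp.ne'
      rw [log_potential_cos_of_joukowski (ξ := ξ) hne (hr := hr), Complex.norm_real, arch_of_ge h.le,
        Real.arcosh, Real.norm_eq_abs, abs_of_pos hp, abs_of_nonneg (Real.log_nonneg h1)]
      rw [← Complex.ofReal_inv, Real.add_sqrt_self_sq_sub_one_inv h.le]
      push_cast; ring
    · rw [abs_of_neg h0] at h h1 ⊢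
      have hp : 0 < -ξ + √((-ξ) ^ 2 - 1) := by linarith
      have hne : ((-(-ξ + √((-ξ) ^ 2 - 1)) : ℝ) : ℂ) ≠ 0 := by
        exact_mod_cast neg_ne_zero.2 hp.ne'
      rw [log_potential_cos_of_joukowski (ξ := ξ) hne (hr := hr), Complex.norm_real, arch_of_ge h.le,
        Real.arcosh, norm_neg, Real.norm_eq_abs, abs_of_pos hp,
        abs_of_nonneg (Real.log_nonneg h1)]
      rw [← Complex.ofReal_inv, inv_neg, Real.add_sqrt_self_sq_sub_one_inv h.le]
      push_cast; ring

/-- The Cauchy transform of the arcsine law on `[-1, 1]` in Joukowski coordinates. -/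
lemma integral_inv_sub_cos {ζ z : ℂ} (hζ : ζ ≠ 0) (hζ1 : ‖ζ‖ < 1) (hz : ζ + ζ⁻¹ = 2 * z) :
    ∫ θ in (0 : ℝ)..Real.pi, (z - (Real.cos θ : ℂ))⁻¹ = 2 * Real.pi / (ζ⁻¹ - ζ) := by
  have hinv : 1 < ‖ζ⁻¹‖ := by
    rw [norm_inv]; exact (one_lt_inv₀ (norm_pos_iff.2 hζ)).2 hζ1
  have hw : ∀ w : ℂ, ‖w‖ ≤ 1 → w - ζ⁻¹ ≠ 0 := by
    intro w hw h
    rw [sub_eq_zero] at h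
    rw [h] at hw
    linarith
  have hd : DifferentiableOn ℂ (fun w : ℂ => (w - ζ⁻¹)⁻¹) (Metric.closedBall 0 1) := by
    intro w hw'
    have : DifferentiableAt ℂ (fun w : ℂ => w - ζ⁻¹) w := by fun_prop
    exact (this.inv (hw w (by simpa using hw'))).differentiableWithinAt
  -- Of the two poles only `ζ` lies in the disc, so Cauchy's formula is applied to `(w - ζ⁻¹)⁻¹`.
  have hC := hd.circleIntegral_sub_inv_smul (w := ζ) (by simpa using hζ1)
  have hne : ζ - ζ⁻¹ ≠ 0 := hw ζ hζ1.le
  have hpt : ∀ θ : ℝ, (z - (Real.cos θ : ℂ))⁻¹ =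
      (-2 / Complex.I) * (deriv (circleMap 0 1) θ •
        ((circleMap 0 1 θ - ζ)⁻¹ • (circleMap 0 1 θ - ζ⁻¹)⁻¹)) := by
    intro θ
    have h := circleMap_sub_mul_sub_inv hζ hz θ
    have h0 : circleMap 0 1 θ ≠ 0 := circleMap_ne_center one_ne_zero
    rw [smul_eq_mul, smul_eq_mul, ← mul_inv, h, deriv_circleMap, mul_inv, mul_inv,
      ← neg_sub z, inv_neg]
    field_simp
  have hcont : Continuous fun θ : ℝ => (z - (Real.cos θ : ℂ))⁻¹ := by
    apply Continuous.inv₀ (by fun_prop)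
    intro θ h
    have h' := circleMap_sub_mul_sub_inv hζ hz θ
    rw [← neg_sub z, h, neg_zero, mul_zero, mul_eq_zero] at h'
    have hn : ‖circleMap 0 1 θ‖ = 1 := by simp
    rcases h' with h' | h'
    · rw [sub_eq_zero] at h'
      rw [h'] at hn; linarith
    · exact hw _ hn.le h'
  have h2 := integral_comp_cos_zero_two_pi (fun y : ℝ => (z - (y : ℂ))⁻¹)
    (hcont.intervalIntegrable _ _)
  rw [intervalIntegral.integral_congr (g := fun θ => (-2 / Complex.I) *
    (deriv (circleMap 0 1) θ • ((circleMap 0 1 θ - ζ)⁻¹ • (circleMap 0 1 θ - ζ⁻¹)⁻¹)))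
    (fun θ _ => hpt θ), intervalIntegral.integral_const_mul] at h2
  unfold circleIntegral at hC
  rw [hC, Complex.real_smul] at h2
  have h3 : ζ⁻¹ - ζ ≠ 0 := by rw [← neg_sub]; exact neg_ne_zero.2 hne
  rw [← mul_right_inj' (two_ne_zero (α := ℂ))]
  rw [Complex.ofReal_ofNat] at h2
  rw [← h2, smul_eq_mul, ← neg_sub ζ⁻¹ ζ, inv_neg]
  field_simp

lemma norm_sub_lt_norm_add_of_inner_pos {α β : ℂ} (h : 0 < α.re * β.re + α.im * β.im) :
    ‖α - β‖ < ‖α + β‖ := by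
  rw [← sq_lt_sq₀ (norm_nonneg _) (norm_nonneg _), Complex.sq_norm, Complex.sq_norm,
    Complex.normSq_apply, Complex.normSq_apply]
  simp only [Complex.sub_re, Complex.add_re, Complex.sub_im, Complex.add_im]
  nlinarith

lemma cpow_half_mul_self {z : ℂ} (hz : z ≠ 0) :
    z ^ (1 / 2 : ℂ) * z ^ (1 / 2 : ℂ) = z := by
  rw [← Complex.cpow_add _ _ hz]; norm_num

lemma cpow_half_re_im {z : ℂ} (hz : z ≠ 0) :
    (z ^ (1 / 2 : ℂ)).re = Real.exp (Real.log ‖z‖ / 2) * Real.cos (z.arg / 2) ∧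
    (z ^ (1 / 2 : ℂ)).im = Real.exp (Real.log ‖z‖ / 2) * Real.sin (z.arg / 2) := by
  have e : Complex.log z * (1 / 2) = ((Real.log ‖z‖ / 2 : ℝ) : ℂ) + ((z.arg / 2 : ℝ) : ℂ) *
      Complex.I := by
    apply Complex.ext <;> simp [Complex.log_re, Complex.log_im] <;> ring
  rw [Complex.cpow_def_of_ne_zero hz, e]
  constructor
  · rw [Complex.exp_re]; simp
  · rw [Complex.exp_im]; simp

/-- The Cauchy transform of the arcsine law on `[a, b]` is `1 / R`. -/
lemma integral_inv_sub_arcsine {a b : ℝ} (hab : a < b) {s : ℂ}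
    (hs : s ∉ ((↑) : ℝ → ℂ) '' Icc a b) :
    sqrtR a b s ≠ 0 ∧
    ∫ θ in (0 : ℝ)..Real.pi, (s - ((a + b) / 2 + (b - a) / 2 * Real.cos θ : ℝ))⁻¹ =
      Real.pi / sqrtR a b s := by
  have ha : s - a ≠ 0 := fun h => hs ⟨a, ⟨le_rfl, hab.le⟩, (sub_eq_zero.1 h).symm⟩
  have hb : s - b ≠ 0 := fun h => hs ⟨b, ⟨hab.le, le_rfl⟩, (sub_eq_zero.1 h).symm⟩
  obtain ⟨hα1, hα2⟩ := cpow_half_re_im ha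
  obtain ⟨hβ1, hβ2⟩ := cpow_half_re_im hb
  have hα := cpow_half_mul_self ha
  have hβ := cpow_half_mul_self hb
  -- Both numbers have the same imaginary part, so their arguments lie on the same side of the real
  -- axis. A difference of `π` would require `s` between `a` and `b`. Hence the two square roots
  -- make an angle below `π/2`.
  have harg : |(s - a).arg - (s - b).arg| < Real.pi := by
    have hpi := Real.pi_pos
    rcases lt_trichotomy s.im 0 with h | h | h
    · have h1 : (s - a).arg < 0 := Complex.arg_neg_iff.2 (by simpa using h)
      have h2 : (s - b).arg < 0 := Complex.arg_neg_iff.2 (by simpa using h)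
      have h3 := Complex.neg_pi_lt_arg (s - a)
      have h4 := Complex.neg_pi_lt_arg (s - b)
      rw [abs_lt]; constructor <;> linarith
    · have hs' : s = (s.re : ℂ) := by apply Complex.ext <;> simp [h]
      have hmem : ¬ (a ≤ s.re ∧ s.re ≤ b) := fun hh => hs ⟨s.re, hh, hs'.symm⟩
      rw [hs', ← Complex.ofReal_sub, ← Complex.ofReal_sub]
      rcases lt_or_ge s.re a with h1 | h1
      · rw [Complex.arg_ofReal_of_neg (by linarith), Complex.arg_ofReal_of_neg (by linarith)]
        simpa using hpi
      · have h2 : b < s.re := by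
          by_contra hh; exact hmem ⟨h1, not_lt.1 hh⟩
        rw [Complex.arg_ofReal_of_nonneg (by linarith), Complex.arg_ofReal_of_nonneg (by linarith)]
        simpa using hpi
    · have h1 : 0 ≤ (s - a).arg := Complex.arg_nonneg_iff.2 (by simpa using h.le)
      have h2 : 0 ≤ (s - b).arg := Complex.arg_nonneg_iff.2 (by simpa using h.le)
      have h3 : (s - a).arg < Real.pi := Complex.arg_lt_pi_iff.2 (Or.inr (by simpa using h.ne'))
      have h4 : (s - b).arg < Real.pi := Complex.arg_lt_pi_iff.2 (Or.inr (by simpa using h.ne'))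
      rw [abs_lt]; constructor <;> linarith
  unfold sqrtR
  have hα0 : (s - a) ^ (1 / 2 : ℂ) ≠ 0 := fun h => ha (by rw [← hα, h, mul_zero])
  have hβ0 : (s - b) ^ (1 / 2 : ℂ) ≠ 0 := fun h => hb (by rw [← hβ, h, mul_zero])
  set α := (s - a) ^ (1 / 2 : ℂ)
  set β := (s - b) ^ (1 / 2 : ℂ)
  have hin : 0 < α.re * β.re + α.im * β.im := by
    have hc : 0 < Real.cos ((s - a).arg / 2 - (s - b).arg / 2) := by
      rw [abs_lt] at harg
      apply Real.cos_pos_of_mem_Ioo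
      constructor <;> linarith
    rw [hα1, hα2, hβ1, hβ2]
    rw [Real.cos_sub] at hc
    have := mul_pos (mul_pos (Real.exp_pos (Real.log ‖s - a‖ / 2))
      (Real.exp_pos (Real.log ‖s - b‖ / 2))) hc
    linarith
  have hlt := norm_sub_lt_norm_add_of_inner_pos hin
  have hd : ((b : ℂ) - a) ≠ 0 := by
    rw [← Complex.ofReal_sub]; exact_mod_cast (sub_pos.2 hab).ne'
  have hprod : (α - β) * (α + β) = b - a := by linear_combination hα - hβ
  have hm0 : α - β ≠ 0 := fun h => hd (by rw [← hprod, h, zero_mul])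
  have hp0 : α + β ≠ 0 := fun h => hd (by rw [← hprod, h, mul_zero])
  -- The Joukowski preimage inside the disc of `s`, rescaled so that `[a, b]` becomes `[-1, 1]`;
  -- here `ζ⁻¹ - ζ = 4 α β / (b - a)`.
  have hζ : (α - β) / (α + β) ≠ 0 := div_ne_zero hm0 hp0
  have hζ1 : ‖(α - β) / (α + β)‖ < 1 := by
    rw [norm_div]; exact (div_lt_one (norm_pos_iff.2 hp0)).2 hlt
  have hz : (α - β) / (α + β) + ((α - β) / (α + β))⁻¹ =
      2 * ((2 * s - a - b) / (b - a)) := by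
    rw [← hprod]
    field_simp
    linear_combination 2 * hα + 2 * hβ
  have hI := integral_inv_sub_cos hζ hζ1 hz
  refine ⟨mul_ne_zero hα0 hβ0, ?_⟩
  have hpt : ∀ θ : ℝ, (s - ((a + b) / 2 + (b - a) / 2 * Real.cos θ : ℝ))⁻¹ =
      (2 / (b - a)) * ((2 * s - a - b) / (b - a) - (Real.cos θ : ℂ))⁻¹ := by
    intro θ
    have : (2 * s - a - b) / (b - a) - (Real.cos θ : ℂ) =
        2 / (b - a) * (s - ((a + b) / 2 + (b - a) / 2 * Real.cos θ : ℝ)) := by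
      push_cast
      field_simp
      ring
    rw [this, mul_inv, inv_div, ← mul_assoc, div_mul_div_cancel₀ hd, div_self two_ne_zero, one_mul]
  rw [intervalIntegral.integral_congr (fun θ _ => hpt θ), intervalIntegral.integral_const_mul, hI,
    inv_div, ← hprod]
  have e : (α + β) / (α - β) - (α - β) / (α + β) = 4 * (α * β) / ((α - β) * (α + β)) := by
    field_simp
    ring
  rw [e]
  field_simp
  norm_num

/-- The mean of `log y / y` under the arcsine law of `[(α - β)², (α + β)²]`. -/
lemma integral_log_div_arcsine {α β : ℝ} (hβ : 0 ≤ β) (hαβ : β < α) :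
    ∫ θ in (0 : ℝ)..Real.pi, Real.log (α ^ 2 + β ^ 2 + 2 * α * β * Real.cos θ) /
        (α ^ 2 + β ^ 2 + 2 * α * β * Real.cos θ) =
      2 * Real.pi / (α ^ 2 - β ^ 2) * Real.log ((α ^ 2 - β ^ 2) / α) := by
  have hα : 0 < α := by linarith
  have hre : ∀ w : ℂ, ‖w‖ ≤ 1 → 0 < ((α : ℂ) + β * w).re := by
    intro w hw
    have h1 := (abs_le.1 ((Complex.abs_re_le_norm w).trans hw)).1
    simp
    nlinarith
  have hslit : ∀ w : ℂ, ‖w‖ ≤ 1 → (α : ℂ) + β * w ∈ Complex.slitPlane := fun w hw =>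
    Or.inl (hre w hw)
  have hd : DifferentiableOn ℂ (fun w : ℂ => Complex.log (α + β * w) / (α + β * w))
      (Metric.closedBall 0 1) := by
    intro w hw
    have hw' := hslit w (by simpa using hw)
    have : DifferentiableAt ℂ (fun w : ℂ => (α : ℂ) + β * w) w := by fun_prop
    exact ((this.clog hw').div this (Complex.slitPlane_ne_zero hw')).differentiableWithinAt
  have hw0 : ‖(-(β / α : ℝ) : ℂ)‖ < 1 := by
    rw [norm_neg, Complex.norm_real, Real.norm_eq_abs, abs_of_nonneg (by positivity)]
    exact (div_lt_one hα).2 hαβ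
  -- On the circle `y = (α + β w)(α + β w⁻¹)` and `log y = 2 Re log (α + β w)`. The logarithm is
  -- analytic in the disc, and the only pole there is the zero `-β/α` of `α w + β`.
  have hC := hd.circleIntegral_sub_inv_smul (w := -(β / α : ℝ)) (by simpa using hw0)
  have hpos : 0 < (α ^ 2 - β ^ 2) / α := div_pos (by nlinarith) hα
  have harg : (α : ℂ) + β * -(β / α : ℝ) = ((α ^ 2 - β ^ 2) / α : ℝ) := by
    push_cast
    have : (α : ℂ) ≠ 0 := by exact_mod_cast hα.ne'
    field_simp
    ring
  have hy : ∀ θ : ℝ, ((α : ℂ) + β * circleMap 0 1 θ) * ((α : ℂ) + β * (circleMap 0 1 θ)⁻¹) =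
      ((α ^ 2 + β ^ 2 + 2 * α * β * Real.cos θ : ℝ) : ℂ) := by
    intro θ
    have h := circleMap_add_inv θ
    have h0 : circleMap 0 1 θ ≠ 0 := circleMap_ne_center one_ne_zero
    have : ((α : ℂ) + β * circleMap 0 1 θ) * ((α : ℂ) + β * (circleMap 0 1 θ)⁻¹) =
      α ^ 2 + β ^ 2 * (circleMap 0 1 θ * (circleMap 0 1 θ)⁻¹) +
        α * β * (circleMap 0 1 θ + (circleMap 0 1 θ)⁻¹) := by ring
    rw [this, h, mul_inv_cancel₀ h0]
    push_cast; ring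
  have hypos : ∀ θ : ℝ, 0 < α ^ 2 + β ^ 2 + 2 * α * β * Real.cos θ := by
    intro θ
    have := Real.neg_one_le_cos θ
    have h1 : 0 ≤ 2 * α * β := by positivity
    nlinarith [mul_le_mul_of_nonneg_left this h1, sq_pos_of_pos (sub_pos.2 hαβ)]
  have hnorm : ∀ θ : ℝ, ‖(α : ℂ) + β * circleMap 0 1 θ‖ ^ 2 =
      α ^ 2 + β ^ 2 + 2 * α * β * Real.cos θ := by
    intro θ
    rw [Complex.sq_norm, circleMap_zero_one, Complex.normSq_apply]
    simp only [Complex.add_re, Complex.add_im, Complex.re_ofReal_mul, Complex.im_ofReal_mul,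
      Complex.exp_ofReal_mul_I_re, Complex.exp_ofReal_mul_I_im, Complex.ofReal_re,
      Complex.ofReal_im]
    nlinarith [Real.sin_sq_add_cos_sq θ]
  have hpt : ∀ θ : ℝ, ((Real.log (α ^ 2 + β ^ 2 + 2 * α * β * Real.cos θ) /
        (α ^ 2 + β ^ 2 + 2 * α * β * Real.cos θ) : ℝ)) =
      2 * ((1 / (α * Complex.I)) * (deriv (circleMap 0 1) θ • ((circleMap 0 1 θ - -(β / α : ℝ))⁻¹ •
        (Complex.log (α + β * circleMap 0 1 θ) / (α + β * circleMap 0 1 θ))))).re := by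
    intro θ
    have h0 : circleMap 0 1 θ ≠ 0 := circleMap_ne_center one_ne_zero
    have hα' : (α : ℂ) ≠ 0 := by exact_mod_cast hα.ne'
    have hA : (α : ℂ) + β * circleMap 0 1 θ ≠ 0 :=
      Complex.slitPlane_ne_zero (hslit _ (by simp))
    have hy0 : ((α ^ 2 + β ^ 2 + 2 * α * β * Real.cos θ : ℝ) : ℂ) ≠ 0 := by
      exact_mod_cast (hypos θ).ne'
    have hB : (α : ℂ) + β * (circleMap 0 1 θ)⁻¹ ≠ 0 := fun h => hy0 (by rw [← hy, h, mul_zero])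
    have e : (1 / (α * Complex.I)) * (deriv (circleMap 0 1) θ • ((circleMap 0 1 θ - -(β / α : ℝ))⁻¹ •
        (Complex.log (α + β * circleMap 0 1 θ) / (α + β * circleMap 0 1 θ)))) =
        (((α ^ 2 + β ^ 2 + 2 * α * β * Real.cos θ)⁻¹ : ℝ) : ℂ) *
          Complex.log (α + β * circleMap 0 1 θ) := by
      rw [Complex.ofReal_inv, ← hy, deriv_circleMap]
      have : circleMap 0 1 θ - -((β / α : ℝ) : ℂ) =
          circleMap 0 1 θ * ((α : ℂ) + β * (circleMap 0 1 θ)⁻¹) / α := by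
        push_cast; field_simp; ring
      rw [this]
      simp only [smul_eq_mul]
      field_simp
    rw [e, Complex.re_ofReal_mul, Complex.log_re, ← hnorm θ, Real.log_pow]
    push_cast
    ring
  obtain ⟨Φ, hΦ⟩ : ∃ Φ : ℝ → ℂ, ∀ θ, Φ θ = deriv (circleMap 0 1) θ •
      ((circleMap 0 1 θ - -((β / α : ℝ) : ℂ))⁻¹ •
        (Complex.log (α + β * circleMap 0 1 θ) / (α + β * circleMap 0 1 θ))) := ⟨_, fun _ => rfl⟩
  have hcont : Continuous Φ := by
    have hc : Continuous (circleMap 0 1) := by fun_prop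
    rw [funext hΦ]
    simp only [deriv_circleMap, smul_eq_mul]
    refine (hc.mul continuous_const).mul (Continuous.mul ?_ ?_)
    · refine (hc.sub continuous_const).inv₀ fun θ h => ?_
      replace h : circleMap 0 1 θ = -((β / α : ℝ) : ℂ) := sub_eq_zero.1 h
      rw [← h] at hw0
      simp at hw0
    · refine Continuous.div ?_ (by fun_prop) fun θ =>
        Complex.slitPlane_ne_zero (hslit _ (by simp))
      exact Continuous.clog (by fun_prop) fun θ => hslit _ (by simp)
  have hcont' : Continuous fun θ => (1 / (α * Complex.I)) * Φ θ := by fun_prop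
  have h2 := integral_comp_cos_zero_two_pi
    (fun c : ℝ => Real.log (α ^ 2 + β ^ 2 + 2 * α * β * c) / (α ^ 2 + β ^ 2 + 2 * α * β * c))
    (Continuous.intervalIntegrable (Continuous.div (Continuous.log (by fun_prop)
      fun θ => (hypos θ).ne') (by fun_prop) fun θ => (hypos θ).ne') _ _)
  rw [intervalIntegral.integral_congr (b := 2 * Real.pi)
    (g := fun θ => 2 * Complex.reCLM ((1 / (α * Complex.I)) * Φ θ))
    (fun θ _ => by simp only [hΦ]; exact hpt θ), intervalIntegral.integral_const_mul,
    Complex.reCLM.intervalIntegral_comp_comm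
      (hcont'.intervalIntegrable _ _),
    intervalIntegral.integral_const_mul, intervalIntegral.integral_congr (fun θ _ => hΦ θ)] at h2
  unfold circleIntegral at hC
  rw [hC, harg, ← Complex.ofReal_log hpos.le, smul_eq_mul] at h2
  have e : (1 / ((α : ℂ) * Complex.I)) * (2 * Real.pi * Complex.I *
      ((Real.log ((α ^ 2 - β ^ 2) / α) : ℝ) / ((α ^ 2 - β ^ 2) / α : ℝ))) =
      ((2 * Real.pi / (α ^ 2 - β ^ 2) * Real.log ((α ^ 2 - β ^ 2) / α) : ℝ) : ℂ) := by
    have h1 : (α : ℂ) ≠ 0 := by exact_mod_cast hα.ne'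
    push_cast
    field_simp
  rw [e, Complex.reCLM_apply, Complex.ofReal_re, smul_eq_mul] at h2
  linarith

end StieltjesWigert

namespace StieltjesWigert

/-! ### The superposition of arcsine laws -/

lemma lintegral_deriv_of_nonneg {F f : ℝ → ℝ} {α β : ℝ} (hαβ : α ≤ β)
    (hF : ContinuousOn F (Icc α β)) (hd : ∀ x ∈ Ioo α β, HasDerivAt F (f x) x)
    (hf : ∀ x ∈ Ioc α β, 0 ≤ f x) :
    F α ≤ F β ∧ ∫⁻ x in Ioc α β, ENNReal.ofReal (f x) = ENNReal.ofReal (F β - F α) := by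
  have hi := intervalIntegral.integrableOn_deriv_of_nonneg hF hd
    fun x hx => hf x ⟨hx.1, hx.2.le⟩
  have h2 := intervalIntegral.integral_eq_sub_of_hasDerivAt_of_le hαβ hF hd
    ((intervalIntegrable_iff_integrableOn_Ioc_of_le hαβ).2 hi)
  rw [intervalIntegral.integral_of_le hαβ] at h2
  constructor
  · rw [← sub_nonneg, ← h2]
    exact setIntegral_nonneg measurableSet_Ioc hf
  · rw [← h2, ofReal_integral_eq_lintegral_ofReal hi (ae_restrict_of_forall_mem measurableSet_Ioc hf)]

/-- The fundamental theorem of calculus for a nonnegative derivative that may fail to exist at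
one point. -/
lemma lintegral_deriv_of_nonneg_of_ne {F f : ℝ → ℝ} {α β : ℝ} (e : ℝ) (hαβ : α ≤ β)
    (hF : ContinuousOn F (Icc α β)) (hd : ∀ x ∈ Ioo α β, x ≠ e → HasDerivAt F (f x) x)
    (hf : ∀ x ∈ Ioc α β, 0 ≤ f x) :
    ∫⁻ x in Ioc α β, ENNReal.ofReal (f x) = ENNReal.ofReal (F β - F α) := by
  by_cases he : e ∈ Ioo α β
  · have h1 := lintegral_deriv_of_nonneg he.1.le (hF.mono (Icc_subset_Icc le_rfl he.2.le))
      (fun x hx => hd x ⟨hx.1, hx.2.trans he.2⟩ hx.2.ne)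
      fun x hx => hf x ⟨hx.1, hx.2.trans he.2.le⟩
    have h2 := lintegral_deriv_of_nonneg he.2.le (hF.mono (Icc_subset_Icc he.1.le le_rfl))
      (fun x hx => hd x ⟨he.1.trans hx.1, hx.2⟩ hx.1.ne')
      fun x hx => hf x ⟨he.1.trans hx.1, hx.2⟩
    rw [← Ioc_union_Ioc_eq_Ioc he.1.le he.2.le, lintegral_union measurableSet_Ioc
      (Ioc_disjoint_Ioc_of_le le_rfl), h1.2, h2.2, ← ENNReal.ofReal_add (by linarith) (by linarith)]
    congr 1
    ring
  · exact (lintegral_deriv_of_nonneg hαβ hF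
      (fun x hx => hd x hx fun h => he (h ▸ hx)) hf).2

/-- The midpoint of the support of the arcsine law with parameter `v`. -/
noncomputable def midpt (c v : ℝ) : ℝ := (2 * c - v) / v ^ 2

/-- Half the length of the support of the arcsine law with parameter `v`. -/
noncomputable def halfw (c v : ℝ) : ℝ := 2 * √(c * (c - v)) / v ^ 2

lemma halfw_pos {c v : ℝ} (hv : 0 < v) (hvc : v < c) : 0 < halfw c v := by
  have : 0 < c * (c - v) := mul_pos (hv.trans hvc) (sub_pos.2 hvc)
  unfold halfw
  positivity

/-- The choice of `midpt` and `halfw` is made for this identity: the discriminant on the right is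
quadratic in `v` as well as in `y`, so it can be integrated explicitly in either variable. -/
lemma halfw_sq_sub {c v : ℝ} (hv : 0 < v) (hvc : v ≤ c) (y : ℝ) :
    halfw c v ^ 2 - (y - midpt c v) ^ 2 = (4 * c * y - (v * y + 1) ^ 2) / v ^ 2 := by
  have h0 : 0 ≤ c * (c - v) := mul_nonneg (hv.le.trans hvc) (sub_nonneg.2 hvc)
  have hs := Real.sq_sqrt h0
  unfold halfw midpt
  rw [div_pow, mul_pow, hs]
  field_simp
  ring

lemma lintegral_comp_cos {m r : ℝ} (hr : 0 < r) (f : ℝ → ENNReal) :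
    ∫⁻ θ in Ioo 0 Real.pi, f (m + r * Real.cos θ) =
      ∫⁻ y, ENNReal.ofReal ((√(r ^ 2 - (y - m) ^ 2))⁻¹) * f y := by
  have hinj : InjOn (fun θ => m + r * Real.cos θ) (Ioo 0 Real.pi) := by
    intro x hx y hy h
    have : Real.cos x = Real.cos y := by
      have : r * Real.cos x = r * Real.cos y := by simpa using h
      exact mul_left_cancel₀ hr.ne' this
    exact Real.injOn_cos ⟨hx.1.le, hx.2.le⟩ ⟨hy.1.le, hy.2.le⟩ this
  have hd : ∀ θ ∈ Ioo 0 Real.pi, HasDerivWithinAt (fun θ => m + r * Real.cos θ)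
      (r * -Real.sin θ) (Ioo 0 Real.pi) θ := fun θ _ =>
    (((Real.hasDerivAt_cos θ).const_mul r).const_add m).hasDerivWithinAt
  have h := lintegral_image_eq_lintegral_abs_deriv_mul measurableSet_Ioo hd hinj
    (fun y => ENNReal.ofReal ((√(r ^ 2 - (y - m) ^ 2))⁻¹) * f y)
  have himg : (fun θ => m + r * Real.cos θ) '' Ioo 0 Real.pi = Ioo (m - r) (m + r) := by
    ext y
    constructor
    · rintro ⟨θ, hθ, rfl⟩
      have h1 : Real.cos θ < 1 := by
        have := Real.cos_lt_cos_of_nonneg_of_le_pi le_rfl hθ.2.le hθ.1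
        simpa using this
      have h2 : -1 < Real.cos θ := by
        have := Real.cos_lt_cos_of_nonneg_of_le_pi hθ.1.le le_rfl hθ.2
        simpa using this
      constructor <;> simp only <;> nlinarith
    · intro hy
      have h1 : -1 < (y - m) / r := by rw [lt_div_iff₀ hr]; linarith [hy.1]
      have h2 : (y - m) / r < 1 := by rw [div_lt_iff₀ hr]; linarith [hy.2]
      refine ⟨Real.arccos ((y - m) / r), ⟨Real.arccos_pos.2 h2, ?_⟩, ?_⟩
      · exact lt_of_le_of_ne (Real.arccos_le_pi _) fun h => by
          rw [Real.arccos_eq_pi] at h; linarith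
      · simp only
        rw [Real.cos_arccos h1.le h2.le]
        field_simp
        ring
  rw [himg] at h
  -- Off the interval the square root of a nonpositive number is `0`, and so is its inverse; no
  -- indicator function is needed.
  have hz : ∀ y ∉ Ioo (m - r) (m + r),
      ENNReal.ofReal ((√(r ^ 2 - (y - m) ^ 2))⁻¹) * f y = 0 := by
    intro y hy
    have : r ^ 2 - (y - m) ^ 2 ≤ 0 := by
      have : r ≤ |y - m| := by
        by_contra hh
        rw [not_le, abs_lt] at hh
        exact hy ⟨by linarith, by linarith⟩
      nlinarith [sq_abs (y - m)]
    rw [Real.sqrt_eq_zero_of_nonpos this]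
    simp
  rw [← setLIntegral_eq_of_support_subset (s := Ioo (m - r) (m + r))
    (f := fun y => ENNReal.ofReal ((√(r ^ 2 - (y - m) ^ 2))⁻¹) * f y), h]
  · refine setLIntegral_congr_fun measurableSet_Ioo fun θ hθ => ?_
    have hs := Real.sin_pos_of_mem_Ioo hθ
    have e : r ^ 2 - (m + r * Real.cos θ - m) ^ 2 = (r * Real.sin θ) ^ 2 := by
      nlinarith [Real.sin_sq_add_cos_sq θ]
    rw [e, Real.sqrt_sq (by positivity), mul_neg, abs_neg, abs_of_pos (by positivity), ← mul_assoc,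
      ← ENNReal.ofReal_mul (by positivity), mul_inv_cancel₀ (by positivity)]
    simp
  · intro y hy
    by_contra hh
    exact hy (hz y hh)

lemma one_le_add_one_div_sqrt {u : ℝ} (hu : 0 < u) : 1 ≤ (u + 1) / (2 * √u) := by
  rw [le_div_iff₀ (by positivity)]
  nlinarith [Real.sq_sqrt hu.le, sq_nonneg (√u - 1)]

/-- The argument of `arccos` in the density and of `arcosh` in the effective potential. -/
noncomputable def cosArg (c v y : ℝ) : ℝ := (v * y + 1) / (2 * √(c * y))

lemma one_sub_cosArg_sq {c y : ℝ} (hc : 0 < c) (hy : 0 < y) (v : ℝ) :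
    1 - cosArg c v y ^ 2 = (4 * c * y - (v * y + 1) ^ 2) / (2 * √(c * y)) ^ 2 := by
  have := Real.sq_sqrt (mul_pos hc hy).le
  unfold cosArg
  rw [div_pow, mul_pow, this]
  have : 0 < c * y := by positivity
  field_simp
  ring

lemma hasDerivAt_cosArg {c y v : ℝ} :
    HasDerivAt (fun v => cosArg c v y) (y / (2 * √(c * y))) v := by
  unfold cosArg
  simpa using (((hasDerivAt_id v).mul_const y).add_const 1).div_const (2 * √(c * y))

lemma lintegral_inv_sqrt_eq_arccos {c v₀ y : ℝ} (hv₀ : 0 < v₀) (hc : v₀ ≤ c) (hy : 0 < y) :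
    ∫⁻ v in Ioc v₀ c, ENNReal.ofReal ((√(4 * c * y - (v * y + 1) ^ 2))⁻¹) =
      ENNReal.ofReal (Real.arccos (cosArg c v₀ y) / y) := by
  have hc0 : 0 < c := hv₀.trans_le hc
  have hcy : 0 < √(c * y) := Real.sqrt_pos.2 (mul_pos hc0 hy)
  -- The exceptional point is where `cosArg` equals `1`. Beyond it `arccos` is constantly `0` and
  -- the integrand is `0` by the square root convention, so one antiderivative serves on both sides.
  have h := lintegral_deriv_of_nonneg_of_ne (F := fun v => -(Real.arccos (cosArg c v y) / y))
    (f := fun v => (√(4 * c * y - (v * y + 1) ^ 2))⁻¹) ((2 * √(c * y) - 1) / y) hc ?_ ?_ ?_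
  · rw [h]
    have : Real.arccos (cosArg c c y) = 0 :=
      Real.arccos_eq_zero.2 (one_le_add_one_div_sqrt (mul_pos hc0 hy))
    simp only [this]
    simp
  · have : Continuous fun v => cosArg c v y := by unfold cosArg; fun_prop
    fun_prop
  · intro v hv hne
    have hv0 : 0 < v := hv₀.trans hv.1
    have hpos : 0 < cosArg c v y := by unfold cosArg; positivity
    have hne1 : cosArg c v y ≠ 1 := by
      intro h1
      apply hne
      unfold cosArg at h1
      rw [div_eq_one_iff_eq (by positivity)] at h1
      rw [← h1]; field_simp; ring
    have hd := (((Real.hasDerivAt_arccos (by linarith) hne1).comp v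
      (hasDerivAt_cosArg (c := c) (y := y) (v := v))).div_const y).neg
    refine hd.congr_deriv ?_
    rw [one_sub_cosArg_sq hc0 hy, Real.sqrt_div' _ (by positivity), Real.sqrt_sq (by positivity)]
    rcases eq_or_ne (√(4 * c * y - (v * y + 1) ^ 2)) 0 with h0 | h0
    · simp [h0]
    · field_simp
  · intro v _; positivity

/-- The density of the superposition. -/
noncomputable def arccosDensity (K c v₀ y : ℝ) : ℝ :=
  K / (Real.pi * y) * Real.arccos (cosArg c v₀ y)

/-- The law of the parameter `v` of the arcsine laws. -/
noncomputable def paramMeasure (K c v₀ : ℝ) : Measure ℝ :=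
  (volume.restrict (Ioc v₀ c)).withDensity fun v => ENNReal.ofReal (K / v)

/-- The uniform distribution of the angle on `(0, π)`. -/
noncomputable def angleMeasure : Measure ℝ :=
  ENNReal.ofReal Real.pi⁻¹ • volume.restrict (Ioo 0 Real.pi)

lemma measurable_arcsine_point (c : ℝ) :
    Measurable fun p : ℝ × ℝ => midpt c p.1 + halfw c p.1 * Real.cos p.2 := by
  unfold midpt halfw
  fun_prop

/-- The superposition of arcsine laws. -/
noncomputable def mixture (K c v₀ : ℝ) : Measure ℝ :=
  ((paramMeasure K c v₀).prod angleMeasure).map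
    fun p : ℝ × ℝ => midpt c p.1 + halfw c p.1 * Real.cos p.2

instance : SFinite angleMeasure := by unfold angleMeasure; infer_instance

instance (K c v₀ : ℝ) : SFinite (paramMeasure K c v₀) := by
  unfold paramMeasure; infer_instance

/-- By Tonelli. The arcsine density is `v / (π √(4 c y - (v y + 1)²))`, so the weight `K / v`
cancels the factor `v`. -/
lemma lintegral_mixture {K c v₀ : ℝ} (hK : 0 < K) (hv₀ : 0 < v₀) {f : ℝ → ENNReal}
    (hf : Measurable f) :
    ∫⁻ y, f y ∂mixture K c v₀ = ∫⁻ y, (∫⁻ v in Ioc v₀ c,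
      ENNReal.ofReal (K / Real.pi) * ENNReal.ofReal ((√(4 * c * y - (v * y + 1) ^ 2))⁻¹)) * f y := by
  have hpi := Real.pi_pos
  have hm : Measurable fun p : ℝ × ℝ => f (midpt c p.1 + halfw c p.1 * Real.cos p.2) :=
    hf.comp (measurable_arcsine_point c)
  have hmi : Measurable fun v => ∫⁻ θ, f (midpt c v + halfw c v * Real.cos θ) ∂angleMeasure :=
    hm.lintegral_prod_right'
  rw [mixture, lintegral_map hf (measurable_arcsine_point c), lintegral_prod _ hm.aemeasurable,
    paramMeasure, lintegral_withDensity_eq_lintegral_mul _ (by fun_prop) hmi]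
  have hjm : Measurable fun p : ℝ × ℝ => ENNReal.ofReal (K / Real.pi) *
      ENNReal.ofReal ((√(4 * c * p.2 - (p.1 * p.2 + 1) ^ 2))⁻¹) * f p.2 := by
    fun_prop
  have hswap := lintegral_lintegral_swap (μ := volume.restrict (Ioc v₀ c)) (ν := volume)
    (f := fun v y => ENNReal.ofReal (K / Real.pi) *
      ENNReal.ofReal ((√(4 * c * y - (v * y + 1) ^ 2))⁻¹) * f y) hjm.aemeasurable
  have hR : ∀ y, (∫⁻ v in Ioc v₀ c, ENNReal.ofReal (K / Real.pi) *
      ENNReal.ofReal ((√(4 * c * y - (v * y + 1) ^ 2))⁻¹)) * f y =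
      ∫⁻ v in Ioc v₀ c, ENNReal.ofReal (K / Real.pi) *
      ENNReal.ofReal ((√(4 * c * y - (v * y + 1) ^ 2))⁻¹) * f y := by
    intro y
    rw [lintegral_mul_const _ (by fun_prop)]
  simp only [hR]
  -- At `v = c` the arcsine law degenerates to a point mass, so this null value of `v` is dropped.
  rw [← hswap, ← restrict_Ioo_eq_restrict_Ioc]
  refine setLIntegral_congr_fun measurableSet_Ioo fun v hv => ?_
  have hv0 : 0 < v := hv₀.trans hv.1
  have hmy : Measurable fun y => ENNReal.ofReal ((√(halfw c v ^ 2 - (y - midpt c v) ^ 2))⁻¹) * f y :=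
    by fun_prop
  simp only [Pi.mul_apply, angleMeasure]
  rw [lintegral_smul_measure, lintegral_comp_cos (halfw_pos hv0 hv.2), smul_eq_mul, ← mul_assoc,
    ← ENNReal.ofReal_mul (by positivity), ← lintegral_const_mul _ hmy]
  refine lintegral_congr fun y => ?_
  rw [← mul_assoc, ← ENNReal.ofReal_mul (by positivity), ← ENNReal.ofReal_mul (by positivity),
    halfw_sq_sub hv0 hv.2.le, Real.sqrt_div' _ (by positivity), Real.sqrt_sq hv0.le]
  congr 2
  rcases eq_or_ne (√(4 * c * y - (v * y + 1) ^ 2)) 0 with h0 | h0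
  · simp [h0]
  · field_simp

lemma mixture_eq_withDensity {K c v₀ : ℝ} (hK : 0 < K) (hv₀ : 0 < v₀) (hc : v₀ ≤ c) :
    mixture K c v₀ = (volume.restrict (Ioi 0)).withDensity
      fun y => ENNReal.ofReal (arccosDensity K c v₀ y) := by
  have hpi := Real.pi_pos
  refine Measure.ext_of_lintegral _ fun f hf => ?_
  have hm : Measurable fun y => ENNReal.ofReal (arccosDensity K c v₀ y) := by
    unfold arccosDensity cosArg
    fun_prop
  rw [lintegral_mixture hK hv₀ hf, lintegral_withDensity_eq_lintegral_mul _ hm hf,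
    ← setLIntegral_eq_of_support_subset (s := Ioi 0)]
  · refine setLIntegral_congr_fun measurableSet_Ioi fun y hy => ?_
    have hy' : 0 < y := hy
    simp only [Pi.mul_apply]
    rw [lintegral_const_mul _ (by fun_prop), lintegral_inv_sqrt_eq_arccos hv₀ hc hy,
      ← ENNReal.ofReal_mul (by positivity)]
    congr 2
    unfold arccosDensity
    field_simp
  · intro y hy
    by_contra hh
    apply hy
    simp only [mem_Ioi, not_lt] at hh
    have hc0 : 0 < c := hv₀.trans_le hc
    have : ∀ v, √(4 * c * y - (v * y + 1) ^ 2) = 0 := fun v =>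
      Real.sqrt_eq_zero_of_nonpos (by nlinarith [sq_nonneg (v * y + 1)])
    simp [this]

end StieltjesWigert

namespace StieltjesWigert

/-! ### The logarithmic potential of the superposition -/

/-- On `(-1, 1)` both sides are `0`, since the radicand is negative. To the left of `-1` the formula
fails, hence the lower bound. -/
lemma hasDerivAt_arch {ξ : ℝ} (h : -1 < ξ) (h1 : ξ ≠ 1) :
    HasDerivAt arch (√(ξ ^ 2 - 1))⁻¹ ξ := by
  rcases lt_or_gt_of_ne h1 with h2 | h2
  · rw [Real.sqrt_eq_zero_of_nonpos (by nlinarith), inv_zero]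
    refine (hasDerivAt_const ξ (0 : ℝ)).congr_of_eventuallyEq ?_
    filter_upwards [Iio_mem_nhds h2] with y hy using arch_of_le (le_of_lt hy)
  · refine (Real.hasDerivAt_arcosh h2).congr_of_eventuallyEq ?_
    filter_upwards [Ioi_mem_nhds h2] with y hy using arch_of_ge (le_of_lt hy)

/-- At `v = c` the argument is `(√(c u) + 1/√(c u)) / 2`, a hyperbolic cosine of `log (c u) / 2`.
This is where the quadratic term in `log x` originates. -/
lemma arch_cosArg_self {c u : ℝ} (hc : 0 < c) (hu : 0 < u) :
    arch (cosArg c c u) = |Real.log (c * u)| / 2 := by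
  have hcu : 0 < c * u := mul_pos hc hu
  have h1 : cosArg c c u = Real.cosh (|Real.log (c * u)| / 2) := by
    rw [← abs_two, ← abs_div, Real.cosh_abs, Real.cosh_eq, Real.exp_neg,
      Real.exp_half, Real.exp_log hcu]
    have := Real.sq_sqrt hcu.le
    have h2 : 0 < √(c * u) := Real.sqrt_pos.2 hcu
    unfold cosArg
    field_simp
    rw [this]
  rw [h1, arch_of_ge (Real.one_le_cosh _), Real.arcosh_cosh (by positivity)]

lemma lintegral_inv_sqrt_eq_arch {c v₀ u : ℝ} (hv₀ : 0 < v₀) (hc : v₀ ≤ c) (hu : 0 < u) :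
    ∫⁻ v in Ioc v₀ c, ENNReal.ofReal ((√((v * u + 1) ^ 2 - 4 * c * u))⁻¹) =
      ENNReal.ofReal ((|Real.log (c * u)| / 2 - arch (cosArg c v₀ u)) / u) := by
  have hc0 : 0 < c := hv₀.trans_le hc
  have hcy : 0 < √(c * u) := Real.sqrt_pos.2 (mul_pos hc0 hu)
  have h := lintegral_deriv_of_nonneg_of_ne (F := fun v => arch (cosArg c v u) / u)
    (f := fun v => (√((v * u + 1) ^ 2 - 4 * c * u))⁻¹) ((2 * √(c * u) - 1) / u) hc ?_ ?_ ?_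
  · rw [h, arch_cosArg_self hc0 hu, sub_div]
  · have : Continuous fun v => cosArg c v u := by unfold cosArg; fun_prop
    exact ((continuous_arch.comp this).div_const u).continuousOn
  · intro v hv hne
    have hv0 : 0 < v := hv₀.trans hv.1
    have hpos : 0 < cosArg c v u := by unfold cosArg; positivity
    have hne1 : cosArg c v u ≠ 1 := by
      intro h1
      apply hne
      unfold cosArg at h1
      rw [div_eq_one_iff_eq (by positivity)] at h1
      rw [← h1]; field_simp; ring
    have hd := ((hasDerivAt_arch (by linarith) hne1).comp v
      (hasDerivAt_cosArg (c := c) (y := u) (v := v))).div_const u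
    refine hd.congr_deriv ?_
    have e : cosArg c v u ^ 2 - 1 = ((v * u + 1) ^ 2 - 4 * c * u) / (2 * √(c * u)) ^ 2 := by
      rw [← neg_sub, one_sub_cosArg_sq hc0 hu]; ring
    rw [e, Real.sqrt_div' _ (by positivity), Real.sqrt_sq (by positivity)]
    rcases eq_or_ne (√((v * u + 1) ^ 2 - 4 * c * u)) 0 with h0 | h0
    · simp [h0]
    · field_simp
  · intro v _; positivity

/-! ### Geometry of the arcsine supports -/

lemma halfw_lt_midpt {c v : ℝ} (hv : 0 < v) (hvc : v ≤ c) : halfw c v < midpt c v := by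
  have h := halfw_sq_sub hv hvc 0
  have hm : 0 < midpt c v := by unfold midpt; apply div_pos <;> [linarith; positivity]
  have h2 : halfw c v ^ 2 < midpt c v ^ 2 := by
    have : (0 : ℝ) < 1 / v ^ 2 := by positivity
    have h3 : (4 * c * 0 - (v * 0 + 1) ^ 2) / v ^ 2 = -(1 / v ^ 2) := by ring
    rw [h3] at h
    nlinarith
  exact lt_of_pow_lt_pow_left₀ 2 hm.le h2

/-- Being interior to every interval, `1/c` is the reference point at which all the arcsine
potentials are minimal. -/
lemma abs_inv_sub_midpt_lt {c v : ℝ} (hv : 0 < v) (hvc : v < c) :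
    |1 / c - midpt c v| < halfw c v := by
  have hc : 0 < c := hv.trans hvc
  have h := halfw_sq_sub hv hvc.le (1 / c)
  have h1 : 0 < (4 * c * (1 / c) - (v * (1 / c) + 1) ^ 2) / v ^ 2 := by
    apply div_pos _ (by positivity)
    have : v * (1 / c) < 1 := by rw [mul_one_div, div_lt_one hc]; exact hvc
    have h0 : 0 < v * (1 / c) := by positivity
    have h4 : 4 * c * (1 / c) = 4 := by field_simp
    rw [h4]
    nlinarith
  rw [← h] at h1
  exact abs_lt_of_sq_lt_sq (by linarith) (halfw_pos hv hvc).le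

lemma cosArg_lt_one_iff {c v y : ℝ} (hv : 0 < v) (hvc : v < c) (hy : 0 < y) :
    cosArg c v y < 1 ↔ y ∈ Ioo (midpt c v - halfw c v) (midpt c v + halfw c v) := by
  have hc : 0 < c := hv.trans hvc
  have hs : 0 < √(c * y) := Real.sqrt_pos.2 (mul_pos hc hy)
  have h1 := one_sub_cosArg_sq hc hy v
  have h2 := halfw_sq_sub hv hvc.le y
  have hp : 0 < cosArg c v y := by unfold cosArg; positivity
  have hh := halfw_pos hv hvc
  have e : (y ∈ Ioo (midpt c v - halfw c v) (midpt c v + halfw c v)) ↔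
      |y - midpt c v| < halfw c v := by
    rw [abs_lt, mem_Ioo]; constructor <;> rintro ⟨h3, h4⟩ <;> constructor <;> linarith
  rw [e, ← abs_of_pos hh, ← sq_lt_sq, ← sub_pos (a := halfw c v ^ 2), h2,
    div_pos_iff_of_pos_right (by positivity)]
  rw [← div_pos_iff_of_pos_right (show 0 < (2 * √(c * y)) ^ 2 by positivity), ← h1]
  constructor <;> intro h <;> nlinarith

lemma continuousAt_cosArg {c v y : ℝ} (hc : 0 < c) (hy : 0 < y) :
    ContinuousAt (cosArg c v) y := by
  have hs : 0 < √(c * y) := Real.sqrt_pos.2 (mul_pos hc hy)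
  unfold cosArg
  exact ContinuousAt.div (by fun_prop) (by fun_prop) (by positivity)

lemma cosArg_le_one {c v y : ℝ} (hv : 0 < v) (hvc : v < c)
    (hy : y ∈ Icc (midpt c v - halfw c v) (midpt c v + halfw c v)) : cosArg c v y ≤ 1 := by
  have hy0 : 0 < y := by linarith [hy.1, halfw_lt_midpt hv hvc.le]
  have hc : 0 < c := hv.trans hvc
  have hs : 0 < √(c * y) := Real.sqrt_pos.2 (mul_pos hc hy0)
  have h1 := one_sub_cosArg_sq hc hy0 v
  have h2 := halfw_sq_sub hv hvc.le y
  have hh : |y - midpt c v| ≤ halfw c v := abs_le.2 ⟨by linarith [hy.1], by linarith [hy.2]⟩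
  have h3 : 0 ≤ halfw c v ^ 2 - (y - midpt c v) ^ 2 := by
    nlinarith [sq_abs (y - midpt c v), abs_nonneg (y - midpt c v)]
  rw [h2, le_div_iff₀ (by positivity), zero_mul] at h3
  have h4 : 0 ≤ 1 - cosArg c v y ^ 2 := by rw [h1]; positivity
  nlinarith

lemma one_lt_cosArg {c v y : ℝ} (hv : 0 < v) (hvc : v < c) (hy0 : 0 < y)
    (hy : y ∉ Icc (midpt c v - halfw c v) (midpt c v + halfw c v)) : 1 < cosArg c v y := by
  have hc : 0 < c := hv.trans hvc
  have hs : 0 < √(c * y) := Real.sqrt_pos.2 (mul_pos hc hy0)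
  have h1 := one_sub_cosArg_sq hc hy0 v
  have h2 := halfw_sq_sub hv hvc.le y
  have hp : 0 < cosArg c v y := by unfold cosArg; positivity
  have hh : halfw c v < |y - midpt c v| := by
    by_contra hle
    rw [not_lt, abs_le] at hle
    exact hy ⟨by linarith, by linarith⟩
  have h3 : halfw c v ^ 2 - (y - midpt c v) ^ 2 < 0 := by
    nlinarith [sq_abs (y - midpt c v), halfw_pos hv hvc]
  rw [h2, div_lt_iff₀ (by positivity), zero_mul] at h3
  have h4 : 1 - cosArg c v y ^ 2 < 0 := by
    rw [h1]; exact div_neg_of_neg_of_pos h3 (by positivity)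
  nlinarith

/-- The mixture is absolutely continuous, with a density supported by `[a, b]`. -/
lemma mixture_eq_withDensity_Icc {K c v₀ : ℝ} (hK : 0 < K) (hv₀ : 0 < v₀) (hc : v₀ < c) :
    mixture K c v₀ = (volume.restrict
      (Icc (midpt c v₀ - halfw c v₀) (midpt c v₀ + halfw c v₀))).withDensity
      fun y => ENNReal.ofReal (arccosDensity K c v₀ y) := by
  rw [mixture_eq_withDensity hK hv₀ hc.le, ← withDensity_indicator measurableSet_Ioi,
    ← withDensity_indicator measurableSet_Icc]
  congr 1
  ext y
  by_cases hy : y ∈ Icc (midpt c v₀ - halfw c v₀) (midpt c v₀ + halfw c v₀)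
  · have hy0 : y ∈ Ioi (0 : ℝ) := by
      have := halfw_lt_midpt hv₀ hc.le
      rw [mem_Ioi]; linarith [hy.1]
    rw [indicator_of_mem hy, indicator_of_mem hy0]
  · rw [indicator_of_notMem hy]
    by_cases hy0 : y ∈ Ioi (0 : ℝ)
    · rw [indicator_of_mem hy0, arccosDensity,
        Real.arccos_eq_zero.2 (one_lt_cosArg hv₀ hc hy0 hy).le]
      simp
    · rw [indicator_of_notMem hy0]

lemma mixture_le {K c v₀ : ℝ} (hK : 0 < K) (hv₀ : 0 < v₀) (hc : v₀ < c) :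
    mixture K c v₀ ≤ ENNReal.ofReal (K / (midpt c v₀ - halfw c v₀)) • volume.restrict
      (Icc (midpt c v₀ - halfw c v₀) (midpt c v₀ + halfw c v₀)) := by
  rw [mixture_eq_withDensity_Icc hK hv₀ hc, ← withDensity_const]
  refine withDensity_mono (ae_restrict_of_forall_mem measurableSet_Icc fun y hy => ?_)
  have ha := sub_pos.2 (halfw_lt_midpt hv₀ hc.le)
  have hy0 : 0 < y := ha.trans_le hy.1
  apply ENNReal.ofReal_le_ofReal
  have hpi := Real.pi_pos
  calc arccosDensity K c v₀ y ≤ K / (Real.pi * y) * Real.pi := by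
        unfold arccosDensity
        gcongr
        exact Real.arccos_le_pi _
    _ = K / y := by field_simp
    _ ≤ K / (midpt c v₀ - halfw c v₀) := by gcongr; exact hy.1

/-! ### Potential of the mixture relative to the point `1/c` -/

lemma integrableOn_log_abs_sub (x α β : ℝ) :
    IntegrableOn (fun y => Real.log |x - y|) (Icc α β) := by
  rcases le_or_gt α β with h | h
  · rw [integrableOn_Icc_iff_integrableOn_Ioc, ← intervalIntegrable_iff_integrableOn_Ioc_of_le h]
    have := (intervalIntegral.intervalIntegrable_log' (a := x - α) (b := x - β)).comp_sub_left x
    simpa [Real.log_abs] using this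
  · simp [Icc_eq_empty (not_le.2 h)]

lemma integrable_log_mixture {K c v₀ : ℝ} (hK : 0 < K) (hv₀ : 0 < v₀) (hc : v₀ < c) (x : ℝ) :
    Integrable (fun y => Real.log |x - y|) (mixture K c v₀) :=
  ((integrableOn_log_abs_sub x _ _).integrable.smul_measure ENNReal.ofReal_ne_top).mono_measure
    (mixture_le hK hv₀ hc)

lemma integral_angleMeasure (f : ℝ → ℝ) :
    ∫ θ, f θ ∂angleMeasure = Real.pi⁻¹ * ∫ θ in (0 : ℝ)..Real.pi, f θ := by
  rw [angleMeasure, integral_smul_measure, intervalIntegral.integral_of_le Real.pi_pos.le,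
    restrict_Ioo_eq_restrict_Ioc, ENNReal.toReal_ofReal (inv_nonneg.2 Real.pi_pos.le), smul_eq_mul]

lemma ae_paramMeasure {K c v₀ : ℝ} : ∀ᵐ v ∂paramMeasure K c v₀, v ∈ Ioo v₀ c := by
  have h : ∀ᵐ v ∂(volume.restrict (Ioc v₀ c)), v ∈ Ioo v₀ c := by
    rw [← restrict_Ioo_eq_restrict_Ioc]
    exact ae_restrict_mem measurableSet_Ioo
  exact (withDensity_absolutelyContinuous _ _).ae_le h

lemma potential_mixture {K c v₀ : ℝ} (hK : 0 < K) (hv₀ : 0 < v₀) (hc : v₀ < c) (x : ℝ) :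
    Integrable (fun v => arch (|x - midpt c v| / halfw c v) + Real.log (halfw c v / 2))
      (paramMeasure K c v₀) ∧
    ∫ y, Real.log |x - y| ∂mixture K c v₀ =
      ∫ v, (arch (|x - midpt c v| / halfw c v) + Real.log (halfw c v / 2))
        ∂paramMeasure K c v₀ := by
  have hm := measurable_arcsine_point c
  have hi := integrable_log_mixture hK hv₀ hc x
  rw [mixture] at hi ⊢
  have hlog : Measurable fun y => Real.log |x - y| := by fun_prop
  rw [integrable_map_measure hlog.aestronglyMeasurable hm.aemeasurable] at hi
  change Integrable (fun p : ℝ × ℝ => Real.log |x - (midpt c p.1 + halfw c p.1 * Real.cos p.2)|) _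
    at hi
  rw [integral_map hm.aemeasurable hlog.aestronglyMeasurable, integral_prod _ hi]
  have hev : (fun v => ∫ θ, Real.log |x - (midpt c v + halfw c v * Real.cos θ)| ∂angleMeasure)
      =ᵐ[paramMeasure K c v₀]
      fun v => arch (|x - midpt c v| / halfw c v) + Real.log (halfw c v / 2) := by
    filter_upwards [ae_paramMeasure] with v hv
    have hh := halfw_pos (hv₀.trans hv.1) hv.2
    rw [integral_angleMeasure]
    have e : ∀ θ, x - (midpt c v + halfw c v * Real.cos θ) =
        halfw c v * ((x - midpt c v) / halfw c v - Real.cos θ) := by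
      intro θ; field_simp; ring
    simp only [e]
    rw [integral_log_abs_sub_cos _ hh, abs_div, abs_of_pos hh]
    have := Real.pi_pos
    field_simp
  exact ⟨hi.integral_prod_left.congr hev, integral_congr_ae hev⟩

/-- Subtracting the value at `1/c` removes the constants `log (halfw c v / 2)` and leaves a
nonnegative integrand, so that Tonelli can be used without integrability checks. -/
lemma potential_mixture_sub {K c v₀ : ℝ} (hK : 0 < K) (hv₀ : 0 < v₀) (hc : v₀ < c) (x : ℝ) :
    (∫ y, Real.log |x - y| ∂mixture K c v₀) - ∫ y, Real.log |1 / c - y| ∂mixture K c v₀ =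
      (∫⁻ v in Ioc v₀ c, ENNReal.ofReal K *
        ENNReal.ofReal (arch (|x - midpt c v| / halfw c v) / v)).toReal := by
  obtain ⟨h1, h2⟩ := potential_mixture hK hv₀ hc x
  obtain ⟨h3, h4⟩ := potential_mixture hK hv₀ hc (1 / c)
  rw [h2, h4, ← integral_sub h1 h3]
  have hev : (fun v => arch (|x - midpt c v| / halfw c v) + Real.log (halfw c v / 2) -
      (arch (|1 / c - midpt c v| / halfw c v) + Real.log (halfw c v / 2)))
      =ᵐ[paramMeasure K c v₀] fun v => arch (|x - midpt c v| / halfw c v) := by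
    filter_upwards [ae_paramMeasure] with v hv
    have hv0 := hv₀.trans hv.1
    rw [arch_of_le ((div_le_one (halfw_pos hv0 hv.2)).2 (abs_inv_sub_midpt_lt hv0 hv.2).le)]
    ring
  have hmeas : Measurable fun v => arch (|x - midpt c v| / halfw c v) := by
    unfold midpt halfw
    exact continuous_arch.measurable.comp (by fun_prop)
  rw [integral_congr_ae hev, integral_eq_lintegral_of_nonneg_ae
    (ae_of_all _ fun v => arch_nonneg _) hmeas.aestronglyMeasurable, paramMeasure,
    lintegral_withDensity_eq_lintegral_mul _ (by fun_prop) (by fun_prop)]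
  congr 1
  refine setLIntegral_congr_fun measurableSet_Ioc fun v hv => ?_
  have hv0 := hv₀.trans hv.1
  simp only [Pi.mul_apply]
  rw [← ENNReal.ofReal_mul (by positivity), ← ENNReal.ofReal_mul (by positivity)]
  congr 1
  ring

lemma continuousOn_arch_cosArg {c v : ℝ} (hc : 0 < c) :
    ContinuousOn (fun u => arch (cosArg c v u) / u) (Ioi 0) := fun _ hu =>
  ((continuous_arch.continuousAt.comp (continuousAt_cosArg hc hu)).div continuousAt_id
    (ne_of_gt hu)).continuousWithinAt

/-- The hypothesis writes each arcsine contribution as an integral over `u`. After the exchange the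
inner integral over `v` is given by `lintegral_inv_sqrt_eq_arch`. -/
lemma potential_mixture_sub_of_interval {K c v₀ : ℝ} (hK : 0 < K) (hv₀ : 0 < v₀) (hc : v₀ < c)
    {x α β : ℝ} (hα : 0 < α) (hαβ : α ≤ β)
    (h : ∀ v ∈ Ioo v₀ c, ∫⁻ u in Ioc α β, ENNReal.ofReal ((√((v * u + 1) ^ 2 - 4 * c * u))⁻¹) =
      ENNReal.ofReal (arch (|x - midpt c v| / halfw c v) / v)) :
    (∫ y, Real.log |x - y| ∂mixture K c v₀) - ∫ y, Real.log |1 / c - y| ∂mixture K c v₀ =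
      K * (∫ u in α..β, (|Real.log (c * u)| / 2) / u) -
        K * ∫ u in α..β, arch (cosArg c v₀ u) / u := by
  have hc0 := hv₀.trans hc
  have hsub : uIcc α β ⊆ Ioi 0 := by
    rw [uIcc_of_le hαβ]; exact fun u hu => hα.trans_le hu.1
  have hi2 : IntervalIntegrable (fun u => arch (cosArg c v₀ u) / u) volume α β :=
    ((continuousOn_arch_cosArg hc0).mono hsub).intervalIntegrable
  have hi1 : IntervalIntegrable (fun u => (|Real.log (c * u)| / 2) / u) volume α β := by
    apply ContinuousOn.intervalIntegrable
    intro u hu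
    have hu0 : 0 < u := hsub hu
    have : c * u ≠ 0 := by positivity
    exact (ContinuousAt.div (by fun_prop (disch := assumption)) continuousAt_id
      hu0.ne').continuousWithinAt
  rw [potential_mixture_sub hK hv₀ hc, ← mul_sub, ← intervalIntegral.integral_sub hi1 hi2]
  have hjm : Measurable fun p : ℝ × ℝ =>
      ENNReal.ofReal ((√((p.1 * p.2 + 1) ^ 2 - 4 * c * p.2))⁻¹) := by
    fun_prop
  have hswap := lintegral_lintegral_swap (μ := volume.restrict (Ioc v₀ c))
    (ν := volume.restrict (Ioc α β))
    (f := fun v u => ENNReal.ofReal ((√((v * u + 1) ^ 2 - 4 * c * u))⁻¹)) hjm.aemeasurable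
  have hL : ∫⁻ v in Ioc v₀ c, ENNReal.ofReal K *
        ENNReal.ofReal (arch (|x - midpt c v| / halfw c v) / v) =
      ENNReal.ofReal K * ∫⁻ v in Ioc v₀ c, ∫⁻ u in Ioc α β,
        ENNReal.ofReal ((√((v * u + 1) ^ 2 - 4 * c * u))⁻¹) := by
    rw [← lintegral_const_mul _ hjm.lintegral_prod_right', ← restrict_Ioo_eq_restrict_Ioc]
    refine setLIntegral_congr_fun measurableSet_Ioo fun v hv => ?_
    simp only
    rw [h v hv]
  have hin : ∀ u ∈ Ioc α β,
      ∫⁻ v in Ioc v₀ c, ENNReal.ofReal ((√((v * u + 1) ^ 2 - 4 * c * u))⁻¹) =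
      ENNReal.ofReal ((|Real.log (c * u)| / 2) / u - arch (cosArg c v₀ u) / u) := by
    intro u hu
    rw [lintegral_inv_sqrt_eq_arch hv₀ hc.le (hα.trans hu.1), sub_div]
  have hnn : ∀ u ∈ Ioc α β, 0 ≤ (|Real.log (c * u)| / 2) / u - arch (cosArg c v₀ u) / u := by
    intro u hu
    have hu0 : 0 < u := hα.trans hu.1
    rw [← sub_div, ← arch_cosArg_self hc0 hu0]
    apply div_nonneg _ hu0.le
    rw [sub_nonneg]
    unfold arch
    rw [Real.arcosh_le_arcosh (by positivity) (by positivity)]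
    apply max_le_max le_rfl
    unfold cosArg
    gcongr
  rw [hL, hswap, setLIntegral_congr_fun measurableSet_Ioc hin,
    ← ofReal_integral_eq_lintegral_ofReal
      ((intervalIntegrable_iff_integrableOn_Ioc_of_le hαβ).1 (hi1.sub hi2))
      (ae_restrict_of_forall_mem measurableSet_Ioc hnn),
    ← ENNReal.ofReal_mul hK.le, ENNReal.toReal_ofReal, intervalIntegral.integral_of_le hαβ]
  exact mul_nonneg hK.le (setIntegral_nonneg measurableSet_Ioc hnn)

lemma potential_mixture_of_ge {K c v₀ : ℝ} (hK : 0 < K) (hv₀ : 0 < v₀) (hc : v₀ < c)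
    {x : ℝ} (hx : 1 / c ≤ x) :
    (∫ y, Real.log |x - y| ∂mixture K c v₀) - ∫ y, Real.log |1 / c - y| ∂mixture K c v₀ =
      K / 4 * Real.log (c * x) ^ 2 - K * ∫ u in (1 / c)..x, arch (cosArg c v₀ u) / u := by
  have hc0 := hv₀.trans hc
  have hci : 0 < 1 / c := by positivity
  rw [potential_mixture_sub_of_interval hK hv₀ hc hci hx]
  · have hd : ∀ u ∈ uIcc (1 / c) x, HasDerivAt (fun u => Real.log (c * u) ^ 2 / 4)
        ((|Real.log (c * u)| / 2) / u) u := by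
      intro u hu
      rw [uIcc_of_le hx] at hu
      have hu0 : 0 < u := hci.trans_le hu.1
      have h1 : 1 ≤ c * u := by
        have := mul_le_mul_of_nonneg_left hu.1 hc0.le
        rwa [mul_one_div, div_self hc0.ne'] at this
      have h2 := ((((hasDerivAt_id u).const_mul c).log (mul_pos hc0 hu0).ne').pow 2).div_const 4
      refine h2.congr_deriv ?_
      rw [abs_of_nonneg (Real.log_nonneg h1)]
      simp only [id]
      field_simp
      norm_num
      ring
    rw [intervalIntegral.integral_eq_sub_of_hasDerivAt hd]
    · rw [mul_one_div, div_self hc0.ne', Real.log_one]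
      ring
    · apply ContinuousOn.intervalIntegrable
      intro u hu
      rw [uIcc_of_le hx] at hu
      have hu0 : 0 < u := hci.trans_le hu.1
      have : c * u ≠ 0 := by positivity
      exact (ContinuousAt.div (by fun_prop (disch := assumption)) continuousAt_id
        hu0.ne').continuousWithinAt
  · intro v hv
    have hv0 := hv₀.trans hv.1
    have hh := halfw_pos hv0 hv.2
    have hin := abs_lt.1 (abs_inv_sub_midpt_lt hv0 hv.2)
    -- To the right of `1/c` the left endpoint of the interval is never met, so the derivative
    -- formula for `arch` applies.
    have hgt : ∀ u, 1 / c ≤ u → -1 < (u - midpt c v) / halfw c v := by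
      intro u hu; rw [lt_div_iff₀ hh]; linarith [hin.1]
    have h := lintegral_deriv_of_nonneg_of_ne
      (F := fun u => arch ((u - midpt c v) / halfw c v) / v)
      (f := fun u => (√((v * u + 1) ^ 2 - 4 * c * u))⁻¹) (midpt c v + halfw c v) hx ?_ ?_ ?_
    · rw [h]
      have h0 : arch ((1 / c - midpt c v) / halfw c v) = 0 :=
        arch_of_le ((div_le_one hh).2 hin.2.le)
      simp only [h0, zero_div, sub_zero]
      congr 2
      -- If `x` lies between `1/c` and the midpoint it is inside the interval, and both values of
      -- `arch` are `0`.
      rcases le_or_gt (midpt c v) x with h1 | h1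
      · rw [abs_of_nonneg (sub_nonneg.2 h1)]
      · rw [arch_of_le, arch_of_le]
        · rw [abs_of_neg (sub_neg.2 h1), div_le_one hh]; linarith [hin.1]
        · rw [div_le_one hh]; linarith
    · have : Continuous fun u => (u - midpt c v) / halfw c v := by fun_prop
      exact ((continuous_arch.comp this).div_const v).continuousOn
    · intro u hu hne
      have hne1 : (u - midpt c v) / halfw c v ≠ 1 := by
        intro h1
        rw [div_eq_one_iff_eq hh.ne'] at h1
        exact hne (by linarith)
      have hd := ((hasDerivAt_arch (hgt u hu.1.le) hne1).comp u
        (((hasDerivAt_id u).sub_const (midpt c v)).div_const (halfw c v))).div_const v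
      refine hd.congr_deriv ?_
      have e : ((u - midpt c v) / halfw c v) ^ 2 - 1 =
          ((v * u + 1) ^ 2 - 4 * c * u) / (v * halfw c v) ^ 2 := by
        have := halfw_sq_sub hv0 hv.2.le u
        field_simp at this ⊢
        linarith
      rw [e, Real.sqrt_div' _ (by positivity), Real.sqrt_sq (by positivity)]
      rcases eq_or_ne (√((v * u + 1) ^ 2 - 4 * c * u)) 0 with h0 | h0
      · simp [h0]
      · field_simp
    · intro u _; positivity

lemma potential_mixture_of_le {K c v₀ : ℝ} (hK : 0 < K) (hv₀ : 0 < v₀) (hc : v₀ < c)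
    {x : ℝ} (hx0 : 0 < x) (hx : x ≤ 1 / c) :
    (∫ y, Real.log |x - y| ∂mixture K c v₀) - ∫ y, Real.log |1 / c - y| ∂mixture K c v₀ =
      K / 4 * Real.log (c * x) ^ 2 - K * ∫ u in x..(1 / c), arch (cosArg c v₀ u) / u := by
  have hc0 := hv₀.trans hc
  rw [potential_mixture_sub_of_interval hK hv₀ hc hx0 hx]
  · have hd : ∀ u ∈ uIcc x (1 / c), HasDerivAt (fun u => -(Real.log (c * u) ^ 2 / 4))
        ((|Real.log (c * u)| / 2) / u) u := by
      intro u hu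
      rw [uIcc_of_le hx] at hu
      have hu0 : 0 < u := hx0.trans_le hu.1
      have h1 : c * u ≤ 1 := by
        have := mul_le_mul_of_nonneg_left hu.2 hc0.le
        rwa [mul_one_div, div_self hc0.ne'] at this
      have h2 := ((((hasDerivAt_id u).const_mul c).log (mul_pos hc0 hu0).ne').pow 2).div_const 4
      refine h2.neg.congr_deriv ?_
      rw [abs_of_nonpos (Real.log_nonpos (by positivity) h1)]
      simp only [id]
      field_simp
      norm_num
      ring
    rw [intervalIntegral.integral_eq_sub_of_hasDerivAt hd]
    · rw [mul_one_div, div_self hc0.ne', Real.log_one]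
      ring
    · apply ContinuousOn.intervalIntegrable
      intro u hu
      rw [uIcc_of_le hx] at hu
      have hu0 : 0 < u := hx0.trans_le hu.1
      have : c * u ≠ 0 := by positivity
      exact (ContinuousAt.div (by fun_prop (disch := assumption)) continuousAt_id
        hu0.ne').continuousWithinAt
  · intro v hv
    have hv0 := hv₀.trans hv.1
    have hh := halfw_pos hv0 hv.2
    have hin := abs_lt.1 (abs_inv_sub_midpt_lt hv0 hv.2)
    have hgt : ∀ u, u ≤ 1 / c → -1 < (midpt c v - u) / halfw c v := by
      intro u hu; rw [lt_div_iff₀ hh]; linarith [hin.2]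
    have h := lintegral_deriv_of_nonneg_of_ne
      (F := fun u => -(arch ((midpt c v - u) / halfw c v) / v))
      (f := fun u => (√((v * u + 1) ^ 2 - 4 * c * u))⁻¹) (midpt c v - halfw c v) hx ?_ ?_ ?_
    · rw [h]
      have h0 : arch ((midpt c v - 1 / c) / halfw c v) = 0 :=
        arch_of_le ((div_le_one hh).2 (by linarith [hin.1]))
      simp only [h0, zero_div, neg_zero, zero_sub, neg_neg]
      congr 2
      rcases le_or_gt x (midpt c v) with h1 | h1
      · rw [abs_of_nonpos (sub_nonpos.2 h1), neg_sub]
      · rw [arch_of_le, arch_of_le]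
        · rw [abs_of_pos (sub_pos.2 h1), div_le_one hh]; linarith [hin.2]
        · rw [div_le_one hh]; linarith
    · have : Continuous fun u => (midpt c v - u) / halfw c v := by fun_prop
      exact ((continuous_arch.comp this).div_const v).neg.continuousOn
    · intro u hu hne
      have hne1 : (midpt c v - u) / halfw c v ≠ 1 := by
        intro h1
        rw [div_eq_one_iff_eq hh.ne'] at h1
        exact hne (by linarith)
      have hd := (((hasDerivAt_arch (hgt u hu.2.le) hne1).comp u
        (((hasDerivAt_id u).const_sub (midpt c v)).div_const (halfw c v))).div_const v).neg
      refine hd.congr_deriv ?_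
      have e : ((midpt c v - u) / halfw c v) ^ 2 - 1 =
          ((v * u + 1) ^ 2 - 4 * c * u) / (v * halfw c v) ^ 2 := by
        have := halfw_sq_sub hv0 hv.2.le u
        field_simp at this ⊢
        linarith
      rw [e, Real.sqrt_div' _ (by positivity), Real.sqrt_sq (by positivity)]
      rcases eq_or_ne (√((v * u + 1) ^ 2 - 4 * c * u)) 0 with h0 | h0
      · simp [h0]
      · field_simp
    · intro u _; positivity

/-! ### Equality on the support and strict inequality off it -/

lemma integral_arch_cosArg_eq_zero {c v α β : ℝ} (hv : 0 < v) (hvc : v < c)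
    (hα : α ∈ Icc (midpt c v - halfw c v) (midpt c v + halfw c v))
    (hβ : β ∈ Icc (midpt c v - halfw c v) (midpt c v + halfw c v)) :
    ∫ u in α..β, arch (cosArg c v u) / u = 0 := by
  rw [intervalIntegral.integral_congr (g := fun _ => 0), intervalIntegral.integral_zero]
  intro u hu
  have : u ∈ Icc (midpt c v - halfw c v) (midpt c v + halfw c v) := uIcc_subset_Icc hα hβ hu
  simp [arch_of_le (cosArg_le_one hv hvc this)]

lemma integral_arch_cosArg_pos {c v α β : ℝ} (hv : 0 < v) (hvc : v < c) (hα : 0 < α)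
    (hαβ : α < β)
    (h : ∃ u ∈ Icc α β, u ∉ Icc (midpt c v - halfw c v) (midpt c v + halfw c v)) :
    0 < ∫ u in α..β, arch (cosArg c v u) / u := by
  obtain ⟨u, hu, hu'⟩ := h
  have hc0 := hv.trans hvc
  have hu0 : 0 < u := hα.trans_le hu.1
  refine intervalIntegral.integral_pos hαβ
    ((continuousOn_arch_cosArg hc0).mono fun u hu => hα.trans_le hu.1)
    (fun x hx => div_nonneg (arch_nonneg _) (hα.trans hx.1).le) ⟨u, hu, ?_⟩
  exact div_pos (arch_pos (one_lt_cosArg hv hvc hu0 hu')) hu0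

lemma inv_mem_Icc {c v : ℝ} (hv : 0 < v) (hvc : v < c) :
    1 / c ∈ Icc (midpt c v - halfw c v) (midpt c v + halfw c v) := by
  have := abs_lt.1 (abs_inv_sub_midpt_lt hv hvc)
  constructor <;> linarith

lemma effective_potential_eq {K c v₀ : ℝ} (hK : 0 < K) (hv₀ : 0 < v₀) (hc : v₀ < c) {x : ℝ}
    (hx : x ∈ Icc (midpt c v₀ - halfw c v₀) (midpt c v₀ + halfw c v₀)) :
    2 * ∫ y, Real.log |x - y| ∂mixture K c v₀ =
      2 * (∫ y, Real.log |1 / c - y| ∂mixture K c v₀) + K / 2 * Real.log (c * x) ^ 2 := by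
  have hx0 : 0 < x := by linarith [hx.1, halfw_lt_midpt hv₀ hc.le]
  rcases le_total (1 / c) x with h | h
  · have := potential_mixture_of_ge hK hv₀ hc h
    rw [integral_arch_cosArg_eq_zero hv₀ hc (inv_mem_Icc hv₀ hc) hx] at this
    linarith
  · have := potential_mixture_of_le hK hv₀ hc hx0 h
    rw [integral_arch_cosArg_eq_zero hv₀ hc hx (inv_mem_Icc hv₀ hc)] at this
    linarith

lemma effective_potential_lt {K c v₀ : ℝ} (hK : 0 < K) (hv₀ : 0 < v₀) (hc : v₀ < c) {x : ℝ}
    (hx0 : 0 < x) (hx : x ∉ Icc (midpt c v₀ - halfw c v₀) (midpt c v₀ + halfw c v₀)) :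
    2 * ∫ y, Real.log |x - y| ∂mixture K c v₀ <
      2 * (∫ y, Real.log |1 / c - y| ∂mixture K c v₀) + K / 2 * Real.log (c * x) ^ 2 := by
  have hc0 := hv₀.trans hc
  have hne : x ≠ 1 / c := fun h => hx (h ▸ inv_mem_Icc hv₀ hc)
  rcases lt_or_gt_of_ne hne with h | h
  · have := potential_mixture_of_le hK hv₀ hc hx0 h.le
    have hp := mul_pos hK (integral_arch_cosArg_pos hv₀ hc hx0 h ⟨x, ⟨le_rfl, h.le⟩, hx⟩)
    linarith
  · have := potential_mixture_of_ge hK hv₀ hc h.le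
    have hp := mul_pos hK (integral_arch_cosArg_pos hv₀ hc (by positivity) h ⟨x, ⟨h.le, le_rfl⟩, hx⟩)
    linarith

lemma potential_mixture_ge {K c v₀ : ℝ} (hK : 0 < K) (hv₀ : 0 < v₀) (hc : v₀ < c) (x : ℝ) :
    ∫ y, Real.log |1 / c - y| ∂mixture K c v₀ ≤ ∫ y, Real.log |x - y| ∂mixture K c v₀ := by
  rw [← sub_nonneg, potential_mixture_sub hK hv₀ hc]
  exact ENNReal.toReal_nonneg

lemma mixture_univ {K c v₀ : ℝ} (hK : 0 < K) (hv₀ : 0 < v₀) (hc : v₀ < c) :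
    mixture K c v₀ univ = ENNReal.ofReal (K * Real.log (c / v₀)) := by
  have hpi := Real.pi_pos
  have hc0 := hv₀.trans hc
  have h1 : angleMeasure univ = 1 := by
    rw [angleMeasure]
    simp only [Measure.smul_apply, Measure.restrict_apply MeasurableSet.univ, univ_inter,
      Real.volume_Ioo, sub_zero, smul_eq_mul]
    rw [← ENNReal.ofReal_mul (by positivity), inv_mul_cancel₀ hpi.ne', ENNReal.ofReal_one]
  have h2 : paramMeasure K c v₀ univ = ENNReal.ofReal (K * Real.log (c / v₀)) := by
    rw [paramMeasure, withDensity_apply _ MeasurableSet.univ, Measure.restrict_univ,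
      (lintegral_deriv_of_nonneg (F := fun v => K * Real.log v) hc.le ?_ ?_ ?_).2,
      Real.log_div hc0.ne' hv₀.ne', mul_sub]
    · intro v hv
      have : v ≠ 0 := (hv₀.trans_le hv.1).ne'
      exact ContinuousAt.continuousWithinAt (by fun_prop (disch := assumption))
    · intro v hv
      have := (Real.hasDerivAt_log (hv₀.trans hv.1).ne').const_mul K
      rwa [← div_eq_mul_inv] at this
    · intro v hv
      exact div_nonneg hK.le (hv₀.trans hv.1).le
  rw [mixture, Measure.map_apply (measurable_arcsine_point c) MeasurableSet.univ, preimage_univ,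
    ← univ_prod_univ, Measure.prod_prod, h1, h2, mul_one]

end StieltjesWigert

namespace StieltjesWigert

/-! ### Boundary values of `G` and the real form of the equilibrium conditions -/

/-- The regularized logarithmic kernel `log |u + i ε|`. -/
noncomputable def logReg (ε u : ℝ) : ℝ := Real.log (u ^ 2 + ε ^ 2) / 2

lemma measurable_logReg (ε : ℝ) : Measurable (logReg ε) := by unfold logReg; fun_prop

lemma log_norm_eq_logReg (x y ε : ℝ) :
    Real.log ‖(x + ε * Complex.I - y : ℂ)‖ = logReg ε (x - y) := by
  have : ‖(x + ε * Complex.I - y : ℂ)‖ = √((x - y) ^ 2 + ε ^ 2) := by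
    rw [Complex.norm_def, Complex.normSq_apply]
    simp
    ring_nf
  rw [this, Real.log_sqrt (by positivity), logReg]

lemma log_abs_eq_logReg_zero (u : ℝ) : Real.log |u| = logReg 0 u := by
  rw [logReg, Real.log_abs]
  simp

/-- The last hypothesis excludes `u = ε = 0`, where `log 0 = 0` would break monotonicity. -/
lemma logReg_mono {ε δ u : ℝ} (hε : 0 ≤ ε) (h : ε ≤ δ) (hu : u ≠ 0 ∨ 0 < ε) :
    logReg ε u ≤ logReg δ u := by
  unfold logReg
  have : 0 < u ^ 2 + ε ^ 2 := by
    rcases hu with hu | hu <;> positivity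
  gcongr

lemma abs_logReg_le {ε u : ℝ} (hε : 0 ≤ ε) (h : ε ≤ 1) (hu : u ≠ 0) :
    |logReg ε u| ≤ |(Real.log |u|)| + |logReg 1 u| := by
  have h1 := logReg_mono hε h (Or.inl hu)
  have h0 := logReg_mono le_rfl hε (Or.inl hu)
  rw [← log_abs_eq_logReg_zero] at h0
  rw [abs_le]
  constructor
  · linarith [neg_abs_le (Real.log |u|), abs_nonneg (logReg 1 u)]
  · linarith [le_abs_self (logReg 1 u), abs_nonneg (Real.log |u|)]

/-- For `y > x` the limit point is on the branch cut, where the principal logarithm takes its value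
from above. Thus the upper boundary value is obtained by simply putting `ε = 0`. -/
lemma tendsto_log_upper {x y : ℝ} (h : y ≠ x) :
    Tendsto (fun ε : ℝ => Complex.log (x + ε * Complex.I - y)) (𝓝[>] 0)
      (𝓝 (Complex.log ((x : ℂ) - y))) := by
  have hcont : Tendsto (fun ε : ℝ => (x + ε * Complex.I - y : ℂ)) (𝓝[>] 0) (𝓝 ((x : ℂ) - y)) := by
    have : Continuous fun ε : ℝ => (x + ε * Complex.I - y : ℂ) := by fun_prop
    have := (this.tendsto 0).mono_left (nhdsWithin_le_nhds (s := Ioi 0))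
    simpa using this
  rcases lt_or_gt_of_ne h with h1 | h1
  · have hs : (x : ℂ) - y ∈ Complex.slitPlane := by
      rw [← Complex.ofReal_sub, Complex.ofReal_mem_slitPlane]; linarith
    exact ((continuousAt_clog hs).tendsto).comp hcont
  · have hw := Complex.continuousWithinAt_log_of_re_neg_of_im_zero (z := (x : ℂ) - y)
      (by simpa using h1) (by simp)
    refine hw.tendsto.comp (tendsto_nhdsWithin_iff.2 ⟨hcont, ?_⟩)
    filter_upwards [self_mem_nhdsWithin] with ε hε
    simpa using le_of_lt hε

/-- Dominated convergence: by monotonicity in `ε` the real part lies between its values at `0` and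
`1`, and the imaginary part is at most `π` in modulus. -/
lemma tendsto_gFun_upper {μ : Measure ℝ} [IsFiniteMeasure μ] {x : ℝ} (hx : μ {x} = 0)
    (h0 : Integrable (fun y => Real.log |x - y|) μ)
    (h1 : Integrable (fun y => logReg 1 (x - y)) μ) :
    Tendsto (fun ε : ℝ => gFun μ (x + ε * Complex.I)) (𝓝[>] 0)
      (𝓝 (∫ y, Complex.log ((x : ℂ) - (y : ℂ)) ∂μ)) := by
  unfold gFun
  have hne : ∀ᵐ y ∂μ, y ≠ x := by
    rw [ae_iff]; simpa using hx
  refine tendsto_integral_filter_of_dominated_convergence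
    (fun y => |(Real.log |x - y|)| + |logReg 1 (x - y)| + Real.pi) ?_ ?_ ?_ ?_
  · exact Eventually.of_forall fun ε => (Measurable.clog (by fun_prop)).aestronglyMeasurable
  · have : Ioc (0 : ℝ) 1 ∈ 𝓝[>] (0 : ℝ) := Ioc_mem_nhdsGT one_pos
    filter_upwards [this] with ε hε
    filter_upwards [hne] with y hy
    refine (Complex.norm_le_abs_re_add_abs_im _).trans ?_
    rw [Complex.log_re, Complex.log_im, log_norm_eq_logReg]
    exact add_le_add (abs_logReg_le hε.1.le hε.2 (sub_ne_zero.2 hy.symm)) (Complex.abs_arg_le_pi _)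
  · exact (h0.abs.add h1.abs).add (integrable_const _)
  · filter_upwards [hne] with y hy using tendsto_log_upper hy

lemma gFun_lower (μ : Measure ℝ) (x : ℝ) {ε : ℝ} (hε : 0 < ε) :
    gFun μ (x - ε * Complex.I) = (starRingEnd ℂ) (gFun μ (x + ε * Complex.I)) := by
  unfold gFun
  rw [← integral_conj]
  congr 1
  ext y
  rw [← Complex.log_conj]
  · congr 1; simp [sub_eq_add_neg]
  · intro h
    rw [Complex.arg_eq_pi_iff] at h
    simp at h
    exact hε.ne' h.2

lemma tendsto_gFun_lower {μ : Measure ℝ} {x : ℝ} {G : ℂ}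
    (h : Tendsto (fun ε : ℝ => gFun μ (x + ε * Complex.I)) (𝓝[>] 0) (𝓝 G)) :
    Tendsto (fun ε : ℝ => gFun μ (x - ε * Complex.I)) (𝓝[>] 0) (𝓝 ((starRingEnd ℂ) G)) := by
  refine ((Complex.continuous_conj.tendsto G).comp h).congr' ?_
  filter_upwards [self_mem_nhdsWithin] with ε hε
  exact (gFun_lower μ x hε).symm

lemma re_integral_log {μ : Measure ℝ} [IsFiniteMeasure μ] {x : ℝ}
    (h0 : Integrable (fun y => Real.log |x - y|) μ) :
    (∫ y, Complex.log ((x : ℂ) - (y : ℂ)) ∂μ).re = ∫ y, Real.log |x - y| ∂μ := by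
  have hre : ∀ y : ℝ, (Complex.log ((x : ℂ) - (y : ℂ))).re = Real.log |x - y| := by
    intro y
    rw [Complex.log_re, ← Complex.ofReal_sub, Complex.norm_real, Real.norm_eq_abs]
  have hi : Integrable (fun y : ℝ => Complex.log ((x : ℂ) - (y : ℂ))) μ := by
    refine (h0.abs.add (integrable_const Real.pi)).mono'
      (Measurable.clog (by fun_prop)).aestronglyMeasurable (ae_of_all _ fun y => ?_)
    refine (Complex.norm_le_abs_re_add_abs_im _).trans ?_
    rw [hre, Complex.log_im]
    exact add_le_add le_rfl (Complex.abs_arg_le_pi _)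
  simp only [← hre]
  exact (integral_re hi).symm

lemma re_gFun {μ : Measure ℝ} {x ε : ℝ}
    (h : Integrable (fun y : ℝ => Complex.log (x + ε * Complex.I - (y : ℂ))) μ) :
    (gFun μ (x + ε * Complex.I)).re = ∫ y, logReg ε (x - y) ∂μ := by
  unfold gFun
  have hre : ∀ y : ℝ, (Complex.log (x + ε * Complex.I - (y : ℂ))).re = logReg ε (x - y) := by
    intro y
    rw [Complex.log_re, log_norm_eq_logReg]
  simp only [← hre]
  exact (integral_re h).symm

lemma integrable_logReg {μ : Measure ℝ} {x ε : ℝ}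
    (h : Integrable (fun y : ℝ => Complex.log (x + ε * Complex.I - (y : ℂ))) μ) :
    Integrable (fun y => logReg ε (x - y)) μ := by
  have hre : ∀ y : ℝ, (Complex.log (x + ε * Complex.I - (y : ℂ))).re = logReg ε (x - y) := by
    intro y
    rw [Complex.log_re, log_norm_eq_logReg]
  simp only [← hre]
  exact h.re

lemma tendsto_logReg {u : ℝ} (hu : u ≠ 0) :
    Tendsto (fun ε => logReg ε u) (𝓝[>] 0) (𝓝 (Real.log |u|)) := by
  rw [log_abs_eq_logReg_zero]
  have : ContinuousAt (fun ε => logReg ε u) 0 := by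
    unfold logReg
    have : u ^ 2 + (0 : ℝ) ^ 2 ≠ 0 := by positivity
    fun_prop (disch := assumption)
  exact this.tendsto.mono_left nhdsWithin_le_nhds

lemma tendsto_logReg_zero : Tendsto (fun ε => logReg ε 0) (𝓝[>] 0) atBot := by
  have : (fun ε => logReg ε 0) = Real.log := by
    ext ε; simp [logReg]
  rw [this]
  exact Real.tendsto_log_nhdsGT_zero

/-- If the regularized potentials converge as `ε ↓ 0`, there is no atom and the logarithm is
integrable. -/
lemma integrable_log_of_tendsto {μ : Measure ℝ} {x L : ℝ}
    (hi : ∀ ε : ℝ, 0 < ε → Integrable (fun y => logReg ε (x - y)) μ)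
    (hL : Tendsto (fun ε => ∫ y, logReg ε (x - y) ∂μ) (𝓝[>] 0) (𝓝 L)) :
    μ {x} = 0 ∧ Integrable (fun y => Real.log |x - y|) μ := by
  obtain ⟨s, -, hs0, hs⟩ := exists_seq_strictAnti_tendsto' (α := ℝ) (x := 0) (y := 1) one_pos
  have hsw : Tendsto s atTop (𝓝[>] 0) :=
    tendsto_nhdsWithin_iff.2 ⟨hs, Eventually.of_forall fun n => (hs0 n).1⟩
  -- The kernel increases with `ε`, so these differences are nonnegative and Fatou's lemma applies.
  -- Their limit is infinite at `y = x`, which excludes an atom, and elsewhere it is `logReg 1 - log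
  -- |x - y|`, which is thereby integrable.
  set f : ℕ → ℝ → ENNReal := fun n y => ENNReal.ofReal (logReg 1 (x - y) - logReg (s n) (x - y))
    with hf
  have hfm : ∀ n, Measurable (f n) := fun n =>
    ENNReal.measurable_ofReal.comp (((measurable_logReg 1).comp (by fun_prop)).sub
      ((measurable_logReg (s n)).comp (by fun_prop)))
  have hint : ∀ n, ∫⁻ y, f n y ∂μ = ENNReal.ofReal ((∫ y, logReg 1 (x - y) ∂μ) -
      ∫ y, logReg (s n) (x - y) ∂μ) := by
    intro n
    rw [← integral_sub (hi 1 one_pos) (hi _ (hs0 n).1), ofReal_integral_eq_lintegral_ofReal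
      (f := fun y => logReg 1 (x - y) - logReg (s n) (x - y))
      ((hi 1 one_pos).sub (hi _ (hs0 n).1))]
    exact ae_of_all _ fun y => sub_nonneg.2 (logReg_mono (hs0 n).1.le (hs0 n).2.le
      (Or.inr (hs0 n).1))
  have hlim : Tendsto (fun n => ∫⁻ y, f n y ∂μ) atTop
      (𝓝 (ENNReal.ofReal ((∫ y, logReg 1 (x - y) ∂μ) - L))) := by
    simp only [hint]
    exact ENNReal.tendsto_ofReal (tendsto_const_nhds.sub (hL.comp hsw))
  have hfatou : ∫⁻ y, liminf (fun n => f n y) atTop ∂μ < ⊤ := by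
    refine (lintegral_liminf_le hfm).trans_lt ?_
    rw [hlim.liminf_eq]
    exact ENNReal.ofReal_lt_top
  have hx : liminf (fun n => f n x) atTop = ⊤ := by
    apply Tendsto.liminf_eq
    simp only [hf, sub_self]
    refine ENNReal.tendsto_ofReal_atTop.comp ?_
    exact tendsto_atTop_add_const_left _ _ (tendsto_neg_atBot_atTop.comp
      (tendsto_logReg_zero.comp hsw))
  have hne : ∀ y, y ≠ x → liminf (fun n => f n y) atTop =
      ENNReal.ofReal (logReg 1 (x - y) - Real.log |x - y|) := by
    intro y hy
    apply Tendsto.liminf_eq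
    exact ENNReal.tendsto_ofReal (tendsto_const_nhds.sub
      ((tendsto_logReg (sub_ne_zero.2 hy.symm)).comp hsw))
  have hatom : μ {x} = 0 := by
    have := ae_lt_top (Measurable.liminf hfm) hfatou.ne
    rw [ae_iff] at this
    refine measure_mono_null ?_ this
    rintro y rfl
    simp [hx]
  have haene : ∀ᵐ y ∂μ, y ≠ x := by rw [ae_iff]; simpa using hatom
  refine ⟨hatom, ?_⟩
  have hd : Integrable (fun y => logReg 1 (x - y) - Real.log |x - y|) μ := by
    refine ⟨(((measurable_logReg 1).comp (by fun_prop : Measurable fun y => x - y)).sub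
      (by fun_prop : Measurable fun y => Real.log |x - y|)).aestronglyMeasurable, ?_⟩
    rw [hasFiniteIntegral_iff_ofReal]
    · refine lt_of_le_of_lt (le_of_eq (lintegral_congr_ae ?_)) hfatou
      filter_upwards [haene] with y hy
      rw [hne y hy]
    · filter_upwards [haene] with y hy
      rw [log_abs_eq_logReg_zero]
      exact sub_nonneg.2 (logReg_mono le_rfl zero_le_one (Or.inl (sub_ne_zero.2 hy.symm)))
  have := (hi 1 one_pos).sub hd
  refine this.congr (ae_of_all _ fun y => ?_)
  simp

lemma upper_notMem {x ε : ℝ} (hε : ε ≠ 0) :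
    (x + ε * Complex.I : ℂ) ∉ ((↑) : ℝ → ℂ) '' Ici 0 := by
  rintro ⟨y, -, hy⟩
  have := congrArg Complex.im hy
  simp at this
  exact hε this.symm

/-- The lower boundary value is the conjugate of the upper one, so `G₊ + G₋` is real and equals
twice the logarithmic potential. -/
lemma add_conj_integral_log {μ : Measure ℝ} [IsFiniteMeasure μ] {x : ℝ}
    (h0 : Integrable (fun y => Real.log |x - y|) μ) :
    (∫ y, Complex.log ((x : ℂ) - (y : ℂ)) ∂μ) +
      (starRingEnd ℂ) (∫ y, Complex.log ((x : ℂ) - (y : ℂ)) ∂μ) =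
      ((2 * ∫ y, Real.log |x - y| ∂μ : ℝ) : ℂ) := by
  rw [Complex.add_conj, re_integral_log h0]

/-- The equilibrium conditions in terms of the logarithmic potential on the real line. -/
lemma IsEquilibriumMeasure.exists_potential {w : ℝ → ℝ} {m : ℝ} {μ : Measure ℝ}
    (h : IsEquilibriumMeasure w m μ) : ∃ l : ℝ, ∀ x : ℝ, 0 < x →
      μ {x} = 0 ∧ Integrable (fun y => Real.log |x - y|) μ ∧
      (x ∈ μ.support → 2 * (∫ y, Real.log |x - y| ∂μ) + Real.log (w x) = l) ∧
      (x ∉ μ.support → 2 * (∫ y, Real.log |x - y| ∂μ) + Real.log (w x) < l) := by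
  have hfin : IsFiniteMeasure μ := ⟨by rw [h.mass]; exact ENNReal.ofReal_lt_top⟩
  obtain ⟨Gp, Gm, l, hl⟩ := h.variational
  refine ⟨l, fun x hx => ?_⟩
  obtain ⟨hp, hm, hin, hout⟩ := hl x hx
  have hI : ∀ ε : ℝ, 0 < ε →
      Integrable (fun y : ℝ => Complex.log (x + ε * Complex.I - (y : ℂ))) μ := fun ε hε =>
    h.integrable_log _ (upper_notMem hε.ne')
  have hL : Tendsto (fun ε => ∫ y, logReg ε (x - y) ∂μ) (𝓝[>] 0) (𝓝 (Gp x).re) := by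
    refine ((Complex.continuous_re.tendsto _).comp hp).congr' ?_
    filter_upwards [self_mem_nhdsWithin] with ε hε
    exact re_gFun (hI ε hε)
  obtain ⟨hatom, hlog⟩ := integrable_log_of_tendsto (fun ε hε => integrable_logReg (hI ε hε)) hL
  have hup := tendsto_gFun_upper hatom hlog (integrable_logReg (hI 1 one_pos))
  have e1 := tendsto_nhds_unique hp hup
  have e2 := tendsto_nhds_unique hm (tendsto_gFun_lower hup)
  rw [e1, e2, add_conj_integral_log hlog] at hin hout
  refine ⟨hatom, hlog, fun hs => ?_, fun hs => ?_⟩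
  · have := hin hs
    norm_cast at this
    linarith
  · obtain ⟨r, hr, hr'⟩ := hout hs
    norm_cast at hr'
    linarith

/-- The converse passage. As the mass sits on a compact subset of `(0, ∞)`, `log (z - y)` is bounded
on it for every admissible `z`. -/
lemma isEquilibriumMeasure_of_potential {w : ℝ → ℝ} {m : ℝ} {μ : Measure ℝ} {α β l : ℝ}
    (hα : 0 < α) (hmass : μ univ = ENNReal.ofReal m) (hsupp : μ (Icc α β)ᶜ = 0)
    (h : ∀ x : ℝ, 0 < x →
      μ {x} = 0 ∧ Integrable (fun y => Real.log |x - y|) μ ∧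
      (x ∈ μ.support → 2 * (∫ y, Real.log |x - y| ∂μ) + Real.log (w x) = l) ∧
      (x ∉ μ.support → 2 * (∫ y, Real.log |x - y| ∂μ) + Real.log (w x) < l)) :
    IsEquilibriumMeasure w m μ := by
  have hfin : IsFiniteMeasure μ := ⟨by rw [hmass]; exact ENNReal.ofReal_lt_top⟩
  have hae : ∀ᵐ y ∂μ, y ∈ Icc α β := by rw [ae_iff]; exact hsupp
  have hint : ∀ z : ℂ, z ∉ ((↑) : ℝ → ℂ) '' Ici 0 →
      Integrable (fun x : ℝ => Complex.log (z - (x : ℂ))) μ := by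
    intro z hz
    have hne : ∀ y ∈ Icc α β, ‖z - (y : ℂ)‖ ≠ 0 := by
      intro y hy h0
      rw [norm_eq_zero, sub_eq_zero] at h0
      exact hz ⟨y, (hα.trans_le hy.1).le, h0.symm⟩
    have hcont : ContinuousOn (fun y : ℝ => Real.log ‖z - (y : ℂ)‖) (Icc α β) :=
      ContinuousOn.log (by fun_prop) hne
    obtain ⟨C, hC⟩ := isCompact_Icc.exists_bound_of_continuousOn hcont
    refine Integrable.of_bound (Measurable.clog (by fun_prop)).aestronglyMeasurable
      (C + Real.pi) ?_
    filter_upwards [hae] with y hy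
    refine (Complex.norm_le_abs_re_add_abs_im _).trans ?_
    rw [Complex.log_re, Complex.log_im]
    exact add_le_add (hC y hy) (Complex.abs_arg_le_pi _)
  refine ⟨hmass, ?_, hint, ?_⟩
  · refine measure_mono_null ?_ hsupp
    intro x hx hx'
    exact absurd hx'.1 (not_le.2 (lt_of_le_of_lt hx hα))
  · refine ⟨fun x => ∫ y, Complex.log ((x : ℂ) - (y : ℂ)) ∂μ,
      fun x => (starRingEnd ℂ) (∫ y, Complex.log ((x : ℂ) - (y : ℂ)) ∂μ), l, fun x hx => ?_⟩
    obtain ⟨hatom, hlog, hin, hout⟩ := h x hx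
    have h1 := integrable_logReg (x := x) (ε := 1) (hint _ (upper_notMem one_ne_zero))
    have hup := tendsto_gFun_upper hatom hlog h1
    refine ⟨hup, tendsto_gFun_lower hup, fun hs => ?_, fun hs => ?_⟩
    · rw [add_conj_integral_log hlog]
      have := hin hs
      norm_cast
      linarith
    · refine ⟨2 * (∫ y, Real.log |x - y| ∂μ) + Real.log (w x) - l, by linarith [hout hs], ?_⟩
      rw [add_conj_integral_log hlog]
      push_cast
      rfl

end StieltjesWigert

namespace StieltjesWigert

/-! ### Positivity of the logarithmic energy -/

lemma integral_exp_mul_cos {s : ℝ} (hs : 0 < s) (u : ℝ) :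
    ∫ t in Ioi (0 : ℝ), Real.exp (-(s * t)) * Real.cos (u * t) = s / (u ^ 2 + s ^ 2) := by
  have h := integral_exp_mul_complex_Ioi (a := -s + u * Complex.I) (by simpa using hs) 0
  have hi := integrableOn_exp_mul_complex_Ioi (a := -s + u * Complex.I) (by simpa using hs) 0
  have hre : ∀ t : ℝ, Real.exp (-(s * t)) * Real.cos (u * t) =
      (Complex.exp ((-s + u * Complex.I) * t)).re := by
    intro t
    rw [Complex.exp_re]
    simp
  simp only [hre]
  have h2 := integral_re hi.integrable
  have h3 := congrArg Complex.re h
  refine h2.trans (h3.trans ?_)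
  have hne : s ^ 2 + u ^ 2 ≠ 0 := by positivity
  simp [Complex.div_re, Complex.normSq_apply]
  field_simp
  ring

/-- The measure `e^{-st} ds dt` without its density, on `(ε, T] × (0, ∞)`. -/
noncomputable def stripMeasure (ε T : ℝ) : Measure (ℝ × ℝ) :=
  (volume.restrict (Ioc ε T)).prod (volume.restrict (Ioi 0))

instance (ε T : ℝ) : SFinite (stripMeasure ε T) := by unfold stripMeasure; infer_instance

lemma ae_stripMeasure (ε T : ℝ) : ∀ᵐ q ∂stripMeasure ε T, q.1 ∈ Ioc ε T ∧ q.2 ∈ Ioi (0 : ℝ) := by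
  rw [stripMeasure, Measure.prod_restrict]
  filter_upwards [ae_restrict_mem (measurableSet_Ioc.prod measurableSet_Ioi)] with q hq using hq

lemma integrable_exp_stripMeasure {ε : ℝ} (hε : 0 < ε) (T : ℝ) :
    Integrable (fun q : ℝ × ℝ => Real.exp (-(q.1 * q.2))) (stripMeasure ε T) := by
  have h1 : Integrable (fun _ : ℝ => (1 : ℝ)) (volume.restrict (Ioc ε T)) := integrable_const _
  have h2 : Integrable (fun t : ℝ => Real.exp (-ε * t)) (volume.restrict (Ioi 0)) :=
    exp_neg_integrableOn_Ioi 0 hε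
  refine (h1.mul_prod h2).mono' (by fun_prop) ?_
  filter_upwards [ae_stripMeasure ε T] with q hq
  rw [Real.norm_eq_abs, Real.abs_exp, one_mul]
  apply Real.exp_le_exp.2
  have := mul_le_mul_of_nonneg_right hq.1.1.le (le_of_lt hq.2)
  linarith

/-- The derivative of `logReg` in its parameter `s` is the Laplace transform of `t ↦ cos (u t)`. The
kernel is thus a positive superposition of cosines, which the Fourier transform diagonalizes. -/
lemma logReg_sub_eq_integral {ε T : ℝ} (hε : 0 < ε) (hT : ε ≤ T) (u : ℝ) :
    logReg T u - logReg ε u =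
      ∫ q, Real.exp (-(q.1 * q.2)) * Real.cos (u * q.2) ∂stripMeasure ε T := by
  have hi : Integrable (fun q : ℝ × ℝ => Real.exp (-(q.1 * q.2)) * Real.cos (u * q.2))
      (stripMeasure ε T) := by
    refine (integrable_exp_stripMeasure hε T).mono' (by fun_prop) (ae_of_all _ fun q => ?_)
    rw [norm_mul, Real.norm_eq_abs, Real.norm_eq_abs, Real.abs_exp]
    exact mul_le_of_le_one_right (Real.exp_pos _).le (Real.abs_cos_le_one _)
  have hd : ∀ s ∈ uIcc ε T, HasDerivAt (fun s => logReg s u) (s / (u ^ 2 + s ^ 2)) s := by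
    intro s hs
    rw [uIcc_of_le hT] at hs
    have hs0 : 0 < s := hε.trans_le hs.1
    have h := ((((hasDerivAt_id s).pow 2).const_add (u ^ 2)).log (by simp; positivity)).div_const 2
    refine h.congr_deriv ?_
    simp
    field_simp
  have hc : ContinuousOn (fun s => s / (u ^ 2 + s ^ 2)) (uIcc ε T) := by
    rw [uIcc_of_le hT]
    apply ContinuousOn.div (by fun_prop) (by fun_prop)
    intro s hs
    have hs0 : 0 < s := hε.trans_le hs.1
    positivity
  rw [← intervalIntegral.integral_eq_sub_of_hasDerivAt hd hc.intervalIntegrable,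
    intervalIntegral.integral_of_le hT, stripMeasure, integral_prod _ hi]
  refine setIntegral_congr_fun measurableSet_Ioc fun s hs => ?_
  exact (integral_exp_mul_cos (hε.trans hs.1) u).symm

lemma integral_cos_sub_prod (α β : Measure ℝ) [IsFiniteMeasure α] [IsFiniteMeasure β] (t : ℝ) :
    ∫ p : ℝ × ℝ, Real.cos ((p.1 - p.2) * t) ∂α.prod β =
      (charFun α t * (starRingEnd ℂ) (charFun β t)).re := by
  rw [charFun_apply_real, charFun_apply_real, ← integral_conj, ← integral_prod_mul]
  have hi : Integrable (fun p : ℝ × ℝ => Complex.exp (t * p.1 * Complex.I) *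
      (starRingEnd ℂ) (Complex.exp (t * p.2 * Complex.I))) (α.prod β) := by
    refine Integrable.of_bound (by fun_prop) 1 (ae_of_all _ fun p => ?_)
    rw [norm_mul, RCLike.norm_conj, ← Complex.ofReal_mul, ← Complex.ofReal_mul,
      Complex.norm_exp_ofReal_mul_I, Complex.norm_exp_ofReal_mul_I, mul_one]
  refine Eq.trans ?_ (integral_re hi)
  congr 1
  ext p
  rw [← Complex.exp_conj, ← Complex.exp_add]
  have : (t * p.1 * Complex.I + (starRingEnd ℂ) (t * p.2 * Complex.I) : ℂ) =
      (((p.1 - p.2) * t : ℝ) : ℂ) * Complex.I := by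
    simp
    ring
  rw [this]
  exact (Complex.exp_ofReal_mul_I_re _).symm

/-- The regularized mutual logarithmic energy. -/
noncomputable def energyReg (ε : ℝ) (α β : Measure ℝ) : ℝ :=
  ∫ p : ℝ × ℝ, logReg ε (p.1 - p.2) ∂α.prod β

lemma ae_abs_sub_le {α β : Measure ℝ} [SFinite α] [SFinite β] {M : ℝ}
    (hα : ∀ᵐ x ∂α, x ∈ Icc 0 M) (hβ : ∀ᵐ x ∂β, x ∈ Icc 0 M) :
    ∀ᵐ p : ℝ × ℝ ∂α.prod β, |p.1 - p.2| ≤ M := by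
  filter_upwards [Measure.quasiMeasurePreserving_fst.ae hα,
    Measure.quasiMeasurePreserving_snd.ae hβ] with p h1 h2
  rw [abs_le]
  constructor <;> linarith [h1.1, h1.2, h2.1, h2.2]

lemma measurable_logReg_sub (ε : ℝ) : Measurable fun p : ℝ × ℝ => logReg ε (p.1 - p.2) :=
  (measurable_logReg ε).comp (by fun_prop)

lemma integrable_logReg_prod {α β : Measure ℝ} [IsFiniteMeasure α] [IsFiniteMeasure β] {M : ℝ}
    (hα : ∀ᵐ x ∂α, x ∈ Icc 0 M) (hβ : ∀ᵐ x ∂β, x ∈ Icc 0 M) {ε : ℝ} (hε : 0 < ε) :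
    Integrable (fun p : ℝ × ℝ => logReg ε (p.1 - p.2)) (α.prod β) := by
  have hc : Continuous (logReg ε) := by
    unfold logReg
    exact (Continuous.log (by fun_prop) fun u => by positivity).div_const 2
  obtain ⟨C, hC⟩ := (isCompact_Icc (a := -M) (b := M)).exists_bound_of_continuousOn hc.continuousOn
  refine Integrable.of_bound (measurable_logReg_sub ε).aestronglyMeasurable C ?_
  filter_upwards [ae_abs_sub_le hα hβ] with p hp
  exact hC _ (abs_le.1 hp)

lemma energyReg_sub {α β : Measure ℝ} [IsFiniteMeasure α] [IsFiniteMeasure β] {M : ℝ}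
    (hα : ∀ᵐ x ∂α, x ∈ Icc 0 M) (hβ : ∀ᵐ x ∂β, x ∈ Icc 0 M) {ε T : ℝ} (hε : 0 < ε)
    (hT : ε ≤ T) :
    Integrable (fun q : ℝ × ℝ => Real.exp (-(q.1 * q.2)) *
      (charFun α q.2 * (starRingEnd ℂ) (charFun β q.2)).re) (stripMeasure ε T) ∧
    energyReg T α β - energyReg ε α β = ∫ q, Real.exp (-(q.1 * q.2)) *
      (charFun α q.2 * (starRingEnd ℂ) (charFun β q.2)).re ∂stripMeasure ε T := by
  have hI : Integrable (Function.uncurry fun (p q : ℝ × ℝ) =>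
      Real.exp (-(q.1 * q.2)) * Real.cos ((p.1 - p.2) * q.2))
      ((α.prod β).prod (stripMeasure ε T)) := by
    refine ((integrable_const (μ := α.prod β) (1 : ℝ)).mul_prod
      (integrable_exp_stripMeasure hε T)).mono' (by unfold Function.uncurry; fun_prop)
      (ae_of_all _ fun z => ?_)
    simp only [Function.uncurry]
    rw [norm_mul, Real.norm_eq_abs, Real.norm_eq_abs, Real.abs_exp, one_mul]
    exact mul_le_of_le_one_right (Real.exp_pos _).le (Real.abs_cos_le_one _)
  have e : ∀ q : ℝ × ℝ, ∫ p : ℝ × ℝ, Real.exp (-(q.1 * q.2)) * Real.cos ((p.1 - p.2) * q.2)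
      ∂α.prod β = Real.exp (-(q.1 * q.2)) *
      (charFun α q.2 * (starRingEnd ℂ) (charFun β q.2)).re := by
    intro q
    rw [integral_const_mul, integral_cos_sub_prod]
  constructor
  · simp only [← e]
    exact hI.integral_prod_right
  · have hT0 := hε.trans_le hT
    rw [energyReg, energyReg, ← integral_sub (integrable_logReg_prod hα hβ hT0)
      (integrable_logReg_prod hα hβ hε)]
    simp only [logReg_sub_eq_integral hε hT]
    rw [integral_integral_swap hI]
    simp only [e]

/-- The regularized energy of the difference of two measures. -/
noncomputable def energyDiff (ε : ℝ) (μ ν : Measure ℝ) : ℝ :=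
  energyReg ε μ μ - 2 * energyReg ε μ ν + energyReg ε ν ν

/-- The cross terms assemble into a squared modulus, so the regularized energy of `μ - ν` is
nondecreasing in `ε`. -/
lemma energyDiff_sub {μ ν : Measure ℝ} [IsFiniteMeasure μ] [IsFiniteMeasure ν] {M : ℝ}
    (hμ : ∀ᵐ x ∂μ, x ∈ Icc 0 M) (hν : ∀ᵐ x ∂ν, x ∈ Icc 0 M) {ε T : ℝ} (hε : 0 < ε)
    (hT : ε ≤ T) :
    Integrable (fun q : ℝ × ℝ => Real.exp (-(q.1 * q.2)) *
      Complex.normSq (charFun μ q.2 - charFun ν q.2)) (stripMeasure ε T) ∧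
    energyDiff T μ ν - energyDiff ε μ ν = ∫ q, Real.exp (-(q.1 * q.2)) *
      Complex.normSq (charFun μ q.2 - charFun ν q.2) ∂stripMeasure ε T := by
  obtain ⟨i1, e1⟩ := energyReg_sub hμ hμ hε hT
  obtain ⟨i2, e2⟩ := energyReg_sub hμ hν hε hT
  obtain ⟨i3, e3⟩ := energyReg_sub hν hν hε hT
  have key : ∀ q : ℝ × ℝ, Real.exp (-(q.1 * q.2)) *
      Complex.normSq (charFun μ q.2 - charFun ν q.2) =
      Real.exp (-(q.1 * q.2)) * (charFun μ q.2 * (starRingEnd ℂ) (charFun μ q.2)).re -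
      2 * (Real.exp (-(q.1 * q.2)) * (charFun μ q.2 * (starRingEnd ℂ) (charFun ν q.2)).re) +
      Real.exp (-(q.1 * q.2)) * (charFun ν q.2 * (starRingEnd ℂ) (charFun ν q.2)).re := by
    intro q
    rw [Complex.normSq_sub, Complex.mul_conj, Complex.mul_conj, Complex.ofReal_re,
      Complex.ofReal_re]
    ring
  simp only [key]
  refine ⟨(i1.sub (i2.const_mul 2)).add i3, ?_⟩
  refine Eq.trans ?_ (integral_add (i1.sub (i2.const_mul 2)) i3).symm
  refine Eq.trans ?_ (congrArg (· + _) (integral_sub i1 (i2.const_mul 2)).symm)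
  rw [integral_const_mul, ← e1, ← e2, ← e3]
  unfold energyDiff
  ring

/-- At large scale only the masses are seen, with an error `O(T⁻²)`. For equal masses the logarithms
cancel in `energyDiff`. -/
lemma tendsto_energyReg_atTop {α β : Measure ℝ} [IsFiniteMeasure α] [IsFiniteMeasure β] {M : ℝ}
    (hα : ∀ᵐ x ∂α, x ∈ Icc 0 M) (hβ : ∀ᵐ x ∂β, x ∈ Icc 0 M) :
    Tendsto (fun T => energyReg T α β - (α.real univ * β.real univ) * Real.log T) atTop (𝓝 0) := by
  have hb : ∀ᶠ T in atTop, ‖energyReg T α β - (α.real univ * β.real univ) * Real.log T‖ ≤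
      (M ^ 2 / 2 * (α.prod β).real univ) * (T ^ 2)⁻¹ := by
    filter_upwards [eventually_gt_atTop 0] with T hT
    have h1 : (α.real univ * β.real univ) * Real.log T =
        ∫ _p : ℝ × ℝ, Real.log T ∂α.prod β := by
      rw [integral_const, smul_eq_mul, ← univ_prod_univ, measureReal_prod_prod]
    rw [h1, energyReg, ← integral_sub (integrable_logReg_prod hα hβ hT) (integrable_const _)]
    refine (norm_integral_le_of_norm_le_const (C := M ^ 2 / 2 * (T ^ 2)⁻¹) ?_).trans
      (le_of_eq (by ring))
    filter_upwards [ae_abs_sub_le hα hβ] with p hp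
    have hu : (p.1 - p.2) ^ 2 ≤ M ^ 2 := by
      rw [← sq_abs]; exact pow_le_pow_left₀ (abs_nonneg _) hp 2
    have e : logReg T (p.1 - p.2) - Real.log T = Real.log (1 + (p.1 - p.2) ^ 2 * (T ^ 2)⁻¹) / 2 := by
      have : (p.1 - p.2) ^ 2 + T ^ 2 = T ^ 2 * (1 + (p.1 - p.2) ^ 2 * (T ^ 2)⁻¹) := by
        field_simp; ring
      rw [logReg, this, Real.log_mul (by positivity) (by positivity), Real.log_pow]
      push_cast; ring
    rw [e, Real.norm_eq_abs, abs_of_nonneg]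
    · have := Real.log_le_sub_one_of_pos (show 0 < 1 + (p.1 - p.2) ^ 2 * (T ^ 2)⁻¹ by positivity)
      have h3 : (p.1 - p.2) ^ 2 * (T ^ 2)⁻¹ ≤ M ^ 2 * (T ^ 2)⁻¹ := by gcongr
      linarith
    · apply div_nonneg _ two_pos.le
      apply Real.log_nonneg
      have : 0 ≤ (p.1 - p.2) ^ 2 * (T ^ 2)⁻¹ := by positivity
      linarith
  refine squeeze_zero_norm' hb ?_
  simpa using (tendsto_inv_atTop_zero.comp (tendsto_pow_atTop (α := ℝ) two_ne_zero)).const_mul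
    (M ^ 2 / 2 * (α.prod β).real univ)

lemma tendsto_energyReg_zero {α β : Measure ℝ} [IsFiniteMeasure α] [IsFiniteMeasure β] {M : ℝ}
    (hα : ∀ᵐ x ∂α, x ∈ Icc 0 M) (hβ : ∀ᵐ x ∂β, x ∈ Icc 0 M)
    (hne : ∀ᵐ p : ℝ × ℝ ∂α.prod β, p.1 ≠ p.2)
    (hlog : Integrable (fun p : ℝ × ℝ => Real.log |p.1 - p.2|) (α.prod β)) :
    Tendsto (fun ε => energyReg ε α β) (𝓝[>] 0)
      (𝓝 (∫ p : ℝ × ℝ, Real.log |p.1 - p.2| ∂α.prod β)) := by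
  unfold energyReg
  refine tendsto_integral_filter_of_dominated_convergence
    (fun p => |(Real.log |p.1 - p.2|)| + |logReg 1 (p.1 - p.2)|) ?_ ?_ ?_ ?_
  · exact Eventually.of_forall fun ε => (measurable_logReg_sub ε).aestronglyMeasurable
  · have : Ioc (0 : ℝ) 1 ∈ 𝓝[>] (0 : ℝ) := Ioc_mem_nhdsGT one_pos
    filter_upwards [this] with ε hε
    filter_upwards [hne] with p hp
    exact abs_logReg_le hε.1.le hε.2 (sub_ne_zero.2 hp)
  · exact hlog.abs.add (integrable_logReg_prod hα hβ one_pos).abs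
  · filter_upwards [hne] with p hp using tendsto_logReg (sub_ne_zero.2 hp)

/-- Two compactly supported measures of equal mass whose difference has nonnegative logarithmic
energy `∬ log |x - y|` are equal. -/
lemma eq_of_energy_nonneg {μ ν : Measure ℝ} [IsFiniteMeasure μ] [IsFiniteMeasure ν] {M : ℝ}
    (hμ : ∀ᵐ x ∂μ, x ∈ Icc 0 M) (hν : ∀ᵐ x ∂ν, x ∈ Icc 0 M) (hmass : μ univ = ν univ)
    (hne₁ : ∀ᵐ p : ℝ × ℝ ∂μ.prod μ, p.1 ≠ p.2) (hne₂ : ∀ᵐ p : ℝ × ℝ ∂μ.prod ν, p.1 ≠ p.2)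
    (hne₃ : ∀ᵐ p : ℝ × ℝ ∂ν.prod ν, p.1 ≠ p.2)
    (hlog₁ : Integrable (fun p : ℝ × ℝ => Real.log |p.1 - p.2|) (μ.prod μ))
    (hlog₂ : Integrable (fun p : ℝ × ℝ => Real.log |p.1 - p.2|) (μ.prod ν))
    (hlog₃ : Integrable (fun p : ℝ × ℝ => Real.log |p.1 - p.2|) (ν.prod ν))
    (h : 0 ≤ (∫ p : ℝ × ℝ, Real.log |p.1 - p.2| ∂μ.prod μ) -
      2 * (∫ p : ℝ × ℝ, Real.log |p.1 - p.2| ∂μ.prod ν) +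
      ∫ p : ℝ × ℝ, Real.log |p.1 - p.2| ∂ν.prod ν) : μ = ν := by
  have hreal : μ.real univ = ν.real univ := by simp [Measure.real, hmass]
  have hmono : ∀ ε T : ℝ, 0 < ε → ε ≤ T → energyDiff ε μ ν ≤ energyDiff T μ ν := by
    intro ε T hε hT
    rw [← sub_nonneg, (energyDiff_sub hμ hν hε hT).2]
    exact integral_nonneg fun q => mul_nonneg (Real.exp_pos _).le (Complex.normSq_nonneg _)
  have hzero : Tendsto (fun ε => energyDiff ε μ ν) (𝓝[>] 0)
      (𝓝 ((∫ p : ℝ × ℝ, Real.log |p.1 - p.2| ∂μ.prod μ) -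
      2 * (∫ p : ℝ × ℝ, Real.log |p.1 - p.2| ∂μ.prod ν) +
      ∫ p : ℝ × ℝ, Real.log |p.1 - p.2| ∂ν.prod ν)) :=
    ((tendsto_energyReg_zero hμ hμ hne₁ hlog₁).sub
      ((tendsto_energyReg_zero hμ hν hne₂ hlog₂).const_mul 2)).add
      (tendsto_energyReg_zero hν hν hne₃ hlog₃)
  have htop : Tendsto (fun T => energyDiff T μ ν) atTop (𝓝 0) := by
    have := ((tendsto_energyReg_atTop hμ hμ).sub
      ((tendsto_energyReg_atTop hμ hν).const_mul 2)).add (tendsto_energyReg_atTop hν hν)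
    rw [mul_zero, sub_zero, add_zero] at this
    refine this.congr fun T => ?_
    rw [hreal, energyDiff]
    ring
  -- A nondecreasing function with nonnegative limit at `0` and limit `0` at infinity vanishes
  -- identically. Its increment over `[1, 2]` already suffices.
  have h1 : 0 ≤ energyDiff 1 μ ν := by
    refine h.trans (le_of_tendsto hzero ?_)
    filter_upwards [Ioc_mem_nhdsGT (one_pos (α := ℝ))] with ε hε using hmono _ _ hε.1 hε.2
  have h2 : energyDiff 2 μ ν ≤ 0 := by
    refine ge_of_tendsto htop ?_
    filter_upwards [eventually_ge_atTop 2] with T hT using hmono _ _ two_pos hT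
  obtain ⟨hint, heq⟩ := energyDiff_sub hμ hν one_pos (one_le_two (α := ℝ))
  have h12 := hmono 1 2 one_pos one_le_two
  rw [show energyDiff 2 μ ν - energyDiff 1 μ ν = 0 by linarith] at heq
  have hae := (integral_eq_zero_iff_of_nonneg (fun q => mul_nonneg (Real.exp_pos _).le
    (Complex.normSq_nonneg _)) hint).1 heq.symm
  have hae2 := Measure.ae_ae_of_ae_prod hae
  have hD : Continuous fun t : ℝ => Complex.normSq (charFun μ t - charFun ν t) :=
    Complex.continuous_normSq.comp (continuous_charFun.sub continuous_charFun)
  -- One slice `s` is enough: the exponential never vanishes, and continuity of the characteristic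
  -- functions turns equality almost everywhere on `t > 0` into equality.
  have hex : ∃ s : ℝ, ∀ᵐ t ∂(volume.restrict (Ioi (0 : ℝ))),
      Real.exp (-(s * t)) * Complex.normSq (charFun μ t - charFun ν t) = 0 := by
    have : NeZero (volume.restrict (Ioc (1 : ℝ) 2)) := ⟨by
      rw [Ne, Measure.restrict_eq_zero]
      simp⟩
    exact hae2.exists
  obtain ⟨s, hs⟩ := hex
  have hpos : ∀ t : ℝ, 0 < t → charFun μ t = charFun ν t := by
    intro t ht
    by_contra hcon
    have hop : IsOpen ({t : ℝ | Complex.normSq (charFun μ t - charFun ν t) ≠ 0} ∩ Ioi 0) :=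
      (isOpen_ne_fun hD continuous_const).inter isOpen_Ioi
    have hp := hop.measure_pos volume ⟨t, by
      simpa [sub_eq_zero] using hcon, ht⟩
    rw [ae_restrict_iff' measurableSet_Ioi, ae_iff] at hs
    refine hp.ne' (measure_mono_null ?_ hs)
    rintro r ⟨hr, hr0⟩
    exact not_forall.2 ⟨hr0, mul_ne_zero (Real.exp_pos _).ne' hr⟩
  refine Measure.ext_of_charFun (funext fun t => ?_)
  rcases lt_trichotomy t 0 with ht | ht | ht
  · have := congrArg (starRingEnd ℂ) (hpos _ (neg_pos.2 ht))
    rwa [← charFun_neg, ← charFun_neg, neg_neg] at this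
  · rw [ht, charFun_zero, charFun_zero, hreal]
  · exact hpos t ht

end StieltjesWigert

namespace StieltjesWigert

/-! ### Uniqueness of the equilibrium measure -/

/-- On a bounded set `log |x - y|` is bounded above by `A = log (max 1 M)`, so `|log |x - y|| ≤ 2 A
- log |x - y|`. A lower bound on the potential therefore controls the absolute integral. -/
lemma integrable_log_prod {α β : Measure ℝ} [IsFiniteMeasure α] [IsFiniteMeasure β] {M C : ℝ}
    (hα : ∀ᵐ x ∂α, x ∈ Icc 0 M) (hβ : ∀ᵐ x ∂β, x ∈ Icc 0 M)
    (hlog : ∀ᵐ x ∂α, Integrable (fun y => Real.log |x - y|) β ∧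
      C ≤ ∫ y, Real.log |x - y| ∂β) :
    Integrable (fun p : ℝ × ℝ => Real.log |p.1 - p.2|) (α.prod β) := by
  have hm : Measurable fun p : ℝ × ℝ => Real.log |p.1 - p.2| := by fun_prop
  rw [integrable_prod_iff hm.aestronglyMeasurable]
  refine ⟨hlog.mono fun x hx => hx.1, ?_⟩
  refine Integrable.of_bound hm.aestronglyMeasurable.norm.integral_prod_right'
    (∫ _y, 2 * Real.log (max 1 M) ∂β - C) ?_
  filter_upwards [hα, hlog] with x hx hl
  rw [Real.norm_eq_abs, abs_of_nonneg (integral_nonneg fun _ => norm_nonneg _)]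
  have h1 : ∫ y, ‖Real.log |x - y|‖ ∂β ≤ ∫ y, (2 * Real.log (max 1 M) - Real.log |x - y|) ∂β := by
    refine integral_mono_ae hl.1.norm ((integrable_const _).sub hl.1) ?_
    filter_upwards [hβ] with y hy
    have hM : 0 ≤ Real.log (max 1 M) := Real.log_nonneg (le_max_left _ _)
    have hle : Real.log |x - y| ≤ Real.log (max 1 M) := by
      rcases eq_or_ne (x - y) 0 with h0 | h0
      · simpa [h0] using hM
      · apply Real.log_le_log (abs_pos.2 h0)
        refine le_trans ?_ (le_max_right _ _)
        rw [abs_le]; constructor <;> linarith [hx.1, hx.2, hy.1, hy.2]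
    rw [Real.norm_eq_abs, abs_le]
    constructor <;> linarith
  rw [integral_sub (integrable_const _) hl.1] at h1
  exact h1.trans (sub_le_sub_left hl.2 _)

lemma ae_prod_ne {α β : Measure ℝ} [SFinite α] [SFinite β] (h : ∀ᵐ x ∂α, β {x} = 0) :
    ∀ᵐ p : ℝ × ℝ ∂α.prod β, p.1 ≠ p.2 := by
  have hs : MeasurableSet {p : ℝ × ℝ | p.1 ≠ p.2} :=
    (isOpen_ne_fun continuous_fst continuous_snd).measurableSet
  rw [Measure.ae_prod_iff_ae_ae hs]
  filter_upwards [h] with x hx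
  rw [ae_iff]
  simpa [eq_comm] using hx

/-- Two measures of equal mass on a compact subset of `(0, ∞)` that satisfy the variational
conditions for the same weight are equal. -/
lemma eq_of_variational {w : ℝ → ℝ} {μ ν : Measure ℝ} [IsFiniteMeasure μ] [IsFiniteMeasure ν]
    {M C lμ lν : ℝ} (hmass : μ univ = ν univ)
    (hμ : ∀ᵐ x ∂μ, x ∈ Ioc 0 M ∧ x ∈ μ.support) (hν : ∀ᵐ x ∂ν, x ∈ Ioc 0 M ∧ x ∈ ν.support)
    (hCμ : ∀ᵐ x ∂μ, C ≤ ∫ y, Real.log |x - y| ∂μ) (hCν : ∀ x, C ≤ ∫ y, Real.log |x - y| ∂ν)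
    (h1 : ∀ x : ℝ, 0 < x → μ {x} = 0 ∧ Integrable (fun y => Real.log |x - y|) μ ∧
      (x ∈ μ.support → 2 * (∫ y, Real.log |x - y| ∂μ) + Real.log (w x) = lμ) ∧
      (x ∉ μ.support → 2 * (∫ y, Real.log |x - y| ∂μ) + Real.log (w x) < lμ))
    (h2 : ∀ x : ℝ, 0 < x → ν {x} = 0 ∧ Integrable (fun y => Real.log |x - y|) ν ∧
      (x ∈ ν.support → 2 * (∫ y, Real.log |x - y| ∂ν) + Real.log (w x) = lν) ∧
      (x ∉ ν.support → 2 * (∫ y, Real.log |x - y| ∂ν) + Real.log (w x) < lν)) : μ = ν := by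
  have le1 : ∀ x : ℝ, 0 < x → 2 * (∫ y, Real.log |x - y| ∂μ) + Real.log (w x) ≤ lμ := by
    intro x hx
    by_cases hs : x ∈ μ.support
    · exact ((h1 x hx).2.2.1 hs).le
    · exact ((h1 x hx).2.2.2 hs).le
  have le2 : ∀ x : ℝ, 0 < x → 2 * (∫ y, Real.log |x - y| ∂ν) + Real.log (w x) ≤ lν := by
    intro x hx
    by_cases hs : x ∈ ν.support
    · exact ((h2 x hx).2.2.1 hs).le
    · exact ((h2 x hx).2.2.2 hs).le
  have hμ' : ∀ᵐ x ∂μ, x ∈ Icc 0 M := hμ.mono fun x hx => ⟨hx.1.1.le, hx.1.2⟩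
  have hν' : ∀ᵐ x ∂ν, x ∈ Icc 0 M := hν.mono fun x hx => ⟨hx.1.1.le, hx.1.2⟩
  have i1 : Integrable (fun p : ℝ × ℝ => Real.log |p.1 - p.2|) (μ.prod μ) := by
    refine integrable_log_prod (C := C) hμ' hμ' ?_
    filter_upwards [hμ, hCμ] with x hx hC using ⟨(h1 x hx.1.1).2.1, hC⟩
  have i2 : Integrable (fun p : ℝ × ℝ => Real.log |p.1 - p.2|) (μ.prod ν) := by
    refine integrable_log_prod (C := C) hμ' hν' ?_
    filter_upwards [hμ] with x hx using ⟨(h2 x hx.1.1).2.1, hCν x⟩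
  have i3 : Integrable (fun p : ℝ × ℝ => Real.log |p.1 - p.2|) (ν.prod ν) := by
    refine integrable_log_prod (C := C) hν' hν' ?_
    filter_upwards [hν] with x hx using ⟨(h2 x hx.1.1).2.1, hCν x⟩
  refine eq_of_energy_nonneg hμ' hν' hmass
    (ae_prod_ne (hμ.mono fun x hx => (h1 x hx.1.1).1))
    (ae_prod_ne (hμ.mono fun x hx => (h2 x hx.1.1).1))
    (ae_prod_ne (hν.mono fun x hx => (h2 x hx.1.1).1)) i1 i2 i3 ?_
  have hreal : μ.real univ = ν.real univ := by simp [Measure.real, hmass]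
  have j1 : Integrable (fun x => ∫ y, Real.log |x - y| ∂μ) μ := i1.integral_prod_left
  have j2 : Integrable (fun x => ∫ y, Real.log |x - y| ∂ν) μ := i2.integral_prod_left
  have j3 : Integrable (fun x => ∫ y, Real.log |x - y| ∂ν) ν := i3.integral_prod_left
  have j4 : Integrable (fun x => ∫ y, Real.log |y - x| ∂μ) ν := i2.integral_prod_right
  -- On its own support a measure satisfies its condition with equality, while the other satisfies
  -- an inequality. Integrating and adding the two estimates cancels the constants, because the
  -- masses agree, and leaves the energy of `μ - ν`.
  have s1 : μ.real univ * ((lμ - lν) / 2) ≤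
      ∫ x, ((∫ y, Real.log |x - y| ∂μ) - ∫ y, Real.log |x - y| ∂ν) ∂μ := by
    rw [← smul_eq_mul, ← integral_const]
    refine integral_mono_ae (integrable_const _) (j1.sub j2) ?_
    filter_upwards [hμ] with x hx
    have a1 := (h1 x hx.1.1).2.2.1 hx.2
    have a2 := le2 x hx.1.1
    linarith
  have s2 : ν.real univ * ((lν - lμ) / 2) ≤
      ∫ x, ((∫ y, Real.log |x - y| ∂ν) - ∫ y, Real.log |y - x| ∂μ) ∂ν := by
    rw [← smul_eq_mul, ← integral_const]
    refine integral_mono_ae (integrable_const _) (j3.sub j4) ?_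
    filter_upwards [hν] with x hx
    have a1 := (h2 x hx.1.1).2.2.1 hx.2
    have a2 := le1 x hx.1.1
    simp only [abs_sub_comm _ x]
    linarith
  rw [integral_sub j1 j2] at s1
  rw [integral_sub j3 j4] at s2
  have e1 := integral_prod _ i1
  have e2 := integral_prod _ i2
  have e2' := integral_prod_symm _ i2
  have e3 := integral_prod _ i3
  simp only at e1 e2 e2' e3
  rw [hreal] at s1
  linarith

lemma log_weight {k : ℕ} {x : ℝ} (hx : 0 < x) :
    Real.log (weight k x) = -((k : ℝ) ^ 2 / 4) * Real.log x ^ 2 - Real.log x := by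
  unfold weight
  rw [Real.log_mul (by positivity) (Real.exp_pos _).ne', Real.log_exp, one_div, Real.log_inv]
  ring

/-- The part of the support of an equilibrium measure in `(0, ∞)` is bounded away from `0`
and `∞`. -/
lemma IsEquilibriumMeasure.exists_log_bound {k : ℕ} (hk : 0 < k) {m : ℝ} (hm : 0 ≤ m)
    {μ : Measure ℝ} (h : IsEquilibriumMeasure (weight k) m μ) :
    ∃ B : ℝ, 0 ≤ B ∧ ∀ x : ℝ, 0 < x → x ∈ μ.support → |Real.log x| ≤ B := by
  have hfin : IsFiniteMeasure μ := ⟨by rw [h.mass]; exact ENNReal.ofReal_lt_top⟩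
  obtain ⟨l, hl⟩ := h.exists_potential
  have hpos : ∀ᵐ y ∂μ, 0 < y := by
    rw [ae_iff]; simpa [not_lt, Iic_def] using h.null_Iic
  have hI : Integrable (fun y : ℝ => Real.log (1 + y)) μ := by
    -- Integrability at the single point `z = -1` controls the mass near infinity.
    have h1 := (h.integrable_log (-1) (by
      rintro ⟨y, hy, hy'⟩
      have : y = -1 := by exact_mod_cast hy'
      rw [this] at hy
      norm_num at hy)).re
    refine h1.congr (ae_of_all _ fun y => ?_)
    change (Complex.log (-1 - (y : ℂ))).re = Real.log (1 + y)
    rw [Complex.log_re, ← Real.log_abs (1 + y)]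
    congr 1
    rw [← abs_neg, show (-1 - (y : ℂ)) = ((-(1 + y) : ℝ) : ℂ) by push_cast; ring,
      Complex.norm_real, Real.norm_eq_abs]
  set D := ∫ y, Real.log (1 + y) ∂μ
  have hmr : μ.real univ = m := by rw [Measure.real, h.mass, ENNReal.toReal_ofReal hm]
  set Q := |2 * D + 2 * m * Real.log 2 - l|
  -- With `L = |log x|`, the equality on the support yields `L²/4 ≤ (2m + 1) L + Q`, which fails
  -- once `L` exceeds this constant.
  refine ⟨4 * (2 * m + 1) + 4 * Q + 1, by positivity, fun x hx hs => ?_⟩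
  obtain ⟨-, hlog, hin, -⟩ := hl x hx
  have heq := hin hs
  rw [log_weight hx] at heq
  -- For positive arguments `|x - y| ≤ (1 + x)(1 + y)`.
  have hU : ∫ y, Real.log |x - y| ∂μ ≤ m * Real.log (1 + x) + D := by
    have : ∫ y, Real.log |x - y| ∂μ ≤ ∫ y, (Real.log (1 + x) + Real.log (1 + y)) ∂μ := by
      refine integral_mono_ae hlog ((integrable_const _).add hI) ?_
      filter_upwards [hpos] with y hy
      rw [← Real.log_mul (by positivity) (by positivity)]
      rcases eq_or_ne (x - y) 0 with h0 | h0
      · simp only [h0, abs_zero, Real.log_zero]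
        apply Real.log_nonneg
        nlinarith [mul_pos hx hy]
      · apply Real.log_le_log (abs_pos.2 h0)
        rw [abs_le]
        constructor <;> nlinarith [mul_pos hx hy]
    rwa [integral_add (integrable_const _) hI, integral_const, hmr, smul_eq_mul] at this
  have hlog1 : Real.log (1 + x) ≤ Real.log 2 + |Real.log x| := by
    rcases le_total x 1 with h1 | h1
    · have := Real.log_le_log (by positivity) (show 1 + x ≤ 2 by linarith)
      linarith [abs_nonneg (Real.log x)]
    · have := Real.log_le_log (by positivity) (show 1 + x ≤ 2 * x by linarith)
      rw [Real.log_mul two_ne_zero hx.ne'] at this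
      linarith [le_abs_self (Real.log x)]
  have hk1 : (1 : ℝ) ≤ (k : ℝ) ^ 2 := by
    have : (1 : ℝ) ≤ k := by exact_mod_cast hk
    nlinarith
  set L := |Real.log x| with hL
  have hLn : 0 ≤ L := abs_nonneg _
  have hLsq : Real.log x ^ 2 = L ^ 2 := (sq_abs _).symm
  rw [hLsq] at heq
  have h3 := mul_le_mul_of_nonneg_left hlog1 hm
  have hQ := le_abs_self (2 * D + 2 * m * Real.log 2 - l)
  change _ ≤ Q at hQ
  have hQn : 0 ≤ Q := abs_nonneg _
  have h4 : L ^ 2 / 4 ≤ (k : ℝ) ^ 2 / 4 * L ^ 2 := by nlinarith [sq_nonneg L]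
  have h5 : L ^ 2 / 4 ≤ (2 * m + 1) * L + Q := by
    linarith [neg_abs_le (Real.log x)]
  by_contra hcon
  rw [not_le] at hcon
  have hL1 : 1 ≤ L := by linarith
  have h6 : L * (4 * (2 * m + 1) + 4 * Q + 1) ≤ L * L := by gcongr
  nlinarith [mul_le_mul_of_nonneg_left hL1 hQn]

/-! ### The superposition is the equilibrium measure -/

lemma support_mixture {K c v₀ : ℝ} (hK : 0 < K) (hv₀ : 0 < v₀) (hc : v₀ < c) :
    (mixture K c v₀).support = Icc (midpt c v₀ - halfw c v₀) (midpt c v₀ + halfw c v₀) := by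
  have hh := halfw_pos hv₀ hc
  have ha := halfw_lt_midpt hv₀ hc.le
  have hm : Measurable fun y => ENNReal.ofReal (arccosDensity K c v₀ y) := by
    unfold arccosDensity cosArg
    fun_prop
  have hdens := mixture_eq_withDensity_Icc hK hv₀ hc
  set a := midpt c v₀ - halfw c v₀ with ha'
  set b := midpt c v₀ + halfw c v₀ with hb'
  apply Subset.antisymm
  · refine Measure.support_subset_of_isClosed isClosed_Icc ?_
    rw [hdens]
    exact (withDensity_absolutelyContinuous _ _).ae_le (ae_restrict_mem measurableSet_Icc)
  · rw [← closure_Ioo (show a ≠ b by intro h; linarith)]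
    refine closure_minimal (fun x hx => ?_) Measure.isClosed_support
    rw [Measure.mem_support_iff_forall]
    intro U hU
    obtain ⟨O, hOs, hO, hxO⟩ := mem_nhds_iff.1 (inter_mem hU (isOpen_Ioo.mem_nhds hx))
    refine lt_of_lt_of_le ?_ (measure_mono (hOs.trans inter_subset_left))
    rw [hdens, pos_iff_ne_zero, Ne, withDensity_apply_eq_zero hm]
    have hsub : O ⊆ {y | ENNReal.ofReal (arccosDensity K c v₀ y) ≠ 0} ∩ O := by
      intro y hy
      have hy' := (hOs hy).2
      have hy0 : 0 < y := by linarith [hy'.1]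
      refine ⟨?_, hy⟩
      have : 0 < Real.arccos (cosArg c v₀ y) :=
        Real.arccos_pos.2 ((cosArg_lt_one_iff hv₀ hc hy0).2 hy')
      have hpi := Real.pi_pos
      have hp : 0 < arccosDensity K c v₀ y := by unfold arccosDensity; positivity
      exact (ENNReal.ofReal_pos.2 hp).ne'
    intro h0
    have h1 := measure_mono_null hsub h0
    rw [Measure.restrict_eq_self _ (hOs.trans (inter_subset_right.trans Ioo_subset_Icc_self))] at h1
    exact (hO.measure_pos volume ⟨x, hxO⟩).ne' h1

lemma mixture_singleton {K c v₀ : ℝ} (hK : 0 < K) (hv₀ : 0 < v₀) (hc : v₀ < c) (x : ℝ) :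
    mixture K c v₀ {x} = 0 := by
  rw [mixture_eq_withDensity_Icc hK hv₀ hc]
  exact (withDensity_absolutelyContinuous _ _) (by simp)

/-! ### The parameters belonging to the weight -/

section

variable {k : ℕ}

/-- Completing the square in `log x`; this determines `c = e^{2/k²}` and `K = k²/2`. -/
lemma log_weight_eq (hk : 0 < k) {x : ℝ} (hx : 0 < x) :
    Real.log (weight k x) = 1 / (k : ℝ) ^ 2 -
      ((k : ℝ) ^ 2 / 2) / 2 * Real.log (Real.exp (2 / (k : ℝ) ^ 2) * x) ^ 2 := by
  have : (k : ℝ) ≠ 0 := by exact_mod_cast hk.ne'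
  rw [log_weight hx, Real.log_mul (Real.exp_pos _).ne' hx.ne', Real.log_exp]
  field_simp
  ring

lemma param_lt (hk : 0 < k) : Real.exp (-(2 / (k : ℝ))) < Real.exp (2 / (k : ℝ) ^ 2) := by
  have : (0 : ℝ) < k := by exact_mod_cast hk
  apply Real.exp_lt_exp.2
  have h1 : 0 < 2 / (k : ℝ) := by positivity
  have h2 : 0 < 2 / (k : ℝ) ^ 2 := by positivity
  linarith

/-- The equilibrium measure, as a superposition of arcsine laws. -/
noncomputable def equilibrium (k : ℕ) : Measure ℝ :=
  mixture ((k : ℝ) ^ 2 / 2) (Real.exp (2 / (k : ℝ) ^ 2)) (Real.exp (-(2 / (k : ℝ))))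

/-- The left endpoint of the support. -/
noncomputable def leftEnd (k : ℕ) : ℝ :=
  midpt (Real.exp (2 / (k : ℝ) ^ 2)) (Real.exp (-(2 / (k : ℝ)))) -
    halfw (Real.exp (2 / (k : ℝ) ^ 2)) (Real.exp (-(2 / (k : ℝ))))

/-- The right endpoint of the support. -/
noncomputable def rightEnd (k : ℕ) : ℝ :=
  midpt (Real.exp (2 / (k : ℝ) ^ 2)) (Real.exp (-(2 / (k : ℝ)))) +
    halfw (Real.exp (2 / (k : ℝ) ^ 2)) (Real.exp (-(2 / (k : ℝ))))

lemma leftEnd_pos (hk : 0 < k) : 0 < leftEnd k :=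
  sub_pos.2 (halfw_lt_midpt (Real.exp_pos _) (param_lt hk).le)

lemma leftEnd_lt_rightEnd (hk : 0 < k) : leftEnd k < rightEnd k := by
  have := halfw_pos (Real.exp_pos _) (param_lt hk)
  unfold leftEnd rightEnd
  linarith

lemma equilibrium_univ (hk : 0 < k) : equilibrium k univ = ENNReal.ofReal (k + 1) := by
  have : (k : ℝ) ≠ 0 := by exact_mod_cast hk.ne'
  rw [equilibrium, mixture_univ (by positivity) (Real.exp_pos _) (param_lt hk), ← Real.exp_sub,
    Real.log_exp]
  congr 1
  field_simp
  ring

lemma support_equilibrium (hk : 0 < k) :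
    (equilibrium k).support = Icc (leftEnd k) (rightEnd k) :=
  support_mixture (by positivity) (Real.exp_pos _) (param_lt hk)

lemma equilibrium_variational (hk : 0 < k) : ∃ l : ℝ, ∀ x : ℝ, 0 < x →
    equilibrium k {x} = 0 ∧ Integrable (fun y => Real.log |x - y|) (equilibrium k) ∧
    (x ∈ (equilibrium k).support →
      2 * (∫ y, Real.log |x - y| ∂equilibrium k) + Real.log (weight k x) = l) ∧
    (x ∉ (equilibrium k).support →
      2 * (∫ y, Real.log |x - y| ∂equilibrium k) + Real.log (weight k x) < l) := by
  have hK : 0 < (k : ℝ) ^ 2 / 2 := by positivity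
  refine ⟨2 * (∫ y, Real.log |1 / Real.exp (2 / (k : ℝ) ^ 2) - y| ∂equilibrium k) +
    1 / (k : ℝ) ^ 2, fun x hx => ⟨mixture_singleton hK (Real.exp_pos _) (param_lt hk) x,
      integrable_log_mixture hK (Real.exp_pos _) (param_lt hk) x, fun hs => ?_, fun hs => ?_⟩⟩
  · rw [support_equilibrium hk] at hs
    rw [log_weight_eq hk hx]
    have := effective_potential_eq hK (Real.exp_pos _) (param_lt hk) hs
    unfold equilibrium
    linarith
  · rw [support_equilibrium hk] at hs
    rw [log_weight_eq hk hx]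
    have := effective_potential_lt hK (Real.exp_pos _) (param_lt hk) hx hs
    unfold equilibrium
    linarith

lemma isEquilibriumMeasure_equilibrium (hk : 0 < k) :
    IsEquilibriumMeasure (weight k) (k + 1) (equilibrium k) := by
  obtain ⟨l, hl⟩ := equilibrium_variational hk
  refine isEquilibriumMeasure_of_potential (leftEnd_pos hk) (β := rightEnd k)
    (equilibrium_univ hk) ?_ hl
  rw [← support_equilibrium hk]
  exact Measure.measure_compl_support

lemma IsEquilibriumMeasure.eq_equilibrium (hk : 0 < k) {μ : Measure ℝ}
    (h : IsEquilibriumMeasure (weight k) (k + 1) μ) : μ = equilibrium k := by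
  have hf1 : IsFiniteMeasure μ := ⟨by rw [h.mass]; exact ENNReal.ofReal_lt_top⟩
  have hf2 : IsFiniteMeasure (equilibrium k) :=
    ⟨by rw [equilibrium_univ hk]; exact ENNReal.ofReal_lt_top⟩
  have hK : 0 < (k : ℝ) ^ 2 / 2 := by positivity
  obtain ⟨B, hB, hbound⟩ := h.exists_log_bound hk (by positivity)
  obtain ⟨l₁, h₁⟩ := h.exists_potential
  obtain ⟨l₂, h₂⟩ := equilibrium_variational hk
  have hpos : ∀ᵐ y ∂μ, 0 < y := by
    rw [ae_iff]; simpa [not_lt, Iic_def] using h.null_Iic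
  have hμs : ∀ᵐ x ∂μ, x ∈ μ.support := Measure.support_mem_ae
  have hνs : ∀ᵐ x ∂equilibrium k, x ∈ (equilibrium k).support := Measure.support_mem_ae
  set c₀ := ∫ y, Real.log |1 / Real.exp (2 / (k : ℝ) ^ 2) - y| ∂equilibrium k
  -- On the support `2 U = l₁ - log w ≥ l₁ + log x ≥ l₁ - B`, where `U` is the potential of `μ`. The
  -- potential of the mixture is smallest at `1/c`, with value `c₀`.
  refine eq_of_variational (w := weight k) (M := max (Real.exp B) (rightEnd k))
    (C := min ((l₁ - B) / 2) c₀) (by rw [h.mass, equilibrium_univ hk]) ?_ ?_ ?_ ?_ h₁ h₂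
  · filter_upwards [hpos, hμs] with x hx hs
    refine ⟨⟨hx, le_max_of_le_left ?_⟩, hs⟩
    rw [← Real.log_le_iff_le_exp hx]
    exact (le_abs_self _).trans (hbound x hx hs)
  · filter_upwards [hνs] with x hs
    refine ⟨?_, hs⟩
    rw [support_equilibrium hk] at hs
    exact ⟨(leftEnd_pos hk).trans_le hs.1, le_max_of_le_right hs.2⟩
  · filter_upwards [hpos, hμs] with x hx hs
    refine (min_le_left _ _).trans ?_
    have e := (h₁ x hx).2.2.1 hs
    rw [log_weight hx] at e
    have b := hbound x hx hs
    have : 0 ≤ (k : ℝ) ^ 2 / 4 * Real.log x ^ 2 := by positivity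
    linarith [neg_abs_le (Real.log x)]
  · intro x
    exact (min_le_right _ _).trans
      (potential_mixture_ge hK (Real.exp_pos _) (param_lt hk) x)

end

end StieltjesWigert

namespace StieltjesWigert

/-! ### Contour integrals in the slit plane -/

lemma intervalIntegrable_deriv_of_contDiffOn {γ : ℝ → ℂ} {α β : ℝ} (hαβ : α < β)
    (h : ContDiffOn ℝ 1 γ (Icc α β)) : IntervalIntegrable (deriv γ) volume α β := by
  have hc := h.continuousOn_derivWithin (uniqueDiffOn_Icc hαβ) le_rfl
  rw [← uIcc_of_le hαβ.le] at hc
  have hi := hc.intervalIntegrable (μ := volume)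
  rw [uIcc_of_le hαβ.le] at hi
  rw [intervalIntegrable_iff_integrableOn_Ioo_of_le hαβ.le] at hi ⊢
  exact hi.congr_fun (fun x hx => derivWithin_of_mem_nhds (Icc_mem_nhds hx.1 hx.2))
    measurableSet_Ioo

lemma IsSimpleClosedContour.regular {γ : ℝ → ℂ} (h : IsSimpleClosedContour γ) :
    ContinuousOn γ (Icc 0 1) ∧ IntervalIntegrable (deriv γ) volume 0 1 ∧
    ∃ s : Set ℝ, s.Countable ∧ ∀ x ∈ Ioo (0 : ℝ) 1 \ s, HasDerivAt γ (deriv γ x) x := by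
  obtain ⟨n, t, ht, ht0, ht1, hd⟩ := h.piecewise_contDiff
  have key : ∀ i : Fin (n + 1), ContinuousOn γ (Icc 0 (t i)) ∧
      IntervalIntegrable (deriv γ) volume 0 (t i) ∧
      ∀ x ∈ Ioo 0 (t i) \ range t, HasDerivAt γ (deriv γ x) x := by
    intro i
    induction i using Fin.induction with
    | zero =>
      rw [ht0]
      refine ⟨by simp, by simp, by simp⟩
    | succ i ih =>
      obtain ⟨h1, h2, h3⟩ := ih
      have hlt : t i.castSucc < t i.succ := ht (Fin.castSucc_lt_succ)
      have h0 : 0 ≤ t i.castSucc := by rw [← ht0]; exact ht.monotone (Fin.zero_le _)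
      refine ⟨?_, h2.trans (intervalIntegrable_deriv_of_contDiffOn hlt (hd i)), ?_⟩
      · rw [← Icc_union_Icc_eq_Icc h0 hlt.le]
        exact h1.union_of_isClosed (hd i).continuousOn isClosed_Icc isClosed_Icc
      · rintro x ⟨hx, hxt⟩
        rcases lt_trichotomy x (t i.castSucc) with hlt' | heq | hgt
        · exact h3 x ⟨⟨hx.1, hlt'⟩, hxt⟩
        · exact absurd ⟨_, heq.symm⟩ hxt
        · exact (((hd i).differentiableOn one_ne_zero).differentiableAt
            (Icc_mem_nhds hgt hx.2)).hasDerivAt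
  have := key (Fin.last n)
  rw [ht1] at this
  exact ⟨this.1, this.2.1, range t, countable_range t, this.2.2⟩

lemma contourIntegral_eq_zero_of_primitive {γ : ℝ → ℂ} (h : IsSimpleClosedContour γ)
    {U : Set ℂ} (hU : ∀ t ∈ Icc (0 : ℝ) 1, γ t ∈ U) {F f : ℂ → ℂ}
    (hF : ∀ s ∈ U, HasDerivAt F (f s) s) (hf : ContinuousOn f U) :
    contourIntegral f γ = 0 := by
  obtain ⟨hc, hi, s, hs, hd⟩ := h.regular
  unfold contourIntegral
  have hFc : ContinuousOn (fun t => F (γ t)) (Icc 0 1) := fun t ht =>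
    ((hF _ (hU t ht)).continuousAt.comp_continuousWithinAt (hc t ht))
  have hfc : ContinuousOn (fun t => f (γ t)) (uIcc 0 1) := by
    rw [uIcc_of_le zero_le_one]
    exact hf.comp hc hU
  rw [integral_eq_of_hasDerivAt_off_countable_of_le (fun t => F (γ t)) _ zero_le_one hs hFc
    (fun t ht => (hF _ (hU t (Ioo_subset_Icc_self ht.1))).comp t (hd t ht))
    (hi.continuousOn_mul hfc), h.closed, sub_self]

lemma integral_swap_of_continuousOn {δ : ℝ → ℂ} {Φ : ℝ → ℝ → ℂ} {α β : ℝ} (hαβ : α ≤ β)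
    (hΦ : ContinuousOn (Function.uncurry Φ) (Icc 0 1 ×ˢ Icc α β))
    (hδ : IntervalIntegrable δ volume 0 1) :
    ∫ t in (0 : ℝ)..1, (∫ u in α..β, Φ t u) * δ t =
      ∫ u in α..β, ∫ t in (0 : ℝ)..1, Φ t u * δ t := by
  simp only [← intervalIntegral.integral_mul_const]
  simp only [intervalIntegral.integral_of_le hαβ, intervalIntegral.integral_of_le zero_le_one]
  apply integral_integral_swap
  rw [intervalIntegrable_iff_integrableOn_Ioc_of_le zero_le_one] at hδ
  obtain ⟨C, hC⟩ := (isCompact_Icc.prod isCompact_Icc).exists_bound_of_continuousOn hΦ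
  have hδ2 : Integrable (fun p : ℝ × ℝ => δ p.1 * (1 : ℂ))
      ((volume.restrict (Ioc 0 1)).prod (volume.restrict (Ioc α β))) :=
    Integrable.mul_prod hδ (integrable_const _)
  simp only [mul_one] at hδ2
  have hsub : Ioc (0 : ℝ) 1 ×ˢ Ioc α β ⊆ Icc 0 1 ×ˢ Icc α β :=
    prod_mono Ioc_subset_Icc_self Ioc_subset_Icc_self
  refine hδ2.bdd_mul (c := C) ?_ ?_
  · rw [Measure.prod_restrict]
    exact (hΦ.mono hsub).aestronglyMeasurable (measurableSet_Ioc.prod measurableSet_Ioc)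
  · rw [Measure.prod_restrict]
    exact ae_restrict_of_forall_mem (measurableSet_Ioc.prod measurableSet_Ioc)
      fun p hp => hC p (hsub hp)

/-- Cauchy's integral formula for a contour in the slit plane. -/
lemma contourIntegral_div_sub {γ : ℝ → ℂ} (h : IsSimpleClosedContour γ)
    (hU : ∀ t ∈ Icc (0 : ℝ) 1, γ t ∈ Complex.slitPlane) {x : ℝ} (hx : 0 < x)
    (hw : EnclosesCounterclockwise γ x) {g : ℂ → ℂ}
    (hg : DifferentiableOn ℂ g Complex.slitPlane) :
    contourIntegral (fun s => g s / (s - x)) γ = 2 * Real.pi * Complex.I * g x := by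
  obtain ⟨hc, hi, -⟩ := h.regular
  have hstar : ∀ s ∈ Complex.slitPlane, ∀ τ ∈ Icc (0 : ℝ) 1,
      (x : ℂ) + τ * (s - x) ∈ Complex.slitPlane := by
    intro s hs τ hτ
    have := (Complex.starConvex_ofReal_slitPlane hx) hs (sub_nonneg.2 hτ.2) hτ.1
      (sub_add_cancel 1 τ)
    convert this using 1
    simp [Complex.real_smul]
    ring
  have hopen := Complex.isOpen_slitPlane
  have hg' : ContinuousOn (deriv g) Complex.slitPlane :=
    (hg.deriv hopen).continuousOn
  -- The slit plane is star-shaped about `x > 0`, so `g (x + τ (s - x)) / τ` is a primitive along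
  -- the contour.
  have hzero : ∀ τ ∈ Icc (0 : ℝ) 1, τ ≠ 0 →
      contourIntegral (fun s => deriv g (x + τ * (s - x))) γ = 0 := by
    intro τ hτ hτ0
    have hτ0' : (τ : ℂ) ≠ 0 := by exact_mod_cast hτ0
    refine contourIntegral_eq_zero_of_primitive h hU (F := fun s => g (x + τ * (s - x)) / τ)
      (fun s hs => ?_) (hg'.comp (by fun_prop) fun s hs => hstar s hs τ hτ)
    have h1 := (hg.differentiableAt (hopen.mem_nhds (hstar s hs τ hτ))).hasDerivAt
    have h2 : HasDerivAt (fun s : ℂ => (x : ℂ) + τ * (s - x)) (τ * 1) s :=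
      (((hasDerivAt_id s).sub_const (x : ℂ)).const_mul (τ : ℂ)).const_add (x : ℂ)
    refine ((h1.comp s h2).div_const (τ : ℂ)).congr_deriv ?_
    field_simp
  -- The difference quotient of `g` is an average of derivatives along the segment from `x`. After
  -- exchanging integrals it contributes nothing, and only the winding number term remains.
  have hslope : ∀ s ∈ Complex.slitPlane, s ≠ x →
      g s / (s - x) = g x * (1 / (s - x)) + ∫ τ in (0 : ℝ)..1, deriv g (x + τ * (s - x)) := by
    intro s hs hne
    have hne' := sub_ne_zero.2 hne
    have hd : ∀ τ ∈ uIcc (0 : ℝ) 1, HasDerivAt (fun τ : ℝ => g (x + τ * (s - x)) / (s - x))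
        (deriv g (x + τ * (s - x))) τ := by
      intro τ hτ
      rw [uIcc_of_le zero_le_one] at hτ
      have h1 := (hg.differentiableAt (hopen.mem_nhds (hstar s hs τ hτ))).hasDerivAt
      have h2 : HasDerivAt (fun τ : ℝ => (x : ℂ) + τ * (s - x)) (1 * (s - x)) τ :=
        ((Complex.ofRealCLM.hasDerivAt (x := τ)).mul_const (s - x)).const_add (x : ℂ)
      refine ((h1.comp τ h2).div_const (s - x)).congr_deriv ?_
      field_simp
    have hci : IntervalIntegrable (fun τ : ℝ => deriv g (x + τ * (s - x))) volume 0 1 := by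
      apply ContinuousOn.intervalIntegrable
      rw [uIcc_of_le zero_le_one]
      exact hg'.comp (by fun_prop) fun τ hτ => hstar s hs τ hτ
    rw [intervalIntegral.integral_eq_sub_of_hasDerivAt hd hci]
    simp
    field_simp
    ring
  have hnex : ∀ t ∈ Icc (0 : ℝ) 1, γ t ≠ x := fun t ht he => hw.1 ⟨t, ht, he⟩
  have hswap := integral_swap_of_continuousOn (δ := deriv γ)
    (Φ := fun t τ => deriv g (x + τ * (γ t - x))) (zero_le_one (α := ℝ)) (by
      refine hg'.comp ?_ fun p hp => hstar _ (hU _ hp.1) _ hp.2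
      have : ContinuousOn (fun p : ℝ × ℝ => γ p.1) (Icc 0 1 ×ˢ Icc 0 1) :=
        hc.comp continuousOn_fst fun p hp => hp.1
      exact continuousOn_const.add ((Complex.continuous_ofReal.comp continuous_snd).continuousOn.mul
        (this.sub continuousOn_const))) hi
  have hRHS : ∫ τ in (0 : ℝ)..1, ∫ t in (0 : ℝ)..1, deriv g (x + τ * (γ t - x)) * deriv γ t = 0 := by
    rw [intervalIntegral.integral_of_le zero_le_one]
    exact setIntegral_eq_zero_of_forall_eq_zero
      (fun τ hτ => hzero τ ⟨hτ.1.le, hτ.2⟩ hτ.1.ne')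
  rw [hRHS] at hswap
  have hc1 : ContinuousOn (fun t => 1 / (γ t - x)) (uIcc 0 1) := by
    rw [uIcc_of_le zero_le_one]
    exact ContinuousOn.div continuousOn_const (by fun_prop) fun t ht => sub_ne_zero.2 (hnex t ht)
  have hi1 : IntervalIntegrable (fun t => g x * (1 / (γ t - x) * deriv γ t)) volume 0 1 :=
    (hi.continuousOn_mul hc1).const_mul _
  have hcg : ContinuousOn (fun t => g (γ t) / (γ t - x)) (uIcc 0 1) := by
    rw [uIcc_of_le zero_le_one]
    exact ContinuousOn.div (hg.continuousOn.comp hc hU) (by fun_prop)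
      fun t ht => sub_ne_zero.2 (hnex t ht)
  have hi2 : IntervalIntegrable (fun t => g (γ t) / (γ t - x) * deriv γ t) volume 0 1 :=
    hi.continuousOn_mul hcg
  have heq : ∫ t in (0 : ℝ)..1, (g (γ t) / (γ t - x) * deriv γ t -
      g x * (1 / (γ t - x) * deriv γ t)) = 0 := by
    rw [← hswap]
    refine intervalIntegral.integral_congr fun t ht => ?_
    rw [uIcc_of_le zero_le_one] at ht
    rw [hslope _ (hU t ht) (hnex t ht)]
    ring
  rw [intervalIntegral.integral_sub hi2 hi1, intervalIntegral.integral_const_mul] at heq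
  have hwind := hw.2
  unfold contourIntegral at hwind ⊢
  have hpi : (2 * Real.pi * Complex.I : ℂ) ≠ 0 := Complex.two_pi_I_ne_zero
  have hw' : ∫ t in (0 : ℝ)..1, 1 / (γ t - x) * deriv γ t = 2 * Real.pi * Complex.I := by
    rwa [one_div, inv_mul_eq_iff_eq_mul₀ hpi, mul_one] at hwind
  rw [hw'] at heq
  linear_combination heq

/-- The contour integral of `g / ((s - x) R)` as a mean over the arcsine law of `[a, b]`. -/
lemma contourIntegral_div_sub_mul_sqrtR {γ : ℝ → ℂ} (h : IsSimpleClosedContour γ)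
    (hU : ∀ t ∈ Icc (0 : ℝ) 1, γ t ∈ Complex.slitPlane) {a b x : ℝ} (ha : 0 < a) (hab : a < b)
    (hx : x ∈ Icc a b) (hw : ∀ p ∈ Icc a b, EnclosesCounterclockwise γ (p : ℂ)) {g : ℂ → ℂ}
    (hg : DifferentiableOn ℂ g Complex.slitPlane) :
    contourIntegral (fun s => g s / ((s - x) * sqrtR a b s)) γ =
      2 * Complex.I * ∫ θ in (0 : ℝ)..Real.pi,
        (g x - g ((a + b) / 2 + (b - a) / 2 * Real.cos θ : ℝ)) /
          (x - ((a + b) / 2 + (b - a) / 2 * Real.cos θ : ℝ)) := by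
  obtain ⟨hc, hi, -⟩ := h.regular
  have hpi := Real.pi_pos
  have hpi' : (Real.pi : ℂ) ≠ 0 := by exact_mod_cast hpi.ne'
  have hy : ∀ θ : ℝ, (a + b) / 2 + (b - a) / 2 * Real.cos θ ∈ Icc a b := by
    intro θ
    have h1 := Real.neg_one_le_cos θ
    have h2 := Real.cos_le_one θ
    constructor <;> nlinarith
  have hne : ∀ t ∈ Icc (0 : ℝ) 1, ∀ p ∈ Icc a b, γ t - (p : ℂ) ≠ 0 := fun t ht p hp he =>
    (hw p hp).1 ⟨t, ht, sub_eq_zero.1 he⟩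
  have hnot : ∀ t ∈ Icc (0 : ℝ) 1, γ t ∉ ((↑) : ℝ → ℂ) '' Icc a b := by
    rintro t ht ⟨p, hp, hp'⟩
    exact hne t ht p hp (by rw [hp', sub_self])
  have hγ : ContinuousOn (fun p : ℝ × ℝ => γ p.1) (Icc 0 1 ×ˢ Icc 0 Real.pi) :=
    hc.comp continuousOn_fst fun p hp => hp.1
  have hswap := integral_swap_of_continuousOn (δ := deriv γ)
    (Φ := fun t θ => g (γ t) / (γ t - x) *
      (γ t - ((a + b) / 2 + (b - a) / 2 * Real.cos θ : ℝ))⁻¹) hpi.le (by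
      refine ContinuousOn.mul (ContinuousOn.div ?_ (hγ.sub continuousOn_const)
        fun p hp => hne _ hp.1 _ hx) (ContinuousOn.inv₀ (hγ.sub ?_) fun p hp => hne _ hp.1 _ (hy _))
      · exact hg.continuousOn.comp hγ fun p hp => hU _ hp.1
      · exact (Complex.continuous_ofReal.comp (by fun_prop)).continuousOn) hi
  have hLHS : contourIntegral (fun s => g s / ((s - x) * sqrtR a b s)) γ =
      (1 / Real.pi) * ∫ t in (0 : ℝ)..1, (∫ θ in (0 : ℝ)..Real.pi, g (γ t) / (γ t - x) *
      (γ t - ((a + b) / 2 + (b - a) / 2 * Real.cos θ : ℝ))⁻¹) * deriv γ t := by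
    rw [contourIntegral, ← intervalIntegral.integral_const_mul]
    refine intervalIntegral.integral_congr fun t ht => ?_
    rw [uIcc_of_le zero_le_one] at ht
    obtain ⟨h0, hI⟩ := integral_inv_sub_arcsine hab (hnot t ht)
    have h1 := hne t ht x hx
    rw [intervalIntegral.integral_const_mul, hI]
    field_simp
  -- Partial fractions in `(s - x)⁻¹ (s - y)⁻¹` and Cauchy's formula at both points. The one angle
  -- at which `y = x` is a null set.
  have hinner : ∀ᵐ θ : ℝ, θ ∈ uIoc 0 Real.pi →
      ∫ t in (0 : ℝ)..1, g (γ t) / (γ t - x) *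
        (γ t - ((a + b) / 2 + (b - a) / 2 * Real.cos θ : ℝ))⁻¹ * deriv γ t =
      (2 * Real.pi * Complex.I) *
        ((g x - g ((a + b) / 2 + (b - a) / 2 * Real.cos θ : ℝ)) /
          (x - ((a + b) / 2 + (b - a) / 2 * Real.cos θ : ℝ))) := by
    have hae : ∀ᵐ θ : ℝ, θ ≠ Real.arccos ((x - (a + b) / 2) / ((b - a) / 2)) := by
      rw [ae_iff]; simp
    filter_upwards [hae] with θ hθ hθm
    rw [uIoc_of_le hpi.le] at hθm
    set y := (a + b) / 2 + (b - a) / 2 * Real.cos θ with hydef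
    have hyI : y ∈ Icc a b := hy θ
    have hxy : x ≠ y := by
      intro he
      apply hθ
      have hba : (b - a) / 2 ≠ 0 := by
        have : 0 < (b - a) / 2 := by linarith
        exact this.ne'
      have : (x - (a + b) / 2) / ((b - a) / 2) = Real.cos θ := by
        rw [he, hydef, add_sub_cancel_left, mul_div_cancel_left₀ _ hba]
      rw [this, Real.arccos_cos hθm.1.le hθm.2]
    have hxy' : (x : ℂ) - y ≠ 0 := by
      rw [← Complex.ofReal_sub]; exact_mod_cast sub_ne_zero.2 hxy
    have c1 := contourIntegral_div_sub h hU (ha.trans_le hx.1) (hw x hx) hg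
    have c2 := contourIntegral_div_sub h hU (ha.trans_le hyI.1) (hw y hyI) hg
    have hint : ∀ p ∈ Icc a b, IntervalIntegrable
        (fun t => g (γ t) / (γ t - (p : ℂ)) * deriv γ t) volume 0 1 := by
      intro p hp
      apply hi.continuousOn_mul
      rw [uIcc_of_le zero_le_one]
      exact ContinuousOn.div (hg.continuousOn.comp hc hU) (by fun_prop)
        fun t ht => hne t ht p hp
    unfold contourIntegral at c1 c2
    have e : ∫ t in (0 : ℝ)..1, g (γ t) / (γ t - x) * (γ t - y)⁻¹ * deriv γ t =
        ∫ t in (0 : ℝ)..1, (1 / ((x : ℂ) - y)) *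
          (g (γ t) / (γ t - x) * deriv γ t - g (γ t) / (γ t - y) * deriv γ t) := by
      refine intervalIntegral.integral_congr fun t ht => ?_
      rw [uIcc_of_le zero_le_one] at ht
      have h1 := hne t ht x hx
      have h2 := hne t ht y hyI
      field_simp
      ring
    rw [e, intervalIntegral.integral_const_mul,
      intervalIntegral.integral_sub (hint x hx) (hint y hyI), c1, c2]
    field_simp
  rw [hLHS, hswap, intervalIntegral.integral_congr_ae hinner, intervalIntegral.integral_const_mul]
  field_simp

end StieltjesWigert

namespace StieltjesWigert

/-! ### Evaluation of `h` -/

lemma cpow_half_neg {a : ℝ} (ha : 0 < a) : (-(a : ℂ)) ^ (1 / 2 : ℂ) = √a * Complex.I := by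
  have hne : (-(a : ℂ)) ≠ 0 := neg_ne_zero.2 (by exact_mod_cast ha.ne')
  obtain ⟨h1, h2⟩ := cpow_half_re_im hne
  have harg : (-(a : ℂ)).arg = Real.pi := by
    rw [← Complex.ofReal_neg]; exact Complex.arg_ofReal_of_neg (by linarith)
  rw [harg] at h1 h2
  have hn : Real.exp (Real.log ‖-(a : ℂ)‖ / 2) = √a := by
    rw [norm_neg, Complex.norm_real, Real.norm_eq_abs, abs_of_pos ha, Real.exp_half,
      Real.exp_log ha]
  rw [hn, Real.cos_pi_div_two] at h1
  rw [hn, Real.sin_pi_div_two] at h2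
  apply Complex.ext
  · rw [h1]; simp
  · rw [h2]; simp

/-- The Cauchy transform at `s = 0`, where both factors of `R` are `i` times a positive root, so
that `R(0) = -√(a b)`. -/
lemma integral_inv_arcsine {a b : ℝ} (ha : 0 < a) (hab : a < b) :
    ∫ θ in (0 : ℝ)..Real.pi, ((a + b) / 2 + (b - a) / 2 * Real.cos θ)⁻¹ =
      Real.pi * (√(a * b))⁻¹ := by
  have hb : 0 < b := ha.trans hab
  have h0 : (0 : ℂ) ∉ ((↑) : ℝ → ℂ) '' Icc a b := by
    rintro ⟨y, hy, hy0⟩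
    have : y = 0 := by exact_mod_cast hy0
    linarith [hy.1]
  have h := (integral_inv_sub_arcsine hab h0).2
  have hR : sqrtR a b 0 = -((√(a * b) : ℝ) : ℂ) := by
    rw [sqrtR, zero_sub, zero_sub, cpow_half_neg ha, cpow_half_neg hb, Real.sqrt_mul ha.le]
    push_cast
    linear_combination ((√a : ℝ) : ℂ) * ((√b : ℝ) : ℂ) * Complex.I_mul_I
  rw [hR] at h
  have e : ∀ θ : ℝ, ((0 : ℂ) - ((a + b) / 2 + (b - a) / 2 * Real.cos θ : ℝ))⁻¹ =
      ((-((a + b) / 2 + (b - a) / 2 * Real.cos θ)⁻¹ : ℝ) : ℂ) := by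
    intro θ
    rw [zero_sub, inv_neg]
    push_cast
    ring
  simp only [e] at h
  rw [intervalIntegral.integral_ofReal, intervalIntegral.integral_neg, div_neg, Complex.ofReal_neg,
    neg_inj] at h
  rw [← div_eq_mul_inv]
  exact_mod_cast h

/-- The radicand is a quadratic in `τ` with leading coefficient `-g²` and constant term `p²`, so
Euler's substitution `g τ / (p + √·)` gives the antiderivative. At `τ = 1` the radicand is `x²`. -/
lemma integral_inv_sqrt_segment {a b x : ℝ} (ha : 0 < a) (hx : x ∈ Ioo a b) :
    ∫ τ in (0 : ℝ)..1, (√((a + τ * (x - a)) * (b + τ * (x - b))))⁻¹ =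
      2 / √((b - x) * (x - a)) * Real.arctan (√((b - x) * (x - a)) / (√(a * b) + x)) := by
  have hx0 : 0 < x := ha.trans hx.1
  have hb : 0 < b := hx0.trans hx.2
  have hg2 : 0 < (b - x) * (x - a) := mul_pos (sub_pos.2 hx.2) (sub_pos.2 hx.1)
  set g := √((b - x) * (x - a)) with hg
  have hg0 : 0 < g := Real.sqrt_pos.2 hg2
  have hgsq : g ^ 2 = (b - x) * (x - a) := Real.sq_sqrt hg2.le
  set p := √(a * b) with hp
  have hp0 : 0 < p := Real.sqrt_pos.2 (mul_pos ha hb)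
  have hpsq : p ^ 2 = a * b := Real.sq_sqrt (mul_pos ha hb).le
  have hQ : ∀ τ ∈ Icc (0 : ℝ) 1, 0 < (a + τ * (x - a)) * (b + τ * (x - b)) := by
    intro τ hτ
    have h1 : 0 < a + τ * (x - a) := by nlinarith [mul_nonneg hτ.1 (sub_nonneg.2 hx.1.le)]
    have h2 : 0 < b + τ * (x - b) := by
      nlinarith [mul_nonneg (sub_nonneg.2 hτ.2) (sub_nonneg.2 hx.2.le)]
    positivity
  have hd : ∀ τ ∈ uIcc (0 : ℝ) 1, HasDerivAt (fun τ => 2 / g * Real.arctan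
      (g * τ / (p + √((a + τ * (x - a)) * (b + τ * (x - b))))))
      (√((a + τ * (x - a)) * (b + τ * (x - b))))⁻¹ τ := by
    intro τ hτ
    rw [uIcc_of_le zero_le_one] at hτ
    have hq := hQ τ hτ
    have hQd : HasDerivAt (fun τ => (a + τ * (x - a)) * (b + τ * (x - b)))
        ((x - a) * (b + τ * (x - b)) + (a + τ * (x - a)) * (x - b)) τ := by
      have h1 : HasDerivAt (fun τ => a + τ * (x - a)) (x - a) τ := by
        simpa using ((hasDerivAt_id τ).mul_const (x - a)).const_add a
      have h2 : HasDerivAt (fun τ => b + τ * (x - b)) (x - b) τ := by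
        simpa using ((hasDerivAt_id τ).mul_const (x - b)).const_add b
      exact h1.mul h2
    have hSd := (hQd.sqrt hq.ne').const_add p
    have hS0 : 0 < √((a + τ * (x - a)) * (b + τ * (x - b))) := Real.sqrt_pos.2 hq
    have hSsq := Real.sq_sqrt hq.le
    have hnum : HasDerivAt (fun τ => g * τ) g τ := by
      simpa using (hasDerivAt_id τ).const_mul g
    have hF := ((hnum.div hSd (by positivity)).arctan).const_mul (2 / g)
    refine hF.congr_deriv ?_
    simp only [Pi.div_apply]
    set S := √((a + τ * (x - a)) * (b + τ * (x - b))) with hS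
    have hden : 0 < (p + S) ^ 2 + g ^ 2 * τ ^ 2 := by positivity
    have e1 : 1 + (g * τ / (p + S)) ^ 2 = ((p + S) ^ 2 + g ^ 2 * τ ^ 2) / (p + S) ^ 2 := by
      field_simp
    have hexp : S ^ 2 = p ^ 2 + τ * ((x - a) * b + (x - b) * a) - g ^ 2 * τ ^ 2 := by
      rw [hSsq, hpsq, hgsq]; ring
    have hkey : 2 * S * (p + S) -
        τ * ((x - a) * (b + τ * (x - b)) + (a + τ * (x - a)) * (x - b)) =
        (p + S) ^ 2 + g ^ 2 * τ ^ 2 := by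
      linear_combination hexp - 2 * τ ^ 2 * hgsq
    rw [e1]
    generalize (x - a) * (b + τ * (x - b)) + (a + τ * (x - a)) * (x - b) = D at hkey ⊢
    have e2 : g * (p + S) - g * τ * (D / (2 * S)) =
        g * ((p + S) ^ 2 + g ^ 2 * τ ^ 2) / (2 * S) := by
      rw [← hkey]; field_simp
    rw [e2]
    field_simp
  have hci : IntervalIntegrable (fun τ => (√((a + τ * (x - a)) * (b + τ * (x - b))))⁻¹)
      volume 0 1 := by
    apply ContinuousOn.intervalIntegrable
    rw [uIcc_of_le zero_le_one]
    exact ContinuousOn.inv₀ (by fun_prop) fun τ hτ => (Real.sqrt_pos.2 (hQ τ hτ)).ne'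
  rw [intervalIntegral.integral_eq_sub_of_hasDerivAt hd hci]
  have e1 : (a + 1 * (x - a)) * (b + 1 * (x - b)) = x ^ 2 := by ring
  simp only [e1, Real.sqrt_sq hx0.le, mul_zero, zero_div, Real.arctan_zero, sub_zero, mul_one]

lemma integrable_prod_of_continuousOn {Φ : ℝ → ℝ → ℝ} {α β α' β' : ℝ}
    (hΦ : ContinuousOn (Function.uncurry Φ) (Icc α β ×ˢ Icc α' β')) :
    Integrable (Function.uncurry Φ)
      ((volume.restrict (Ioc α β)).prod (volume.restrict (Ioc α' β'))) := by
  rw [Measure.prod_restrict]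
  exact (hΦ.integrableOn_compact (isCompact_Icc.prod isCompact_Icc)).mono_set
    (prod_mono Ioc_subset_Icc_self Ioc_subset_Icc_self)

/-- The mean of the difference quotient of `log` under an arcsine law. -/
lemma integral_log_slope_arcsine {a b x : ℝ} (ha : 0 < a) (hx : x ∈ Ioo a b) :
    IntervalIntegrable (fun θ => ∫ τ in (0 : ℝ)..1, ((a + b) / 2 + (b - a) / 2 * Real.cos θ +
      τ * (x - ((a + b) / 2 + (b - a) / 2 * Real.cos θ)))⁻¹) volume 0 Real.pi ∧
    ∫ θ in (0 : ℝ)..Real.pi, ∫ τ in (0 : ℝ)..1, ((a + b) / 2 + (b - a) / 2 * Real.cos θ +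
      τ * (x - ((a + b) / 2 + (b - a) / 2 * Real.cos θ)))⁻¹ =
      Real.pi * (2 / √((b - x) * (x - a)) *
        Real.arctan (√((b - x) * (x - a)) / (√(a * b) + x))) := by
  have hpi := Real.pi_pos
  have hx0 : 0 < x := ha.trans hx.1
  have hab : a < b := hx.1.trans hx.2
  have hpos : ∀ θ : ℝ, ∀ τ ∈ Icc (0 : ℝ) 1, 0 < (a + b) / 2 + (b - a) / 2 * Real.cos θ +
      τ * (x - ((a + b) / 2 + (b - a) / 2 * Real.cos θ)) := by
    intro θ τ hτ
    have h1 : a ≤ (a + b) / 2 + (b - a) / 2 * Real.cos θ := by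
      nlinarith [Real.neg_one_le_cos θ]
    nlinarith [mul_le_mul_of_nonneg_left h1 (sub_nonneg.2 hτ.2),
      mul_le_mul_of_nonneg_left hx.1.le hτ.1]
  have hI := integrable_prod_of_continuousOn (α := 0) (β := Real.pi) (α' := 0) (β' := 1)
    (Φ := fun θ τ => ((a + b) / 2 + (b - a) / 2 * Real.cos θ +
      τ * (x - ((a + b) / 2 + (b - a) / 2 * Real.cos θ)))⁻¹)
    (ContinuousOn.inv₀ (by fun_prop) fun p hp => (hpos p.1 p.2 hp.2).ne')
  simp only [intervalIntegral.integral_of_le (zero_le_one (α := ℝ))]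
  constructor
  · rw [intervalIntegrable_iff_integrableOn_Ioc_of_le hpi.le]
    exact hI.integral_prod_left
  -- For fixed `τ` the affine map carries the arcsine law of `[a, b]` to that of `[a + τ (x - a), b
  -- + τ (x - b)]`. The value `τ = 1`, where this interval collapses, is discarded.
  · rw [intervalIntegral.integral_of_le hpi.le, integral_integral_swap hI,
      ← integral_inv_sqrt_segment ha hx, intervalIntegral.integral_of_le zero_le_one,
      ← integral_const_mul, ← integral_Ioc_eq_integral_Ioo.symm, integral_Ioc_eq_integral_Ioo]
    refine setIntegral_congr_fun measurableSet_Ioo fun τ hτ => ?_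
    have h1 : 0 < a + τ * (x - a) := by nlinarith [mul_pos hτ.1 (sub_pos.2 hx.1)]
    have h2 : a + τ * (x - a) < b + τ * (x - b) := by
      nlinarith [mul_pos (sub_pos.2 hτ.2) (sub_pos.2 hab)]
    have := integral_inv_arcsine h1 h2
    rw [← this, intervalIntegral.integral_of_le hpi.le]
    congr 1
    ext θ
    congr 1
    ring

/-- The first endpoint condition: the field has mean zero under the arcsine law. -/
lemma integral_log_div_arcsine_eq_zero {a b c : ℝ} (ha : 0 < a) (hab : a < b) (hc : 0 < c)
    (h : √a + √b = 2 * (√c * (√a * √b))) :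
    ∫ θ in (0 : ℝ)..Real.pi, Real.log (c * ((a + b) / 2 + (b - a) / 2 * Real.cos θ)) /
      ((a + b) / 2 + (b - a) / 2 * Real.cos θ) = 0 := by
  have hb : 0 < b := ha.trans hab
  have sa := Real.sq_sqrt ha.le
  have sb := Real.sq_sqrt hb.le
  have sc := Real.sq_sqrt hc.le
  have ra : 0 < √a := Real.sqrt_pos.2 ha
  have rb : 0 < √b := Real.sqrt_pos.2 hb
  have rc : 0 < √c := Real.sqrt_pos.2 hc
  have rab : √a < √b := Real.sqrt_lt_sqrt ha.le hab
  have hβ : 0 ≤ √c * ((√b - √a) / 2) := by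
    have : 0 ≤ (√b - √a) / 2 := by linarith
    positivity
  have hαβ : √c * ((√b - √a) / 2) < √c * ((√b + √a) / 2) := by
    apply mul_lt_mul_of_pos_left _ rc; linarith
  -- With `α, β = √c (√b ± √a) / 2`, the quantity `c y` has the form required. The balance condition
  -- says exactly that `α² - β² = α`, so the logarithm is `log 1`.
  have hmain := integral_log_div_arcsine hβ hαβ
  have hd : (√c * ((√b + √a) / 2)) ^ 2 - (√c * ((√b - √a) / 2)) ^ 2 =
      √c * ((√b + √a) / 2) := by
    have : (√c * ((√b + √a) / 2)) ^ 2 - (√c * ((√b - √a) / 2)) ^ 2 =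
        √c * (√c * (√a * √b)) := by ring
    rw [this]
    congr 1
    linarith
  rw [hd, div_self (by positivity), Real.log_one, mul_zero] at hmain
  have e : ∀ θ : ℝ, Real.log (c * ((a + b) / 2 + (b - a) / 2 * Real.cos θ)) /
      ((a + b) / 2 + (b - a) / 2 * Real.cos θ) = c * (Real.log ((√c * ((√b + √a) / 2)) ^ 2 +
        (√c * ((√b - √a) / 2)) ^ 2 + 2 * (√c * ((√b + √a) / 2)) * (√c * ((√b - √a) / 2)) *
          Real.cos θ) / ((√c * ((√b + √a) / 2)) ^ 2 +
        (√c * ((√b - √a) / 2)) ^ 2 + 2 * (√c * ((√b + √a) / 2)) * (√c * ((√b - √a) / 2)) *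
          Real.cos θ)) := by
    intro θ
    have e1 : (√c * ((√b + √a) / 2)) ^ 2 + (√c * ((√b - √a) / 2)) ^ 2 +
        2 * (√c * ((√b + √a) / 2)) * (√c * ((√b - √a) / 2)) * Real.cos θ =
        c * ((a + b) / 2 + (b - a) / 2 * Real.cos θ) := by
      have : (√c * ((√b + √a) / 2)) ^ 2 + (√c * ((√b - √a) / 2)) ^ 2 +
        2 * (√c * ((√b + √a) / 2)) * (√c * ((√b - √a) / 2)) * Real.cos θ =
        √c ^ 2 * ((√a ^ 2 + √b ^ 2) / 2 + (√b ^ 2 - √a ^ 2) / 2 * Real.cos θ) := by ring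
      rw [this, sa, sb, sc]
    rw [e1, mul_div_assoc', mul_div_mul_left _ _ hc.ne']
  simp only [e]
  rw [intervalIntegral.integral_const_mul, hmain, mul_zero]

/-- The mean of the difference quotient of the field `V'(y) = (K log y + 1) / y`. -/
lemma integral_field_slope_arcsine {a b c K x : ℝ} (ha : 0 < a) (hx : x ∈ Ioo a b) (hc : 0 < c)
    (hK : 0 < K) (hcK : Real.log c = 1 / K) (h : √a + √b = 2 * (√c * (√a * √b))) :
    ∫ θ in (0 : ℝ)..Real.pi, ((K * Real.log x + 1) / x -
        (K * Real.log ((a + b) / 2 + (b - a) / 2 * Real.cos θ) + 1) /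
          ((a + b) / 2 + (b - a) / 2 * Real.cos θ)) /
        (x - ((a + b) / 2 + (b - a) / 2 * Real.cos θ)) =
      K / x * (Real.pi * (2 / √((b - x) * (x - a)) *
        Real.arctan (√((b - x) * (x - a)) / (√(a * b) + x)))) := by
  have hpi := Real.pi_pos
  have hx0 : 0 < x := ha.trans hx.1
  have hab : a < b := hx.1.trans hx.2
  obtain ⟨hi, hI⟩ := integral_log_slope_arcsine ha hx
  have hZ := integral_log_div_arcsine_eq_zero ha hab hc h
  have hy : ∀ θ : ℝ, 0 < (a + b) / 2 + (b - a) / 2 * Real.cos θ := by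
    intro θ
    nlinarith [Real.neg_one_le_cos θ]
  have hcont : Continuous fun θ : ℝ => Real.log (c * ((a + b) / 2 + (b - a) / 2 * Real.cos θ)) /
      ((a + b) / 2 + (b - a) / 2 * Real.cos θ) :=
    Continuous.div (Continuous.log (by fun_prop) fun θ => (mul_pos hc (hy θ)).ne') (by fun_prop)
      fun θ => (hy θ).ne'
  -- Since `K log c = 1`, the field is `K log (c y) / y`. Its difference quotient is `K / x` times
  -- the difference quotient of `log` minus `log (c y) / y`, and the last term has mean zero.
  have hsub := intervalIntegral.integral_sub hi (hcont.intervalIntegrable 0 Real.pi)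
  rw [hI, hZ, sub_zero] at hsub
  rw [← hsub, ← intervalIntegral.integral_const_mul]
  apply intervalIntegral.integral_congr_ae
  have hae : ∀ᵐ θ : ℝ, θ ≠ Real.arccos ((x - (a + b) / 2) / ((b - a) / 2)) := by
    rw [ae_iff]; simp
  filter_upwards [hae] with θ hθ hθm
  rw [uIoc_of_le hpi.le] at hθm
  have hy0 := hy θ
  set y := (a + b) / 2 + (b - a) / 2 * Real.cos θ with hydef
  have hxy : x - y ≠ 0 := by
    intro he
    apply hθ
    have hba : (b - a) / 2 ≠ 0 := by
      have : 0 < (b - a) / 2 := by linarith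
      exact this.ne'
    have : (x - (a + b) / 2) / ((b - a) / 2) = Real.cos θ := by
      rw [sub_eq_zero.1 he, hydef, add_sub_cancel_left, mul_div_cancel_left₀ _ hba]
    rw [this, Real.arccos_cos hθm.1.le hθm.2]
  have hslope : ∫ τ in (0 : ℝ)..1, (y + τ * (x - y))⁻¹ = (Real.log x - Real.log y) / (x - y) := by
    have hpos : ∀ τ ∈ uIcc (0 : ℝ) 1, 0 < y + τ * (x - y) := by
      intro τ hτ
      rw [uIcc_of_le zero_le_one] at hτ
      rcases le_total x y with hle | hle
      · nlinarith [mul_nonneg (sub_nonneg.2 hτ.2) (sub_nonneg.2 hle)]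
      · nlinarith [mul_nonneg hτ.1 (sub_nonneg.2 hle)]
    have hd : ∀ τ ∈ uIcc (0 : ℝ) 1, HasDerivAt (fun τ => Real.log (y + τ * (x - y)) / (x - y))
        ((y + τ * (x - y))⁻¹) τ := by
      intro τ hτ
      have h1 : HasDerivAt (fun τ => y + τ * (x - y)) (x - y) τ := by
        simpa using ((hasDerivAt_id τ).mul_const (x - y)).const_add y
      refine ((h1.log (hpos τ hτ).ne').div_const (x - y)).congr_deriv ?_
      field_simp
    rw [intervalIntegral.integral_eq_sub_of_hasDerivAt hd]
    · simp [sub_div]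
    · exact ContinuousOn.intervalIntegrable
        (ContinuousOn.inv₀ (by fun_prop) fun τ hτ => (hpos τ hτ).ne')
  rw [hslope, Real.log_mul hc.ne' hy0.ne', hcK]
  field_simp
  ring

end StieltjesWigert

namespace StieltjesWigert

/-! ### The endpoints and the density -/

section

variable {k : ℕ}

/-- The explicit form of the square roots of the endpoints. -/
lemma exists_sqrt_endpoints (hk : 0 < k) : ∃ T : ℝ, 0 < T ∧
    T ^ 2 = Real.exp (1 / (k : ℝ) ^ 2) ^ 2 * Real.exp (2 / (k : ℝ)) ^ 2 - Real.exp (2 / (k : ℝ)) ∧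
    sqrtA k = Real.exp (1 / (k : ℝ) ^ 2) * Real.exp (2 / (k : ℝ)) - T ∧
    sqrtB k = Real.exp (1 / (k : ℝ) ^ 2) * Real.exp (2 / (k : ℝ)) + T ∧
    leftEnd k = sqrtA k ^ 2 ∧ rightEnd k = sqrtB k ^ 2 := by
  have hk0 : (0 : ℝ) < k := by exact_mod_cast hk
  have e1 : Real.exp ((2 * k + 1) / (k : ℝ) ^ 2) =
      Real.exp (1 / (k : ℝ) ^ 2) * Real.exp (2 / (k : ℝ)) := by
    rw [← Real.exp_add]; congr 1; field_simp; ring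
  have e2 : Real.exp ((4 * k + 2) / (k : ℝ) ^ 2) =
      Real.exp (1 / (k : ℝ) ^ 2) ^ 2 * Real.exp (2 / (k : ℝ)) ^ 2 := by
    rw [← Real.exp_nat_mul, ← Real.exp_nat_mul, ← Real.exp_add]
    congr 1; field_simp; push_cast; ring
  have e3 : Real.exp (2 / (k : ℝ) ^ 2) = Real.exp (1 / (k : ℝ) ^ 2) ^ 2 := by
    rw [← Real.exp_nat_mul]; congr 1; push_cast; ring
  have e4 : Real.exp (-(2 / (k : ℝ))) = (Real.exp (2 / (k : ℝ)))⁻¹ := Real.exp_neg _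
  unfold leftEnd rightEnd sqrtA sqrtB midpt halfw
  rw [e1, e2, e3, e4]
  have hq : 1 < Real.exp (1 / (k : ℝ) ^ 2) := Real.one_lt_exp_iff.2 (by positivity)
  have hp : 1 < Real.exp (2 / (k : ℝ)) := Real.one_lt_exp_iff.2 (by positivity)
  generalize Real.exp (1 / (k : ℝ) ^ 2) = q at hq ⊢
  generalize Real.exp (2 / (k : ℝ)) = p at hp ⊢
  have hT : 0 < q ^ 2 * p ^ 2 - p := by
    have : 1 < q ^ 2 := by nlinarith
    nlinarith
  have hTsq := Real.sq_sqrt hT.le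
  have hT0 := Real.sqrt_pos.2 hT
  generalize √(q ^ 2 * p ^ 2 - p) = T at hTsq hT0 ⊢
  have hp0 : 0 < p := by linarith
  have hq0 : 0 < q := by linarith
  -- Here `c = q²` and `v₀ = p⁻¹`, so midpoint plus or minus half-width becomes the square `(q p ±
  -- T)²`.
  have hr : √(q ^ 2 * (q ^ 2 - p⁻¹)) = q * T / p := by
    rw [Real.sqrt_eq_iff_mul_self_eq_of_pos (by positivity)]
    field_simp
    linear_combination hTsq
  refine ⟨T, hT0, hTsq, rfl, rfl, ?_, ?_⟩
  · rw [hr]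
    field_simp
    linear_combination -hTsq
  · rw [hr]
    field_simp
    linear_combination -hTsq

lemma sqrtA_pos (hk : 0 < k) : 0 < sqrtA k := by
  obtain ⟨T, hT, hTsq, hA, -⟩ := exists_sqrt_endpoints hk
  rw [hA, sub_pos]
  apply lt_of_pow_lt_pow_left₀ 2 (by positivity)
  rw [hTsq, mul_pow]
  linarith [Real.exp_pos (2 / (k : ℝ))]

lemma sqrt_leftEnd (hk : 0 < k) : √(leftEnd k) = sqrtA k := by
  obtain ⟨T, hT, hTsq, hA, hB, h1, h2⟩ := exists_sqrt_endpoints hk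
  rw [h1, Real.sqrt_sq (sqrtA_pos hk).le]

lemma sqrt_rightEnd (hk : 0 < k) : √(rightEnd k) = sqrtB k := by
  obtain ⟨T, hT, hTsq, hA, hB, h1, h2⟩ := exists_sqrt_endpoints hk
  rw [h2, Real.sqrt_sq]
  rw [hB]
  positivity

lemma sqrt_leftEnd_mul_sqrt_rightEnd (hk : 0 < k) :
    √(leftEnd k) * √(rightEnd k) = Real.exp (2 / (k : ℝ)) := by
  obtain ⟨T, hT, hTsq, hA, hB, -⟩ := exists_sqrt_endpoints hk
  rw [sqrt_leftEnd hk, sqrt_rightEnd hk, hA, hB]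
  linear_combination -hTsq

lemma sqrt_leftEnd_mul_rightEnd (hk : 0 < k) :
    √(leftEnd k * rightEnd k) = Real.exp (2 / (k : ℝ)) := by
  rw [Real.sqrt_mul (leftEnd_pos hk).le, sqrt_leftEnd_mul_sqrt_rightEnd hk]

/-- The balance condition satisfied by the endpoints. -/
lemma sqrt_leftEnd_add_sqrt_rightEnd (hk : 0 < k) :
    √(leftEnd k) + √(rightEnd k) =
      2 * (√(Real.exp (2 / (k : ℝ) ^ 2)) * (√(leftEnd k) * √(rightEnd k))) := by
  obtain ⟨T, hT, hTsq, hA, hB, -⟩ := exists_sqrt_endpoints hk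
  have e : √(Real.exp (2 / (k : ℝ) ^ 2)) = Real.exp (1 / (k : ℝ) ^ 2) := by
    rw [← Real.exp_half]; congr 1; ring
  rw [sqrt_leftEnd_mul_sqrt_rightEnd hk, sqrt_leftEnd hk, sqrt_rightEnd hk, hA, hB, e]
  ring

/-- This is `arccos z = arctan (√(1 - z²) / z)` for `z > 0`, together with `√(a b) = 1/v₀`. -/
lemma density_eq_arccosDensity (hk : 0 < k) {x : ℝ} (hx : x ∈ Icc (leftEnd k) (rightEnd k)) :
    density k (leftEnd k) (rightEnd k) x = arccosDensity ((k : ℝ) ^ 2 / 2)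
      (Real.exp (2 / (k : ℝ) ^ 2)) (Real.exp (-(2 / (k : ℝ)))) x := by
  have hx0 : 0 < x := (leftEnd_pos hk).trans_le hx.1
  have hc := Real.exp_pos (2 / (k : ℝ) ^ 2)
  have hv := Real.exp_pos (-(2 / (k : ℝ)))
  have hp := sqrt_leftEnd_mul_rightEnd hk
  have hvp : Real.exp (2 / (k : ℝ)) = (Real.exp (-(2 / (k : ℝ))))⁻¹ := by
    rw [Real.exp_neg, inv_inv]
  have hQ : (rightEnd k - x) * (x - leftEnd k) =
      (4 * Real.exp (2 / (k : ℝ) ^ 2) * x - (Real.exp (-(2 / (k : ℝ))) * x + 1) ^ 2) /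
        Real.exp (-(2 / (k : ℝ))) ^ 2 := by
    rw [← halfw_sq_sub hv (param_lt hk).le]
    unfold rightEnd leftEnd
    ring
  have hpos : 0 < cosArg (Real.exp (2 / (k : ℝ) ^ 2)) (Real.exp (-(2 / (k : ℝ)))) x := by
    unfold cosArg
    positivity
  unfold density arccosDensity
  rw [Real.arccos_eq_arctan hpos, one_sub_cosArg_sq hc hx0, hp, hvp, hQ]
  generalize Real.exp (2 / (k : ℝ) ^ 2) = c at hc ⊢
  generalize Real.exp (-(2 / (k : ℝ))) = v at hv ⊢
  rw [Real.sqrt_div' _ (by positivity), Real.sqrt_div' _ (by positivity), Real.sqrt_sq hv.le,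
    Real.sqrt_sq (by positivity)]
  unfold cosArg
  have hs : 0 < √(c * x) := by positivity
  congr 1
  · field_simp
  · congr 1
    field_simp
    ring

lemma equilibrium_eq_withDensity (hk : 0 < k) :
    equilibrium k = (volume.restrict (Icc (leftEnd k) (rightEnd k))).withDensity
      fun x => ENNReal.ofReal (density k (leftEnd k) (rightEnd k) x) := by
  have h : equilibrium k = (volume.restrict (Icc (leftEnd k) (rightEnd k))).withDensity
      fun x => ENNReal.ofReal (arccosDensity ((k : ℝ) ^ 2 / 2)
        (Real.exp (2 / (k : ℝ) ^ 2)) (Real.exp (-(2 / (k : ℝ)))) x) :=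
    mixture_eq_withDensity_Icc (by positivity) (Real.exp_pos _) (param_lt hk)
  rw [h]
  apply withDensity_congr_ae
  filter_upwards [ae_restrict_mem measurableSet_Icc] with x hx
  rw [density_eq_arccosDensity hk hx]

lemma deriv_logWeight {s : ℂ} (hs : s ∈ Complex.slitPlane) :
    -deriv (logWeight k) s = ((k : ℂ) ^ 2 / 2 * Complex.log s + 1) / s := by
  have h0 : s ≠ 0 := Complex.slitPlane_ne_zero hs
  have hl := Complex.hasDerivAt_log hs
  have h := ((hl.pow 2).const_mul (-((k : ℂ) ^ 2 / 4))).sub hl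
  have h' : HasDerivAt (logWeight k) _ s := h
  rw [h'.deriv]
  field_simp
  push_cast
  ring

lemma differentiableOn_deriv_logWeight :
    DifferentiableOn ℂ (fun s => -deriv (logWeight k) s) Complex.slitPlane := by
  have h : DifferentiableOn ℂ (fun s => ((k : ℂ) ^ 2 / 2 * Complex.log s + 1) / s)
      Complex.slitPlane := fun s hs =>
    ((((Complex.hasDerivAt_log hs).differentiableAt.const_mul _).add_const _).div
      differentiableAt_id (Complex.slitPlane_ne_zero hs)).differentiableWithinAt
  exact h.congr fun s hs => deriv_logWeight hs

lemma deriv_logWeight_ofReal {y : ℝ} (hy : 0 < y) :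
    -deriv (logWeight k) (y : ℂ) = (((k : ℝ) ^ 2 / 2 * Real.log y + 1) / y : ℝ) := by
  rw [deriv_logWeight (Complex.ofReal_mem_slitPlane.2 hy)]
  push_cast
  rw [Complex.ofReal_log hy.le]

lemma density_eq_mul_hFun (hk : 0 < k) {x : ℝ} (hx : x ∈ Icc (leftEnd k) (rightEnd k)) {γ : ℝ → ℂ}
    (hγ : IsSimpleClosedContour γ)
    (hw : ∀ p ∈ Icc (leftEnd k) (rightEnd k), EnclosesCounterclockwise γ (p : ℂ))
    (hU : ∀ t ∈ Icc (0 : ℝ) 1, γ t ∈ Complex.slitPlane) :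
    (density k (leftEnd k) (rightEnd k) x : ℂ) =
      1 / (2 * Real.pi) * (√((rightEnd k - x) * (x - leftEnd k)) : ℝ) *
        hFun k (leftEnd k) (rightEnd k) γ (x : ℂ) := by
  have ha := leftEnd_pos hk
  have hab := leftEnd_lt_rightEnd hk
  have hx0 : 0 < x := ha.trans_le hx.1
  have hk0 : (0 : ℝ) < k := by exact_mod_cast hk
  have hbal := sqrt_leftEnd_add_sqrt_rightEnd hk
  generalize leftEnd k = a at *
  generalize rightEnd k = b at *
  -- At the endpoints both sides vanish; the arctangent evaluation is available only in the
  -- interior.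
  by_cases hg : (b - x) * (x - a) = 0
  · simp [density, hg]
  have hxo : x ∈ Ioo a b := by
    rw [mul_eq_zero, not_or] at hg
    exact ⟨lt_of_le_of_ne hx.1 fun h => hg.2 (by rw [h, sub_self]),
      lt_of_le_of_ne hx.2 fun h => hg.1 (by rw [h, sub_self])⟩
  have hy : ∀ θ : ℝ, 0 < (a + b) / 2 + (b - a) / 2 * Real.cos θ := by
    intro θ
    nlinarith [Real.neg_one_le_cos θ]
  have hr := integral_field_slope_arcsine (K := (k : ℝ) ^ 2 / 2) ha hxo
    (Real.exp_pos (2 / (k : ℝ) ^ 2)) (by positivity) (by rw [Real.log_exp]; field_simp) hbal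
  have hci := contourIntegral_div_sub_mul_sqrtR hγ hU ha hab hx hw
    (differentiableOn_deriv_logWeight (k := k))
  simp only [deriv_logWeight_ofReal hx0, deriv_logWeight_ofReal (hy _), ← Complex.ofReal_sub,
    ← Complex.ofReal_div] at hci
  rw [intervalIntegral.integral_ofReal, hr] at hci
  have hgpos : 0 < √((b - x) * (x - a)) :=
    Real.sqrt_pos.2 (mul_pos (sub_pos.2 hxo.2) (sub_pos.2 hxo.1))
  unfold hFun density
  rw [hci]
  generalize Real.arctan (√((b - x) * (x - a)) / (√(a * b) + x)) = A
  generalize √((b - x) * (x - a)) = g at hgpos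
  have hpi : (Real.pi : ℂ) ≠ 0 := by exact_mod_cast Real.pi_ne_zero
  have hgc : (g : ℂ) ≠ 0 := by exact_mod_cast hgpos.ne'
  have hxc : (x : ℂ) ≠ 0 := by exact_mod_cast hx0.ne'
  push_cast
  field_simp

end

end StieltjesWigert

theorem lemma4 (k : ℕ) (hk : 0 < k) :
    ∃ a b : ℝ, 0 < a ∧ a < b ∧
      √a = StieltjesWigert.sqrtA k ∧ √b = StieltjesWigert.sqrtB k ∧
      (∃! μ : MeasureTheory.Measure ℝ,
        StieltjesWigert.IsEquilibriumMeasure (StieltjesWigert.weight k) (k + 1) μ) ∧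
      (∀ μ : MeasureTheory.Measure ℝ,
        StieltjesWigert.IsEquilibriumMeasure (StieltjesWigert.weight k) (k + 1) μ →
          μ.support = Set.Icc a b ∧
          μ = (MeasureTheory.volume.restrict (Set.Icc a b)).withDensity
            (fun x => ENNReal.ofReal (StieltjesWigert.density k a b x))) ∧
      (∀ x ∈ Set.Icc a b, ∀ γ : ℝ → ℂ, StieltjesWigert.IsSimpleClosedContour γ →
        (∀ p ∈ Set.Icc a b, StieltjesWigert.EnclosesCounterclockwise γ (p : ℂ)) →
        (∀ t ∈ Set.Icc (0 : ℝ) 1, γ t ∈ Complex.slitPlane) →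
          (StieltjesWigert.density k a b x : ℂ) =
            1 / (2 * Real.pi) * (√((b - x) * (x - a)) : ℝ) *
              StieltjesWigert.hFun k a b γ (x : ℂ)) := by
  open StieltjesWigert in
  exact ⟨leftEnd k, rightEnd k, leftEnd_pos hk, leftEnd_lt_rightEnd hk, sqrt_leftEnd hk,
    sqrt_rightEnd hk,
    ⟨equilibrium k, isEquilibriumMeasure_equilibrium hk, fun _ h => h.eq_equilibrium hk⟩,
    fun μ h => by
      rw [h.eq_equilibrium hk]
      exact ⟨support_equilibrium hk, equilibrium_eq_withDensity hk⟩,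
    fun x hx γ hγ hw hU => density_eq_mul_hFun hk hx hγ hw hU⟩
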